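/- Let $R$ be an associative unital ring. All projective modules are finitely generated left $R$-modules. $K_0(R)$ is the abelian group generated by symbols $[P]$, $P$ projective, with relations $[P_2]=[P_1]+[P_3]$ whenever $P_2\cong P_1\oplus P_3$. $K_1(R)$ (written additively) is the abelian group generated by symbols $[(P,\alpha)]$, with $P$ projective and $\alpha\in\mathrm{Aut}(P)$, with relations $[(P,\alpha\beta)]=[(P,\alpha)]+[(P,\beta)]$ and $[(P_2,\alpha_2)]=[(P_1,\alpha_1)]+[(P_3,\alpha_3)]$ for every automorphism $(\alpha_1,\alpha_2,\alpha_3)$ of a short exact sequence $0\to P_1\to P_2\to P_3\to 0$. Let $\tau:K_0(R)\to K_1(R)$ be the homomorphism sending $[P]$ to the class of the transposition $(x,y)\mapsto(y,x)$ of $P\oplus P$. A closed $R$-decorated 1-foam $U$ is a finite oriented graph (loops, multiple edges and circles without vertices are allowed; circles count as edges) in which at every vertex either two edges merge into one or one edge splits into two, with a flat connection: a flat bundle of projective modules over each edge and, at each vertex, an isomorphism between the fiber of the thick edge and the direct sum of the fibers of the two (unordered) thin edges. $-U$ is $U$ with all orientations reversed. An $R$-decorated 2-foam $F$ with boundary is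 a compact two-dimensional complex, not embedded anywhere, made of oriented surfaces (facets) carrying flat bundles of projective modules. Two thin facets and one thick facet meet along a seam, with orientations flowing from the thin facets to the thick one, and a flat isomorphism $P_{12}\cong P_1\oplus P_2$ between the fibers is given there. Four seams meet at a vertex of $F$, whose link is the complete graph on four vertices, and there the two resulting decompositions $P_{123}\cong P_{12}\oplus P_3\cong P_1\oplus P_2\oplus P_3$ and $P_{123}\cong P_1\oplus P_{23}\cong P_1\oplus P_2\oplus P_3$ agree. The boundary $\partial F$, with the induced orientation, is a closed $R$-decorated 1-foam. Foams $U_0,U_1$ are cobordant if $\partial F\cong U_1\sqcup(-U_0)$ for some such $F$. The cobordism classes of closed $R$-decorated 1-foams form an abelian group $\mathsf{Cob}_1(R)$, with addition given by disjoint union and negation given by $U\mapsto -U$. A strong cut $B$ of $U$ consists of finitely many points, at least one, on each edge of $U$. It cuts $U$ into intervals and tripods. Let $P_B=\bigoplus_{b\in B}P_b$ be the sum of the fibers over the points of $B$, and let $f_B\in\mathrm{Aut}(P_B)$ be the sum, over all these intervals and tripods, of the isomorphisms given by the connection from the sum of the fibers over the incoming endpoints to the sum of the fibers over the outgoing endpoints.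 Theorem. There is an isomorphism of abelian groups $$\gamma:\ \mathsf{Cob}_1(R)\ \xrightarrow{\ \cong\ }\ K_1(R)/\tau(K_0(R))$$ such that, for every closed $R$-decorated 1-foam $U$ and every strong cut $B$ of $U$, $\gamma$ sends the cobordism class of $U$ to the class of $[(P_B,f_B)]$. -/

import Mathlib

universe u

noncomputable section

namespace RFoam

/-! ### Finitely generated projective modules, `K₀`, `K₁` and `τ` -/

/-- A finitely generated projective left `R`-module. -/
structure FGProj (R : Type u) [Ring R] where
  carrier : Type u
  [addCommGroup : AddCommGroup carrier]
  [module : Module R carrier]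
  [finite : Module.Finite R carrier]
  [projective : Module.Projective R carrier]

instance (R : Type u) [Ring R] : CoeSort (FGProj R) (Type u) := ⟨FGProj.carrier⟩

attribute [instance] FGProj.addCommGroup FGProj.module FGProj.finite FGProj.projective

section KTheory

variable (R : Type u) [Ring R]

variable {R} in
/-- The direct sum `P ⊕ Q`. -/
def FGProj.prod (P Q : FGProj R) : FGProj R where
  carrier := P × Q

variable {R} in
/-- A finite direct sum `⨁ i, P i`. -/
def FGProj.pi {ι : Type} [Finite ι] (P : ι → FGProj R) : FGProj R where
  carrier := ∀ i, P i
  projective := by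
    classical
    have := Fintype.ofFinite ι
    exact Module.Projective.of_equiv (DFinsupp.linearEquivFunOnFintype (R := R)
      (M := fun i => (P i).carrier))

/-- The relations `[P₂] = [P₁] + [P₃]` for `P₂ ≅ P₁ ⊕ P₃`. -/
def K0.relations : Set (FreeAbelianGroup (FGProj R)) :=
  {x | ∃ (P₁ P₂ P₃ : FGProj R) (_ : P₂ ≃ₗ[R] P₁ × P₃),
    x = FreeAbelianGroup.of P₂ - (FreeAbelianGroup.of P₁ + FreeAbelianGroup.of P₃)}

/-- The Grothendieck group `K₀(R)` of finitely generated projective `R`-modules. -/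
def K0 : Type (u + 1) := FreeAbelianGroup (FGProj R) ⧸ AddSubgroup.closure (K0.relations R)

instance : AddCommGroup (K0 R) :=
  inferInstanceAs (AddCommGroup
    (FreeAbelianGroup (FGProj R) ⧸ AddSubgroup.closure (K0.relations R)))

variable {R} in
/-- The symbol `[P]`. -/
def K0.cls (P : FGProj R) : K0 R :=
  QuotientAddGroup.mk' (AddSubgroup.closure (K0.relations R)) (FreeAbelianGroup.of P)

/-- Pairs `(P, α)` with `α` an automorphism of `P`. -/
structure K1.Gen where
  obj : FGProj R
  aut : obj ≃ₗ[R] obj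

/-- The relations of `K₁(R)`:  `[(P, α)] + [(P, β)] = [(P, αβ)]`, and
`[(P₂, α₂)] = [(P₁, α₁)] + [(P₃, α₃)]` for an automorphism `(α₁, α₂, α₃)` of a short exact
sequence `0 → P₁ → P₂ → P₃ → 0`. -/
inductive K1.IsRelation : FreeAbelianGroup (K1.Gen R) → Prop
  | mul (P : FGProj R) (α β : P ≃ₗ[R] P) :
      K1.IsRelation (FreeAbelianGroup.of ⟨P, α * β⟩ -
        (FreeAbelianGroup.of ⟨P, α⟩ + FreeAbelianGroup.of ⟨P, β⟩))
  | exact (P₁ P₂ P₃ : FGProj R) (i : P₁ →ₗ[R] P₂) (p : P₂ →ₗ[R] P₃)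
      (α₁ : P₁ ≃ₗ[R] P₁) (α₂ : P₂ ≃ₗ[R] P₂) (α₃ : P₃ ≃ₗ[R] P₃)
      (hi : Function.Injective i) (hip : Function.Exact i p) (hp : Function.Surjective p)
      (h₁ : ∀ x, i (α₁ x) = α₂ (i x)) (h₂ : ∀ x, p (α₂ x) = α₃ (p x)) :
      K1.IsRelation (FreeAbelianGroup.of ⟨P₂, α₂⟩ -
        (FreeAbelianGroup.of ⟨P₁, α₁⟩ + FreeAbelianGroup.of ⟨P₃, α₃⟩))

/-- The group `K₁(R)`, written additively: generators `[(P, α)]` modulo the relations above. -/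
def K1 : Type (u + 1) :=
  FreeAbelianGroup (K1.Gen R) ⧸ AddSubgroup.closure {x | K1.IsRelation R x}

instance : AddCommGroup (K1 R) :=
  inferInstanceAs (AddCommGroup
    (FreeAbelianGroup (K1.Gen R) ⧸ AddSubgroup.closure {x | K1.IsRelation R x}))

variable {R} in
/-- The class `[(P, α)]` of an automorphism `α` of `P`. -/
def K1.cls (P : FGProj R) (α : P ≃ₗ[R] P) : K1 R :=
  QuotientAddGroup.mk' (AddSubgroup.closure {x | K1.IsRelation R x})
    (FreeAbelianGroup.of ⟨P, α⟩)

variable {R} in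
/-- The class in `K₁(R)` of the transposition `(x, y) ↦ (y, x)` of `P ⊕ P`. -/
def transposition (P : FGProj R) : K1 R :=
  K1.cls (P.prod P) (LinearEquiv.prodComm R P P)

variable {R} in
theorem transposition_add (P₁ P₂ P₃ : FGProj R) (e : P₂ ≃ₗ[R] P₁ × P₃) :
    transposition P₂ = transposition P₁ + transposition P₃ := by
  have key := K1.IsRelation.exact (P₁.prod P₁) (P₂.prod P₂) (P₃.prod P₃)
    (LinearMap.prodMap (e.symm.toLinearMap ∘ₗ LinearMap.inl R P₁ P₃)
      (e.symm.toLinearMap ∘ₗ LinearMap.inl R P₁ P₃))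
    (LinearMap.prodMap (LinearMap.snd R P₁ P₃ ∘ₗ e.toLinearMap)
      (LinearMap.snd R P₁ P₃ ∘ₗ e.toLinearMap))
    (LinearEquiv.prodComm R P₁ P₁) (LinearEquiv.prodComm R P₂ P₂) (LinearEquiv.prodComm R P₃ P₃)
    (by
      rintro ⟨x, y⟩ ⟨x', y'⟩ h
      have h1 : ((x, 0) : P₁ × P₃) = (x', 0) := e.symm.injective (congrArg Prod.fst h)
      have h2 : ((y, 0) : P₁ × P₃) = (y', 0) := e.symm.injective (congrArg Prod.snd h)
      exact Prod.ext (Prod.mk.inj h1).1 (Prod.mk.inj h2).1)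
    (by
      rintro ⟨x, y⟩
      constructor
      · intro h
        have h1 : (e x).2 = 0 := congrArg Prod.fst h
        have h2 : (e y).2 = 0 := congrArg Prod.snd h
        refine ⟨((e x).1, (e y).1), Prod.ext ?_ ?_⟩
        · exact e.symm_apply_eq.2 (Prod.ext rfl h1.symm)
        · exact e.symm_apply_eq.2 (Prod.ext rfl h2.symm)
      · rintro ⟨⟨a, b⟩, h⟩
        rw [← h]
        refine Prod.ext ?_ ?_
        · change (e (e.symm (a, 0))).2 = 0
          rw [e.apply_symm_apply]
        · change (e (e.symm (b, 0))).2 = 0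
          rw [e.apply_symm_apply])
    (by
      rintro ⟨a, b⟩
      refine ⟨(e.symm (0, a), e.symm (0, b)), Prod.ext ?_ ?_⟩
      · change (e (e.symm (0, a))).2 = a
        rw [e.apply_symm_apply]
      · change (e (e.symm (0, b))).2 = b
        rw [e.apply_symm_apply])
    (fun _ => rfl) (fun _ => rfl)
  have h0 := (QuotientAddGroup.eq_zero_iff (N := AddSubgroup.closure {x | K1.IsRelation R x}) _).2
    (AddSubgroup.subset_closure key)
  rw [QuotientAddGroup.mk_sub, QuotientAddGroup.mk_add, sub_eq_zero] at h0
  exact h0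

/-- The homomorphism `τ : K₀(R) → K₁(R)`, sending `[P]` to the class of the transposition
automorphism of `P ⊕ P`. -/
def tau : K0 R →+ K1 R :=
  QuotientAddGroup.lift (AddSubgroup.closure (K0.relations R))
    (FreeAbelianGroup.lift transposition) (by
      rw [AddSubgroup.closure_le]
      rintro _ ⟨P₁, P₂, P₃, e, rfl⟩
      simp [transposition_add P₁ P₂ P₃ e])

theorem tau_cls (P : FGProj R) : tau R (K0.cls P) = transposition P :=
  FreeAbelianGroup.lift_apply_of _ _

end KTheory

/-! ### Oriented graphs with a flat connection -/

/-- A finite oriented graph (loops and multiple edges allowed) with a flat `R`-connection.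
An arc carries a flat bundle, that is a single module `fiber a`. At every vertex `v` there is an
isomorphism `⨁ (fiber a : a ends at v) ≃ ⨁ (fiber b : b begins at v)`. These isomorphisms are
recorded through their direct sum over all vertices, the automorphism `transport` of the sum of
all fibers: `transport_local` says that `transport` is such a direct sum. -/
structure FlatGraph (R : Type u) [Ring R] where
  Arc : Type
  Vert : Type
  finite_arc : Finite Arc
  finite_vert : Finite Vert
  src : Arc → Vert
  tgt : Arc → Vert
  fiber : Arc → FGProj R
  transport : (∀ a, fiber a) ≃ₗ[R] (∀ a, fiber a)
  transport_local : ∀ (x y : ∀ a, fiber a) (b : Arc),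
    (∀ a, tgt a = src b → x a = y a) → transport x b = transport y b

namespace FlatGraph

variable {R : Type u} [Ring R]

attribute [instance] FlatGraph.finite_arc FlatGraph.finite_vert

/-- The number of arcs ending at `v`. -/
def inDeg (G : FlatGraph R) (v : G.Vert) : ℕ := Nat.card {a // G.tgt a = v}

/-- The number of arcs beginning at `v`. -/
def outDeg (G : FlatGraph R) (v : G.Vert) : ℕ := Nat.card {a // G.src a = v}

/-- Isomorphism of oriented graphs with flat connections. -/
structure Iso (G G' : FlatGraph R) where
  arc : G.Arc ≃ G'.Arc
  vert : G.Vert ≃ G'.Vert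
  src_arc : ∀ a, G'.src (arc a) = vert (G.src a)
  tgt_arc : ∀ a, G'.tgt (arc a) = vert (G.tgt a)
  fiber : ∀ a, G.fiber a ≃ₗ[R] G'.fiber (arc a)
  transport : ∀ (x : ∀ a, G.fiber a) (y : ∀ a, G'.fiber a),
    (∀ a, y (arc a) = fiber a (x a)) →
      ∀ a, G'.transport y (arc a) = fiber a (G.transport x a)

theorem transport_symm_local (G : FlatGraph R) (x y : ∀ a, G.fiber a) (b : G.Arc)
    (h : ∀ a, G.src a = G.tgt b → x a = y a) :
    G.transport.symm x b = G.transport.symm y b := by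
  classical
  obtain ⟨p, rfl⟩ := G.transport.surjective x
  obtain ⟨q, rfl⟩ := G.transport.surjective y
  simp only [LinearEquiv.symm_apply_apply]
  let q' : ∀ a, G.fiber a := fun a => if G.tgt a = G.tgt b then q a else p a
  have h1 : G.transport p = G.transport q' := by
    funext a
    by_cases ha : G.src a = G.tgt b
    · rw [h a ha]
      exact G.transport_local _ _ _ fun c hc => by simp [q', hc.trans ha]
    · exact G.transport_local _ _ _ fun c hc => by
        have : G.tgt c ≠ G.tgt b := fun h => ha (hc.symm.trans h)
        simp [q', this]
  have h2 := congrFun (G.transport.injective h1) b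
  simpa [q'] using h2

/-- Orientation reversal, retaining the connection. -/
def reverse (G : FlatGraph R) : FlatGraph R where
  Arc := G.Arc
  Vert := G.Vert
  finite_arc := G.finite_arc
  finite_vert := G.finite_vert
  src := G.tgt
  tgt := G.src
  fiber := G.fiber
  transport := G.transport.symm
  transport_local := G.transport_symm_local

/-- The disjoint union of a finite family. -/
def sigma {ι : Type} [Finite ι] (M : ι → FlatGraph R) : FlatGraph R where
  Arc := Σ i, (M i).Arc
  Vert := Σ i, (M i).Vert
  finite_arc := inferInstance
  finite_vert := inferInstance
  src a := ⟨a.1, (M a.1).src a.2⟩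
  tgt a := ⟨a.1, (M a.1).tgt a.2⟩
  fiber a := (M a.1).fiber a.2
  transport :=
    { toFun := fun x a => (M a.1).transport (fun b => x ⟨a.1, b⟩) a.2
      invFun := fun x a => (M a.1).transport.symm (fun b => x ⟨a.1, b⟩) a.2
      map_add' := fun x y => by
        funext a
        exact congrFun ((M a.1).transport.map_add (fun b => x ⟨a.1, b⟩) (fun b => y ⟨a.1, b⟩)) a.2
      map_smul' := fun c x => by
        funext a
        exact congrFun ((M a.1).transport.map_smul c (fun b => x ⟨a.1, b⟩)) a.2
      left_inv := fun x => by
        funext a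
        exact congrFun ((M a.1).transport.symm_apply_apply (fun b => x ⟨a.1, b⟩)) a.2
      right_inv := fun x => by
        funext a
        exact congrFun ((M a.1).transport.apply_symm_apply (fun b => x ⟨a.1, b⟩)) a.2 }
  transport_local := by
    rintro x y ⟨i, b⟩ h
    exact (M i).transport_local _ _ _ fun a ha => h ⟨i, a⟩ (by rw [ha])

/-- The disjoint union of two graphs. -/
def sum (G G' : FlatGraph R) : FlatGraph R where
  Arc := G.Arc ⊕ G'.Arc
  Vert := G.Vert ⊕ G'.Vert
  finite_arc := inferInstance
  finite_vert := inferInstance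
  src := Sum.map G.src G'.src
  tgt := Sum.map G.tgt G'.tgt
  fiber := Sum.elim G.fiber G'.fiber
  transport :=
    { toFun := fun x s => match s with
        | Sum.inl a => G.transport (fun b => x (Sum.inl b)) a
        | Sum.inr a => G'.transport (fun b => x (Sum.inr b)) a
      invFun := fun x s => match s with
        | Sum.inl a => G.transport.symm (fun b => x (Sum.inl b)) a
        | Sum.inr a => G'.transport.symm (fun b => x (Sum.inr b)) a
      map_add' := fun x y => by
        funext s
        rcases s with a | a
        · exact congrFun (G.transport.map_add (fun b => x (Sum.inl b)) (fun b => y (Sum.inl b))) a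
        · exact congrFun (G'.transport.map_add (fun b => x (Sum.inr b)) (fun b => y (Sum.inr b))) a
      map_smul' := fun c x => by
        funext s
        rcases s with a | a
        · exact congrFun (G.transport.map_smul c (fun b => x (Sum.inl b))) a
        · exact congrFun (G'.transport.map_smul c (fun b => x (Sum.inr b))) a
      left_inv := fun x => by
        funext s
        rcases s with a | a
        · exact congrFun (G.transport.symm_apply_apply (fun b => x (Sum.inl b))) a
        · exact congrFun (G'.transport.symm_apply_apply (fun b => x (Sum.inr b))) a
      right_inv := fun x => by
        funext s
        rcases s with a | a
        · exact congrFun (G.transport.apply_symm_apply (fun b => x (Sum.inl b))) a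
        · exact congrFun (G'.transport.apply_symm_apply (fun b => x (Sum.inr b))) a }
  transport_local := by
    rintro x y (b | b) h
    · exact G.transport_local _ _ _ fun a ha => h (Sum.inl a) (congrArg Sum.inl ha)
    · exact G'.transport_local _ _ _ fun a ha => h (Sum.inr a) (congrArg Sum.inr ha)

/-- The empty graph. -/
def empty : FlatGraph R where
  Arc := Empty
  Vert := Empty
  finite_arc := inferInstance
  finite_vert := inferInstance
  src := id
  tgt := id
  fiber := Empty.elim
  transport := LinearEquiv.refl R _
  transport_local := fun _ _ b => b.elim

/-- Subdivision: the arc `a` is cut by `r a` new vertices into the consecutive arcs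
`(a, 0), …, (a, r a)`, with identity transport at the new vertices. -/
def subdivide (G : FlatGraph R) (r : G.Arc → ℕ) : FlatGraph R where
  Arc := Σ a, Fin (r a + 1)
  Vert := G.Vert ⊕ (Σ a, Fin (r a))
  finite_arc := inferInstance
  finite_vert := inferInstance
  src s := Fin.cases (motive := fun _ => G.Vert ⊕ (Σ a, Fin (r a)))
    (Sum.inl (G.src s.1)) (fun j => Sum.inr ⟨s.1, j⟩) s.2
  tgt s := Fin.lastCases (motive := fun _ => G.Vert ⊕ (Σ a, Fin (r a)))
    (Sum.inl (G.tgt s.1)) (fun j => Sum.inr ⟨s.1, j⟩) s.2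
  fiber s := G.fiber s.1
  transport :=
    { toFun := fun x s => Fin.cases (motive := fun _ => G.fiber s.1)
        (G.transport (fun b => x ⟨b, Fin.last (r b)⟩) s.1) (fun j => x ⟨s.1, j.castSucc⟩) s.2
      invFun := fun x s => Fin.lastCases (motive := fun _ => G.fiber s.1)
        (G.transport.symm (fun b => x ⟨b, 0⟩) s.1) (fun j => x ⟨s.1, j.succ⟩) s.2
      map_add' := fun x y => by
        funext ⟨a, i⟩
        refine Fin.cases ?_ (fun j => ?_) i
        · exact congrFun (G.transport.map_add (fun b => x ⟨b, Fin.last (r b)⟩)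
            (fun b => y ⟨b, Fin.last (r b)⟩)) a
        · rfl
      map_smul' := fun c x => by
        funext ⟨a, i⟩
        refine Fin.cases ?_ (fun j => ?_) i
        · exact congrFun (G.transport.map_smul c (fun b => x ⟨b, Fin.last (r b)⟩)) a
        · rfl
      left_inv := fun x => by
        funext ⟨a, i⟩
        refine Fin.lastCases ?_ (fun j => ?_) i
        · simp
        · simp
      right_inv := fun x => by
        funext ⟨a, i⟩
        refine Fin.cases ?_ (fun j => ?_) i
        · simp
        · simp }
  transport_local := by
    rintro x y ⟨b, i⟩ h
    revert h
    refine Fin.cases (fun h => ?_) (fun j h => ?_) i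
    · exact G.transport_local _ _ _ fun a ha => h ⟨a, Fin.last (r a)⟩ (by simp [ha])
    · exact h ⟨b, j.castSucc⟩ (by simp)


/-- A loop with one vertex and trivial monodromy. -/
def IsCircleLink (M : FlatGraph R) : Prop :=
  ∃ (a : M.Arc) (v : M.Vert), (∀ b, b = a) ∧ (∀ w, w = v) ∧
    ∀ ξ : M.fiber a, ∃ x, M.transport x = x ∧ x a = ξ

/-- A theta graph: the arc `a₁₂` splits at `w` into `a₁, a₂`, which merge at `v` into `a₁₂`.
The two decompositions of `P₁₂` coincide: each vector of `P₁₂` extends to a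
parallel section, i.e. splitting and merging compose to the identity. -/
def IsThetaLink (M : FlatGraph R) : Prop :=
  ∃ (a₁ a₂ a₁₂ : M.Arc) (v w : M.Vert),
    [a₁, a₂, a₁₂].Nodup ∧ (∀ b, b ∈ [a₁, a₂, a₁₂]) ∧ v ≠ w ∧ (∀ z, z = v ∨ z = w) ∧
    M.src a₁ = w ∧ M.tgt a₁ = v ∧ M.src a₂ = w ∧ M.tgt a₂ = v ∧ M.src a₁₂ = v ∧ M.tgt a₁₂ = w ∧
    ∀ ξ : M.fiber a₁₂, ∃ x, M.transport x = x ∧ x a₁₂ = ξ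

/-- A complete graph on four vertices: `a₁₂₃` splits at `v₁` into `a₁₂, a₃`, then `a₁₂` splits at
`v₂` into `a₁, a₂`, then `a₂, a₃` merge at `v₃` into `a₂₃`, and `a₁, a₂₃` merge at `v₄` into
`a₁₂₃`. The composite
`P₁₂₃ → P₁₂ ⊕ P₃ → P₁ ⊕ P₂ ⊕ P₃ → P₁ ⊕ P₂₃ → P₁₂₃` is the identity: each vector of `P₁₂₃`
extends to a parallel section. (Exchanging `1` and `3` gives the reversed orientation.) -/
def IsTetrahedronLink (M : FlatGraph R) : Prop :=
  ∃ (a₁ a₂ a₃ a₁₂ a₂₃ a₁₂₃ : M.Arc) (v₁ v₂ v₃ v₄ : M.Vert),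
    [a₁, a₂, a₃, a₁₂, a₂₃, a₁₂₃].Nodup ∧ (∀ b, b ∈ [a₁, a₂, a₃, a₁₂, a₂₃, a₁₂₃]) ∧
    [v₁, v₂, v₃, v₄].Nodup ∧ (∀ z, z ∈ [v₁, v₂, v₃, v₄]) ∧
    M.tgt a₁₂₃ = v₁ ∧ M.src a₁₂ = v₁ ∧ M.src a₃ = v₁ ∧
    M.tgt a₁₂ = v₂ ∧ M.src a₁ = v₂ ∧ M.src a₂ = v₂ ∧
    M.tgt a₂ = v₃ ∧ M.tgt a₃ = v₃ ∧ M.src a₂₃ = v₃ ∧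
    M.tgt a₁ = v₄ ∧ M.tgt a₂₃ = v₄ ∧ M.src a₁₂₃ = v₄ ∧
    ∀ ξ : M.fiber a₁₂₃, ∃ x, M.transport x = x ∧ x a₁₂₃ = ξ

/-- The links (with their connections) of the three types of interior points of an `R`-decorated
2-foam: points of facets, points of seams, and vertices where four seams meet. -/
def IsVertexLink (M : FlatGraph R) : Prop :=
  M.IsCircleLink ∨ M.IsThetaLink ∨ M.IsTetrahedronLink

end FlatGraph

/-! ### Closed 1-foams -/

/-- A closed `R`-decorated 1-foam. Every vertex is an `in` vertex (two arcs merge), an `out` vertex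
(an arc splits), or the base point of a circle without vertices. Thus arcs of the graph are
exactly the edges of the foam, where circles count as edges. -/
structure OneFoam (R : Type u) [Ring R] extends FlatGraph R where
  valence : ∀ v, (toFlatGraph.inDeg v = 2 ∧ toFlatGraph.outDeg v = 1) ∨
    (toFlatGraph.inDeg v = 1 ∧ toFlatGraph.outDeg v = 2) ∨
    (toFlatGraph.inDeg v = 1 ∧ toFlatGraph.outDeg v = 1 ∧
      ∃ a, toFlatGraph.src a = v ∧ toFlatGraph.tgt a = v)

namespace OneFoam

variable {R : Type u} [Ring R]

/-- The foam `-U`: orientation reversal. -/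
def reverse (U : OneFoam R) : OneFoam R where
  toFlatGraph := U.toFlatGraph.reverse
  valence v := by
    rcases U.valence v with ⟨h, h'⟩ | ⟨h, h'⟩ | ⟨h, h', a, ha, ha'⟩
    · exact Or.inr (Or.inl ⟨h', h⟩)
    · exact Or.inl ⟨h', h⟩
    · exact Or.inr (Or.inr ⟨h', h, a, ha', ha⟩)

theorem _root_.RFoam.card_fiber_inl {A B V W : Type} (f : A → V) (g : B → W) (v : V) :
    Nat.card {s : A ⊕ B // Sum.map f g s = Sum.inl v} = Nat.card {a // f a = v} :=
  Nat.card_congr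
    { toFun := fun s => match s with
        | ⟨Sum.inl a, h⟩ => ⟨a, Sum.inl_injective h⟩
        | ⟨Sum.inr _, h⟩ => absurd h (by simp)
      invFun := fun a => ⟨Sum.inl a.1, congrArg Sum.inl a.2⟩
      left_inv := by rintro ⟨a | b, h⟩ <;> [rfl; exact absurd h (by simp)]
      right_inv := fun _ => rfl }

theorem _root_.RFoam.card_fiber_inr {A B V W : Type} (f : A → V) (g : B → W) (w : W) :
    Nat.card {s : A ⊕ B // Sum.map f g s = Sum.inr w} = Nat.card {b // g b = w} :=
  Nat.card_congr
    { toFun := fun s => match s with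
        | ⟨Sum.inr b, h⟩ => ⟨b, Sum.inr_injective h⟩
        | ⟨Sum.inl _, h⟩ => absurd h (by simp)
      invFun := fun b => ⟨Sum.inr b.1, congrArg Sum.inr b.2⟩
      left_inv := by rintro ⟨a | b, h⟩ <;> [exact absurd h (by simp); rfl]
      right_inv := fun _ => rfl }

/-- The disjoint union `U ⊔ W`. -/
def sum (U W : OneFoam R) : OneFoam R where
  toFlatGraph := U.toFlatGraph.sum W.toFlatGraph
  valence := by
    rintro (v | v)
    · have h1 : (U.toFlatGraph.sum W.toFlatGraph).inDeg (Sum.inl v) = U.inDeg v :=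
        card_fiber_inl _ _ _
      have h2 : (U.toFlatGraph.sum W.toFlatGraph).outDeg (Sum.inl v) = U.outDeg v :=
        card_fiber_inl _ _ _
      rw [h1, h2]
      rcases U.valence v with h | h | ⟨h, h', a, ha, ha'⟩
      · exact Or.inl h
      · exact Or.inr (Or.inl h)
      · exact Or.inr (Or.inr ⟨h, h', Sum.inl a, congrArg Sum.inl ha, congrArg Sum.inl ha'⟩)
    · have h1 : (U.toFlatGraph.sum W.toFlatGraph).inDeg (Sum.inr v) = W.inDeg v :=
        card_fiber_inr _ _ _
      have h2 : (U.toFlatGraph.sum W.toFlatGraph).outDeg (Sum.inr v) = W.outDeg v :=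
        card_fiber_inr _ _ _
      rw [h1, h2]
      rcases W.valence v with h | h | ⟨h, h', a, ha, ha'⟩
      · exact Or.inl h
      · exact Or.inr (Or.inl h)
      · exact Or.inr (Or.inr ⟨h, h', Sum.inr a, congrArg Sum.inr ha, congrArg Sum.inr ha'⟩)

/-- The empty foam. -/
def empty : OneFoam R where
  toFlatGraph := FlatGraph.empty
  valence v := v.elim

/-- A strong cut of `U`: a finite non-empty set of points on each edge. Only the number of points
matters; the edge `u` carries the points `(u, 0), …, (u, B u)`, in the order given by the
orientation of `u`. -/
def StrongCut (U : OneFoam R) : Type := U.Arc → ℕ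

/-- `P_B`, the direct sum of the fibers over the points of the strong cut `B`. -/
def cutModule (U : OneFoam R) (B : U.StrongCut) : FGProj R :=
  FGProj.pi (U.subdivide B).fiber

/-- The automorphism `f_B` of `P_B`, the sum of the transport maps over all intervals and tripods
into which `B` cuts `U`: it is the identity from the point `(u, i)` to the next point `(u, i + 1)`
of the same edge, and from the last points of the edges ending at a vertex to the first points
of the edges beginning there it is the isomorphism of `U` at that vertex. -/
def cutMap (U : OneFoam R) (B : U.StrongCut) : U.cutModule B ≃ₗ[R] U.cutModule B :=
  (U.subdivide B).transport

end OneFoam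

/-! ### 2-foams with boundary -/

/-- A finite complex of oriented polygons with a flat `R`-connection, used to present 2-foams with
boundary: a compact 2-foam, with each boundary component collapsed to a point, is cut
into polygons; the foam is recovered by cutting off the corners at the collapsed points. The polygon `c` has
`n c + 1` sides, in the cyclic order given by its orientation, and carries the module `fiber c`.
The sides are glued to edges; `sgn s` tells whether the orientation of the polygon along `s` agrees
with that of the edge. An edge has one side of each sign (an edge inside a facet), or one side
of one sign, the thick one, and two of the other sign, the thin ones (a seam). At an edge there is
an isomorphism between the sum of the modules on its positive sides and the sum of
the modules on its negative sides; `glue` is the sum over all edges of these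
isomorphisms and of their inverses. -/
structure PolygonComplex (R : Type u) [Ring R] where
  Poly : Type
  Edge : Type
  finite_poly : Finite Poly
  finite_edge : Finite Edge
  n : Poly → ℕ
  fiber : Poly → FGProj R
  edge : (Σ c, Fin (n c + 1)) → Edge
  sgn : (Σ c, Fin (n c + 1)) → Bool
  valence : ∀ k,
    (Nat.card {s // edge s = k ∧ sgn s = true}, Nat.card {s // edge s = k ∧ sgn s = false}) ∈
      ({(1, 1), (1, 2), (2, 1)} : Set (ℕ × ℕ))
  glue : (∀ s : (Σ c, Fin (n c + 1)), fiber s.1) ≃ₗ[R] (∀ s : (Σ c, Fin (n c + 1)), fiber s.1)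
  glue_glue : ∀ x, glue (glue x) = x
  glue_local : ∀ (x y : ∀ s : (Σ c, Fin (n c + 1)), fiber s.1) (s : (Σ c, Fin (n c + 1))),
    (∀ t, edge t = edge s → sgn t ≠ sgn s → x t = y t) → glue x s = glue y s

namespace PolygonComplex

variable {R : Type u} [Ring R]

attribute [instance] finite_poly finite_edge

/-- The sides of the polygons. -/
abbrev Side (F : PolygonComplex R) : Type := Σ c, Fin (F.n c + 1)

/-- The side following `s` in its polygon. -/
def next (F : PolygonComplex R) (s : F.Side) : F.Side := ⟨s.1, s.2 + 1⟩

/-- The side preceding `s` in its polygon. -/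
def prev (F : PolygonComplex R) (s : F.Side) : F.Side := ⟨s.1, s.2 - 1⟩

/-- Shift along the corners of the polygons: the value at the corner before `s` becomes the
value at the side `s`. -/
def shift (F : PolygonComplex R) :
    (∀ s : F.Side, F.fiber s.1) ≃ₗ[R] (∀ s : F.Side, F.fiber s.1) where
  toFun x s := x (F.prev s)
  invFun x s := x (F.next s)
  map_add' _ _ := rfl
  map_smul' _ _ := rfl
  left_inv x := by
    funext ⟨c, i⟩
    let y : Fin (F.n c + 1) → F.fiber c := fun j => x ⟨c, j⟩
    exact congrArg y (add_sub_cancel_right i 1)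
  right_inv x := by
    funext ⟨c, i⟩
    let y : Fin (F.n c + 1) → F.fiber c := fun j => x ⟨c, j⟩
    exact congrArg y (sub_add_cancel i 1)

/-- The disjoint union of the links of the vertices of the complex. Its arcs are the corners of
the polygons, the corner `s` being the one between the sides `s` and `next s`; its vertices are
the two ends (`true` is the head) of each edge. The corner `s` is oriented from `s` to `next s`, as
the boundary arc that appears when the corner is cut off. -/
def link (F : PolygonComplex R) : FlatGraph R where
  Arc := F.Side
  Vert := F.Edge × Bool
  finite_arc := inferInstance
  finite_vert := inferInstance
  src s := (F.edge s, F.sgn s)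
  tgt s := (F.edge (F.next s), !F.sgn (F.next s))
  fiber s := F.fiber s.1
  transport := F.shift.trans F.glue
  transport_local := by
    intro x y s h
    refine F.glue_local _ _ _ fun t ht hs => h (F.prev t) ?_
    have hn : F.next (F.prev t) = t := by
      rcases t with ⟨c, i⟩
      exact congrArg (Sigma.mk c) (sub_add_cancel i 1)
    rw [hn, ht]
    refine Prod.ext rfl ?_
    revert hs
    cases F.sgn t <;> cases F.sgn s <;> simp

/-- `F`, with corners of its polygons cut off at some of its vertices, is an `R`-decorated 2-foam
with oriented boundary `X`: the arcs along which corners are cut off form the 1-foam `X` (subdivided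
at the ends of edges of `F`), and all other vertices have the links of interior points of a 2-foam
(again subdivided at the ends of edges of `F`). -/
def IsFoamWithBoundary (F : PolygonComplex R) (X : OneFoam R) : Prop :=
  ∃ (ι : Type) (_ : Finite ι) (M : ι → FlatGraph R), (∀ i, (M i).IsVertexLink) ∧
    ∃ r : (X.toFlatGraph.sum (FlatGraph.sigma M)).Arc → ℕ,
      Nonempty (FlatGraph.Iso F.link ((X.toFlatGraph.sum (FlatGraph.sigma M)).subdivide r))

end PolygonComplex

/-- `U₀` and `U₁` are cobordant: there is an `R`-decorated 2-foam with boundary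
`(-U₀) ⊔ U₁`. -/
def Cobordant {R : Type u} [Ring R] (U₀ U₁ : OneFoam R) : Prop :=
  ∃ F : PolygonComplex R, F.IsFoamWithBoundary (U₀.reverse.sum U₁)


/-! ### Elementary properties of cobordism -/

namespace FlatGraph

variable {R : Type u} [Ring R]

namespace Iso

def refl (G : FlatGraph R) : Iso G G where
  arc := Equiv.refl _
  vert := Equiv.refl _
  src_arc _ := rfl
  tgt_arc _ := rfl
  fiber _ := LinearEquiv.refl R _
  transport x y h a := by
    have : y = x := funext h
    subst this
    rfl

def trans {G G' G'' : FlatGraph R} (e : Iso G G') (e' : Iso G' G'') : Iso G G'' where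
  arc := e.arc.trans e'.arc
  vert := e.vert.trans e'.vert
  src_arc a := by simp [e.src_arc, e'.src_arc]
  tgt_arc a := by simp [e.tgt_arc, e'.tgt_arc]
  fiber a := (e.fiber a).trans (e'.fiber (e.arc a))
  transport x y h a := by
    let z : ∀ a, G'.fiber a := fun a => (e'.fiber a).symm (y (e'.arc a))
    have hz : ∀ a, z (e.arc a) = e.fiber a (x a) := fun a =>
      (e'.fiber _).symm_apply_eq.2 (h a)
    have h1 := e.transport x z hz a
    have h2 := e'.transport z y (fun a => ((e'.fiber a).apply_symm_apply _).symm) (e.arc a)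
    exact h2.trans (congrArg (e'.fiber _) h1)

def symm {G G' : FlatGraph R} (e : Iso G G') : Iso G' G where
  arc := e.arc.symm
  vert := e.vert.symm
  src_arc a := by
    rw [Equiv.eq_symm_apply, ← e.src_arc, Equiv.apply_symm_apply]
  tgt_arc a := by
    rw [Equiv.eq_symm_apply, ← e.tgt_arc, Equiv.apply_symm_apply]
  fiber a := (LinearEquiv.cast (R := R) (M := fun b => G'.fiber b)
    (e.arc.apply_symm_apply a).symm).trans (e.fiber (e.arc.symm a)).symm
  transport x y h a := by
    have hc : ∀ (z : ∀ a, G'.fiber a) (a b : G'.Arc) (hab : a = b),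
        LinearEquiv.cast (R := R) (M := fun b => G'.fiber b) hab (z a) = z b := by
      rintro z a _ rfl
      rfl
    simp only [LinearEquiv.trans_apply, hc] at h ⊢
    obtain ⟨b, rfl⟩ := e.arc.surjective a
    have hx : ∀ b, x (e.arc b) = e.fiber b (y b) := by
      intro b
      have := h (e.arc b)
      rw [LinearEquiv.eq_symm_apply] at this
      have key : ∀ c, c = b → e.fiber c (y c) = x (e.arc c) →
          x (e.arc b) = e.fiber b (y b) := by
        rintro _ rfl h
        exact h.symm
      exact key _ (e.arc.symm_apply_apply b) this
    rw [LinearEquiv.eq_symm_apply]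
    exact (e.transport y x hx _).symm


def sumCongr {G G' H H' : FlatGraph R} (e : Iso G G') (f : Iso H H') :
    Iso (G.sum H) (G'.sum H') where
  arc := Equiv.sumCongr e.arc f.arc
  vert := Equiv.sumCongr e.vert f.vert
  src_arc := by
    rintro (a | a)
    · exact congrArg Sum.inl (e.src_arc a)
    · exact congrArg Sum.inr (f.src_arc a)
  tgt_arc := by
    rintro (a | a)
    · exact congrArg Sum.inl (e.tgt_arc a)
    · exact congrArg Sum.inr (f.tgt_arc a)
  fiber s := match s with
    | Sum.inl a => e.fiber a
    | Sum.inr a => f.fiber a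
  transport := by
    rintro x y h (a | a)
    · exact e.transport (fun b => x (Sum.inl b)) (fun b => y (Sum.inl b))
        (fun b => h (Sum.inl b)) a
    · exact f.transport (fun b => x (Sum.inr b)) (fun b => y (Sum.inr b))
        (fun b => h (Sum.inr b)) a

def sumComm (G H : FlatGraph R) : Iso (G.sum H) (H.sum G) where
  arc := Equiv.sumComm _ _
  vert := Equiv.sumComm _ _
  src_arc := by rintro (a | a) <;> rfl
  tgt_arc := by rintro (a | a) <;> rfl
  fiber s := match s with
    | Sum.inl a => LinearEquiv.refl R (G.fiber a)
    | Sum.inr a => LinearEquiv.refl R (H.fiber a)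
  transport := by
    rintro x y h (a | a)
    · exact congrArg (fun z => G.transport z a) (funext fun b => h (Sum.inl b))
    · exact congrArg (fun z => H.transport z a) (funext fun b => h (Sum.inr b))

def sumAssoc (G H K : FlatGraph R) : Iso ((G.sum H).sum K) (G.sum (H.sum K)) where
  arc := Equiv.sumAssoc _ _ _
  vert := Equiv.sumAssoc _ _ _
  src_arc := by rintro ((a | a) | a) <;> rfl
  tgt_arc := by rintro ((a | a) | a) <;> rfl
  fiber s := match s with
    | Sum.inl (Sum.inl a) => LinearEquiv.refl R (G.fiber a)
    | Sum.inl (Sum.inr a) => LinearEquiv.refl R (H.fiber a)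
    | Sum.inr a => LinearEquiv.refl R (K.fiber a)
  transport := by
    rintro x y h ((a | a) | a)
    · exact congrArg (fun z => G.transport z a) (funext fun b => h (Sum.inl (Sum.inl b)))
    · exact congrArg (fun z => H.transport z a) (funext fun b => h (Sum.inl (Sum.inr b)))
    · exact congrArg (fun z => K.transport z a) (funext fun b => h (Sum.inr b))

def sumSumSumComm (G H K L : FlatGraph R) :
    Iso ((G.sum H).sum (K.sum L)) ((G.sum K).sum (H.sum L)) where
  arc := Equiv.sumSumSumComm _ _ _ _
  vert := Equiv.sumSumSumComm _ _ _ _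
  src_arc := by rintro ((a | a) | (a | a)) <;> rfl
  tgt_arc := by rintro ((a | a) | (a | a)) <;> rfl
  fiber s := match s with
    | Sum.inl (Sum.inl a) => LinearEquiv.refl R (G.fiber a)
    | Sum.inl (Sum.inr a) => LinearEquiv.refl R (H.fiber a)
    | Sum.inr (Sum.inl a) => LinearEquiv.refl R (K.fiber a)
    | Sum.inr (Sum.inr a) => LinearEquiv.refl R (L.fiber a)
  transport := by
    rintro x y h ((a | a) | (a | a))
    · exact congrArg (fun z => G.transport z a) (funext fun b => h (Sum.inl (Sum.inl b)))
    · exact congrArg (fun z => H.transport z a) (funext fun b => h (Sum.inl (Sum.inr b)))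
    · exact congrArg (fun z => K.transport z a) (funext fun b => h (Sum.inr (Sum.inl b)))
    · exact congrArg (fun z => L.transport z a) (funext fun b => h (Sum.inr (Sum.inr b)))

def emptySum (G : FlatGraph R) : Iso (empty.sum G) G where
  arc := Equiv.emptySum Empty _
  vert := Equiv.emptySum Empty _
  src_arc := by rintro (a | a) <;> [exact a.elim; rfl]
  tgt_arc := by rintro (a | a) <;> [exact a.elim; rfl]
  fiber s := match s with
    | Sum.inl a => a.elim
    | Sum.inr a => LinearEquiv.refl R (G.fiber a)
  transport := by
    rintro x y h (a | a)
    · exact a.elim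
    · exact congrArg (fun z => G.transport z a) (funext fun b => h (Sum.inr b))

def reverseSum (G H : FlatGraph R) : Iso (G.sum H).reverse (G.reverse.sum H.reverse) where
  arc := Equiv.refl _
  vert := Equiv.refl _
  src_arc := by rintro (a | a) <;> rfl
  tgt_arc := by rintro (a | a) <;> rfl
  fiber s := match s with
    | Sum.inl a => LinearEquiv.refl R (G.fiber a)
    | Sum.inr a => LinearEquiv.refl R (H.fiber a)
  transport := by
    rintro x y h (a | a)
    · exact congrArg (fun z => G.transport.symm z a) (funext fun b => h (Sum.inl b))
    · exact congrArg (fun z => H.transport.symm z a) (funext fun b => h (Sum.inr b))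

def sigmaSum {ι κ : Type} [Finite ι] [Finite κ] (M : ι → FlatGraph R) (N : κ → FlatGraph R) :
    Iso (sigma (Sum.elim M N)) ((sigma M).sum (sigma N)) where
  arc := Equiv.sumSigmaDistrib _
  vert := Equiv.sumSigmaDistrib _
  src_arc := by rintro ⟨i | i, a⟩ <;> rfl
  tgt_arc := by rintro ⟨i | i, a⟩ <;> rfl
  fiber s := match s with
    | ⟨Sum.inl i, a⟩ => LinearEquiv.refl R ((M i).fiber a)
    | ⟨Sum.inr i, a⟩ => LinearEquiv.refl R ((N i).fiber a)
  transport := by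
    rintro x y h ⟨i | i, a⟩
    · exact congrArg (fun z => (M i).transport z a) (funext fun b => h ⟨Sum.inl i, b⟩)
    · exact congrArg (fun z => (N i).transport z a) (funext fun b => h ⟨Sum.inr i, b⟩)

def sumSigmaEmpty {ι : Type} [Finite ι] [IsEmpty ι] (G : FlatGraph R) (M : ι → FlatGraph R) :
    Iso (G.sum (sigma M)) G where
  arc := Equiv.sumEmpty _ (Σ i, (M i).Arc)
  vert := Equiv.sumEmpty _ (Σ i, (M i).Vert)
  src_arc := by rintro (a | a) <;> [rfl; exact isEmptyElim a.1]
  tgt_arc := by rintro (a | a) <;> [rfl; exact isEmptyElim a.1]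
  fiber s := match s with
    | Sum.inl a => LinearEquiv.refl R (G.fiber a)
    | Sum.inr a => isEmptyElim a.1
  transport := by
    rintro x y h (a | a)
    · exact congrArg (fun z => G.transport z a) (funext fun b => h (Sum.inl b))
    · exact isEmptyElim a.1

theorem _root_.RFoam.FlatGraph.subdivide_tgt_last (G : FlatGraph R) (r : G.Arc → ℕ) (a : G.Arc) :
    (G.subdivide r).tgt ⟨a, Fin.last (r a)⟩ = Sum.inl (G.tgt a) := by
  simp [subdivide]

theorem _root_.RFoam.FlatGraph.subdivide_tgt_castSucc (G : FlatGraph R) (r : G.Arc → ℕ)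
    (a : G.Arc) (j : Fin (r a)) :
    (G.subdivide r).tgt ⟨a, j.castSucc⟩ = Sum.inr ⟨a, j⟩ := by
  simp [subdivide]

def subdivideCongr {G G' : FlatGraph R} (e : Iso G G') (r : G'.Arc → ℕ) :
    Iso (G.subdivide fun a => r (e.arc a)) (G'.subdivide r) where
  arc := Equiv.sigmaCongrLeft (β := fun a => Fin (r a + 1)) e.arc
  vert := Equiv.sumCongr e.vert (Equiv.sigmaCongrLeft (β := fun a => Fin (r a)) e.arc)
  src_arc := by
    rintro ⟨a, i⟩
    refine Fin.cases ?_ (fun j => ?_) i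
    · exact congrArg Sum.inl (e.src_arc a)
    · rfl
  tgt_arc := by
    rintro ⟨a, i⟩
    refine Fin.lastCases ?_ (fun j => ?_) i
    · rw [subdivide_tgt_last]
      exact (subdivide_tgt_last G' r (e.arc a)).trans (congrArg Sum.inl (e.tgt_arc a))
    · rw [subdivide_tgt_castSucc]
      exact subdivide_tgt_castSucc G' r (e.arc a) j
  fiber s := e.fiber s.1
  transport := by
    rintro x y h ⟨a, i⟩
    refine Fin.cases ?_ (fun j => ?_) i
    · exact e.transport (fun b => x ⟨b, Fin.last _⟩) (fun b => y ⟨b, Fin.last _⟩)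
        (fun b => h ⟨b, Fin.last _⟩) a
    · exact h ⟨a, j.castSucc⟩

def subdivideSumVert (G H : FlatGraph R) (r : G.Arc → ℕ) (r' : H.Arc → ℕ) :
    ((G.subdivide r).sum (H.subdivide r')).Vert ≃
      ((G.sum H).subdivide (Sum.elim r r')).Vert :=
  (Equiv.sumSumSumComm _ _ _ _).trans (Equiv.sumCongr (Equiv.refl _)
    (Equiv.sumSigmaDistrib fun s : G.Arc ⊕ H.Arc => Fin (Sum.elim r r' s)).symm)

def subdivideSum (G H : FlatGraph R) (r : G.Arc → ℕ) (r' : H.Arc → ℕ) :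
    Iso ((G.subdivide r).sum (H.subdivide r')) ((G.sum H).subdivide (Sum.elim r r')) where
  arc := (Equiv.sumSigmaDistrib fun s : G.Arc ⊕ H.Arc => Fin (Sum.elim r r' s + 1)).symm
  vert := subdivideSumVert G H r r'
  src_arc := by
    rintro (⟨a, i⟩ | ⟨a, i⟩) <;> refine Fin.cases ?_ (fun j => ?_) i <;> rfl
  tgt_arc := by
    rintro (⟨a, i⟩ | ⟨a, i⟩)
    · refine Fin.lastCases ?_ (fun j => ?_) i
      · refine (subdivide_tgt_last (G.sum H) (Sum.elim r r') (Sum.inl a)).trans ?_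
        exact (congrArg (fun z => subdivideSumVert G H r r' (Sum.inl z))
          (subdivide_tgt_last G r a)).symm
      · refine (subdivide_tgt_castSucc (G.sum H) (Sum.elim r r') (Sum.inl a) j).trans ?_
        exact (congrArg (fun z => subdivideSumVert G H r r' (Sum.inl z))
          (subdivide_tgt_castSucc G r a j)).symm
    · refine Fin.lastCases ?_ (fun j => ?_) i
      · refine (subdivide_tgt_last (G.sum H) (Sum.elim r r') (Sum.inr a)).trans ?_
        exact (congrArg (fun z => subdivideSumVert G H r r' (Sum.inr z))
          (subdivide_tgt_last H r' a)).symm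
      · refine (subdivide_tgt_castSucc (G.sum H) (Sum.elim r r') (Sum.inr a) j).trans ?_
        exact (congrArg (fun z => subdivideSumVert G H r r' (Sum.inr z))
          (subdivide_tgt_castSucc H r' a j)).symm
  fiber s := match s with
    | Sum.inl s => LinearEquiv.refl R (G.fiber s.1)
    | Sum.inr s => LinearEquiv.refl R (H.fiber s.1)
  transport := by
    rintro x y h (⟨a, i⟩ | ⟨a, i⟩)
    · refine Fin.cases ?_ (fun j => ?_) i
      · exact congrArg (fun z => G.transport z a)
          (funext fun b => h (Sum.inl ⟨b, Fin.last _⟩))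
      · exact h (Sum.inl ⟨a, j.castSucc⟩)
    · refine Fin.cases ?_ (fun j => ?_) i
      · exact congrArg (fun z => H.transport z a)
          (funext fun b => h (Sum.inr ⟨b, Fin.last _⟩))
      · exact h (Sum.inr ⟨a, j.castSucc⟩)

def subdivideZero (G : FlatGraph R) : Iso G (G.subdivide fun _ => 0) where
  arc :=
    { toFun := fun a => ⟨a, (0 : Fin 1)⟩
      invFun := fun s => s.1
      left_inv := fun _ => rfl
      right_inv := fun ⟨a, i⟩ => congrArg (Sigma.mk a) (Subsingleton.elim (α := Fin 1) _ _) }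
  vert :=
    { toFun := Sum.inl
      invFun := fun s => match s with
        | Sum.inl v => v
        | Sum.inr s => (s.2 : Fin 0).elim0
      left_inv := fun _ => rfl
      right_inv := fun s => match s with
        | Sum.inl _ => rfl
        | Sum.inr s => (s.2 : Fin 0).elim0 }
  src_arc _ := rfl
  tgt_arc _ := rfl
  fiber a := LinearEquiv.refl R (G.fiber a)
  transport := by
    rintro x y h a
    exact congrArg (fun z => G.transport z a) (funext fun b => h b)

end Iso
end FlatGraph

namespace PolygonComplex

variable {R : Type u} [Ring R]

/-- Disjoint union of complexes. -/
def sum (F F' : PolygonComplex R) : PolygonComplex R where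
  Poly := F.Poly ⊕ F'.Poly
  Edge := F.Edge ⊕ F'.Edge
  finite_poly := inferInstance
  finite_edge := inferInstance
  n := Sum.elim F.n F'.n
  fiber := Sum.elim F.fiber F'.fiber
  edge s := match s with
    | ⟨Sum.inl c, i⟩ => Sum.inl (F.edge ⟨c, i⟩)
    | ⟨Sum.inr c, i⟩ => Sum.inr (F'.edge ⟨c, i⟩)
  sgn s := match s with
    | ⟨Sum.inl c, i⟩ => F.sgn ⟨c, i⟩
    | ⟨Sum.inr c, i⟩ => F'.sgn ⟨c, i⟩
  valence := by
    rintro (k | k)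
    · have h := F.valence k
      have key : ∀ b, Nat.card {s // F.edge s = k ∧ F.sgn s = b} = Nat.card
          {s : Σ c : F.Poly ⊕ F'.Poly, Fin (Sum.elim F.n F'.n c + 1) //
            (match s with
              | ⟨Sum.inl c, i⟩ => Sum.inl (F.edge ⟨c, i⟩)
              | ⟨Sum.inr c, i⟩ => Sum.inr (F'.edge ⟨c, i⟩)) = (Sum.inl k : F.Edge ⊕ F'.Edge) ∧
            (match s with
              | ⟨Sum.inl c, i⟩ => F.sgn ⟨c, i⟩
              | ⟨Sum.inr c, i⟩ => F'.sgn ⟨c, i⟩) = b} := fun b => Nat.card_congr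
        { toFun := fun s => ⟨⟨Sum.inl s.1.1, s.1.2⟩, congrArg Sum.inl s.2.1, s.2.2⟩
          invFun := fun s => match s with
            | ⟨⟨Sum.inl c, i⟩, h⟩ => ⟨⟨c, i⟩, Sum.inl_injective h.1, h.2⟩
            | ⟨⟨Sum.inr c, i⟩, h⟩ => absurd h.1 (by simp)
          left_inv := fun _ => rfl
          right_inv := by rintro ⟨⟨c | c, i⟩, h⟩ <;> [rfl; exact absurd h.1 (by simp)] }
      rw [key, key] at h
      exact h
    · have h := F'.valence k
      have key : ∀ b, Nat.card {s // F'.edge s = k ∧ F'.sgn s = b} = Nat.card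
          {s : Σ c : F.Poly ⊕ F'.Poly, Fin (Sum.elim F.n F'.n c + 1) //
            (match s with
              | ⟨Sum.inl c, i⟩ => Sum.inl (F.edge ⟨c, i⟩)
              | ⟨Sum.inr c, i⟩ => Sum.inr (F'.edge ⟨c, i⟩)) = (Sum.inr k : F.Edge ⊕ F'.Edge) ∧
            (match s with
              | ⟨Sum.inl c, i⟩ => F.sgn ⟨c, i⟩
              | ⟨Sum.inr c, i⟩ => F'.sgn ⟨c, i⟩) = b} := fun b => Nat.card_congr
        { toFun := fun s => ⟨⟨Sum.inr s.1.1, s.1.2⟩, congrArg Sum.inr s.2.1, s.2.2⟩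
          invFun := fun s => match s with
            | ⟨⟨Sum.inr c, i⟩, h⟩ => ⟨⟨c, i⟩, Sum.inr_injective h.1, h.2⟩
            | ⟨⟨Sum.inl c, i⟩, h⟩ => absurd h.1 (by simp)
          left_inv := fun _ => rfl
          right_inv := by rintro ⟨⟨c | c, i⟩, h⟩ <;> [exact absurd h.1 (by simp); rfl] }
      rw [key, key] at h
      exact h
  glue :=
    { toFun := fun x s => match s with
        | ⟨Sum.inl c, i⟩ => F.glue (fun t => x ⟨Sum.inl t.1, t.2⟩) ⟨c, i⟩
        | ⟨Sum.inr c, i⟩ => F'.glue (fun t => x ⟨Sum.inr t.1, t.2⟩) ⟨c, i⟩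
      invFun := fun x s => match s with
        | ⟨Sum.inl c, i⟩ => F.glue (fun t => x ⟨Sum.inl t.1, t.2⟩) ⟨c, i⟩
        | ⟨Sum.inr c, i⟩ => F'.glue (fun t => x ⟨Sum.inr t.1, t.2⟩) ⟨c, i⟩
      map_add' := fun x y => by
        funext ⟨c, i⟩
        rcases c with c | c
        · exact congrFun (F.glue.map_add (fun t => x ⟨Sum.inl t.1, t.2⟩)
            (fun t => y ⟨Sum.inl t.1, t.2⟩)) ⟨c, i⟩
        · exact congrFun (F'.glue.map_add (fun t => x ⟨Sum.inr t.1, t.2⟩)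
            (fun t => y ⟨Sum.inr t.1, t.2⟩)) ⟨c, i⟩
      map_smul' := fun a x => by
        funext ⟨c, i⟩
        rcases c with c | c
        · exact congrFun (F.glue.map_smul a (fun t => x ⟨Sum.inl t.1, t.2⟩)) ⟨c, i⟩
        · exact congrFun (F'.glue.map_smul a (fun t => x ⟨Sum.inr t.1, t.2⟩)) ⟨c, i⟩
      left_inv := fun x => by
        funext ⟨c, i⟩
        rcases c with c | c
        · exact congrFun (F.glue_glue (fun t => x ⟨Sum.inl t.1, t.2⟩)) ⟨c, i⟩
        · exact congrFun (F'.glue_glue (fun t => x ⟨Sum.inr t.1, t.2⟩)) ⟨c, i⟩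
      right_inv := fun x => by
        funext ⟨c, i⟩
        rcases c with c | c
        · exact congrFun (F.glue_glue (fun t => x ⟨Sum.inl t.1, t.2⟩)) ⟨c, i⟩
        · exact congrFun (F'.glue_glue (fun t => x ⟨Sum.inr t.1, t.2⟩)) ⟨c, i⟩ }
  glue_glue x := by
    funext ⟨c, i⟩
    rcases c with c | c
    · exact congrFun (F.glue_glue (fun t => x ⟨Sum.inl t.1, t.2⟩)) ⟨c, i⟩
    · exact congrFun (F'.glue_glue (fun t => x ⟨Sum.inr t.1, t.2⟩)) ⟨c, i⟩
  glue_local := by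
    rintro x y ⟨c | c, i⟩ h
    · exact F.glue_local _ _ _ fun t ht hs => h ⟨Sum.inl t.1, t.2⟩ (congrArg Sum.inl ht) hs
    · exact F'.glue_local _ _ _ fun t ht hs => h ⟨Sum.inr t.1, t.2⟩ (congrArg Sum.inr ht) hs

def linkSum (F F' : PolygonComplex R) :
    FlatGraph.Iso (F.sum F').link (F.link.sum F'.link) where
  arc := Equiv.sumSigmaDistrib fun c : F.Poly ⊕ F'.Poly => Fin (Sum.elim F.n F'.n c + 1)
  vert := Equiv.sumProdDistrib _ _ _
  src_arc := by rintro ⟨c | c, i⟩ <;> rfl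
  tgt_arc := by rintro ⟨c | c, i⟩ <;> rfl
  fiber s := match s with
    | ⟨Sum.inl c, _⟩ => LinearEquiv.refl R (F.fiber c)
    | ⟨Sum.inr c, _⟩ => LinearEquiv.refl R (F'.fiber c)
  transport := by
    rintro x y h ⟨c | c, i⟩
    · exact congrArg (fun z => F.glue z ⟨c, i⟩)
        (funext fun t => h ⟨Sum.inl t.1, (F.prev t).2⟩)
    · exact congrArg (fun z => F'.glue z ⟨c, i⟩)
        (funext fun t => h ⟨Sum.inr t.1, (F'.prev t).2⟩)

theorem IsFoamWithBoundary.congr {F : PolygonComplex R} {X Y : OneFoam R}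
    (h : F.IsFoamWithBoundary X) (e : FlatGraph.Iso Y.toFlatGraph X.toFlatGraph) :
    F.IsFoamWithBoundary Y := by
  obtain ⟨ι, _, M, hM, r, ⟨f⟩⟩ := h
  exact ⟨ι, _, M, hM, _, ⟨f.trans (FlatGraph.Iso.subdivideCongr
    (FlatGraph.Iso.sumCongr e (FlatGraph.Iso.refl _)) r).symm⟩⟩

theorem IsFoamWithBoundary.sum {F F' : PolygonComplex R} {X Y : OneFoam R}
    (h : F.IsFoamWithBoundary X) (h' : F'.IsFoamWithBoundary Y) :
    (F.sum F').IsFoamWithBoundary (X.sum Y) := by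
  obtain ⟨ι, _, M, hM, r, ⟨f⟩⟩ := h
  obtain ⟨κ, _, N, hN, r', ⟨f'⟩⟩ := h'
  refine ⟨ι ⊕ κ, inferInstance, Sum.elim M N, Sum.rec hM hN, _, ⟨(linkSum F F').trans
    ((FlatGraph.Iso.sumCongr f f').trans ((FlatGraph.Iso.subdivideSum _ _ r r').trans
      (FlatGraph.Iso.subdivideCongr (G := (X.toFlatGraph.sum Y.toFlatGraph).sum
        (FlatGraph.sigma (Sum.elim M N))) ?_ _).symm))⟩⟩
  exact (FlatGraph.Iso.sumCongr (FlatGraph.Iso.refl _) (FlatGraph.Iso.sigmaSum M N)).trans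
    (FlatGraph.Iso.sumSumSumComm _ _ _ _)

/-- The cylinder `W × [0, 1]`: the edges of `W` give rectangles, each of which is a polygon with two
sides and both corners cut off. -/
def cylinder (W : OneFoam R) : PolygonComplex R where
  Poly := W.Arc
  Edge := W.Vert
  finite_poly := inferInstance
  finite_edge := inferInstance
  n _ := 1
  fiber := W.fiber
  edge s := Fin.cases (motive := fun _ => W.Vert) (W.tgt s.1) (fun _ => W.src s.1) s.2
  sgn s := Fin.cases (motive := fun _ => Bool) false (fun _ => true) s.2
  valence := by
    intro v
    have h1 : Nat.card {s : (Σ _ : W.Arc, Fin (1 + 1)) //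
        Fin.cases (motive := fun _ => W.Vert) (W.tgt s.1) (fun _ => W.src s.1) s.2 = v ∧
        Fin.cases (motive := fun _ => Bool) false (fun _ => true) s.2 = true} = W.outDeg v :=
      Nat.card_congr
        { toFun := fun s => match s with
            | ⟨⟨_, ⟨0, _⟩⟩, h⟩ => absurd h.2 Bool.false_ne_true
            | ⟨⟨a, ⟨1, _⟩⟩, h⟩ => ⟨a, h.1⟩
          invFun := fun a => ⟨⟨a.1, 1⟩, a.2, rfl⟩
          left_inv := by
            rintro ⟨⟨a, ⟨i, hi⟩⟩, h⟩
            rcases i with _ | _ | i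
            · exact absurd h.2 Bool.false_ne_true
            · rfl
            · omega
          right_inv := fun _ => rfl }
    have h2 : Nat.card {s : (Σ _ : W.Arc, Fin (1 + 1)) //
        Fin.cases (motive := fun _ => W.Vert) (W.tgt s.1) (fun _ => W.src s.1) s.2 = v ∧
        Fin.cases (motive := fun _ => Bool) false (fun _ => true) s.2 = false} = W.inDeg v :=
      Nat.card_congr
        { toFun := fun s => match s with
            | ⟨⟨a, ⟨0, _⟩⟩, h⟩ => ⟨a, h.1⟩
            | ⟨⟨_, ⟨1, _⟩⟩, h⟩ => absurd h.2.symm Bool.false_ne_true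
          invFun := fun a => ⟨⟨a.1, 0⟩, a.2, rfl⟩
          left_inv := by
            rintro ⟨⟨a, ⟨i, hi⟩⟩, h⟩
            rcases i with _ | _ | i
            · rfl
            · exact absurd h.2.symm Bool.false_ne_true
            · omega
          right_inv := fun _ => rfl }
    rw [h1, h2]
    rcases W.valence v with ⟨h, h'⟩ | ⟨h, h'⟩ | ⟨h, h', _⟩ <;> simp [h, h']
  glue :=
    { toFun := fun x s => Fin.cases (motive := fun _ => W.fiber s.1)
        (W.transport.symm (fun b => x ⟨b, 1⟩) s.1)
        (fun _ => W.transport (fun b => x ⟨b, 0⟩) s.1) s.2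
      invFun := fun x s => Fin.cases (motive := fun _ => W.fiber s.1)
        (W.transport.symm (fun b => x ⟨b, 1⟩) s.1)
        (fun _ => W.transport (fun b => x ⟨b, 0⟩) s.1) s.2
      map_add' := fun x y => by
        funext ⟨a, i⟩
        refine Fin.cases ?_ (fun j => ?_) i
        · exact congrFun (W.transport.symm.map_add (fun b => x ⟨b, 1⟩) (fun b => y ⟨b, 1⟩)) a
        · exact congrFun (W.transport.map_add (fun b => x ⟨b, 0⟩) (fun b => y ⟨b, 0⟩)) a
      map_smul' := fun c x => by
        funext ⟨a, i⟩
        refine Fin.cases ?_ (fun j => ?_) i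
        · exact congrFun (W.transport.symm.map_smul c (fun b => x ⟨b, 1⟩)) a
        · exact congrFun (W.transport.map_smul c (fun b => x ⟨b, 0⟩)) a
      left_inv := fun x => by
        funext ⟨a, i⟩
        refine Fin.cases ?_ (fun j => ?_) i
        · exact congrFun (W.transport.symm_apply_apply (fun b => x ⟨b, 0⟩)) a
        · obtain rfl : j = 0 := Subsingleton.elim _ _
          exact congrFun (W.transport.apply_symm_apply (fun b => x ⟨b, 1⟩)) a
      right_inv := fun x => by
        funext ⟨a, i⟩
        refine Fin.cases ?_ (fun j => ?_) i
        · exact congrFun (W.transport.symm_apply_apply (fun b => x ⟨b, 0⟩)) a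
        · obtain rfl : j = 0 := Subsingleton.elim _ _
          exact congrFun (W.transport.apply_symm_apply (fun b => x ⟨b, 1⟩)) a }
  glue_glue x := by
    funext ⟨a, i⟩
    refine Fin.cases ?_ (fun j => ?_) i
    · exact congrFun (W.transport.symm_apply_apply (fun b => x ⟨b, 0⟩)) a
    · obtain rfl : j = 0 := Subsingleton.elim _ _
      exact congrFun (W.transport.apply_symm_apply (fun b => x ⟨b, 1⟩)) a
  glue_local := by
    rintro x y ⟨a, i⟩
    refine Fin.cases (fun h => ?_) (fun j h => ?_) i
    · exact W.transport_symm_local _ _ _ fun b hb => h ⟨b, 1⟩ hb Bool.false_ne_true.symm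
    · exact W.transport_local _ _ _ fun b hb => h ⟨b, 0⟩ hb Bool.false_ne_true

def linkCylinder (W : OneFoam R) :
    FlatGraph.Iso (cylinder W).link (W.reverse.sum W).toFlatGraph where
  arc :=
    { toFun := fun s => Fin.cases (motive := fun _ => W.Arc ⊕ W.Arc)
        (Sum.inl s.1) (fun _ => Sum.inr s.1) s.2
      invFun := fun s => match s with
        | Sum.inl a => ⟨a, (0 : Fin 2)⟩
        | Sum.inr a => ⟨a, (1 : Fin 2)⟩
      left_inv := by
        rintro ⟨a, i⟩
        refine Fin.cases rfl (fun j => ?_) i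
        obtain rfl : j = (0 : Fin 1) := Subsingleton.elim (α := Fin 1) _ _
        rfl
      right_inv := by rintro (a | a) <;> rfl }
  vert :=
    { toFun := fun v => match v with
        | (v, false) => Sum.inl v
        | (v, true) => Sum.inr v
      invFun := fun v => match v with
        | Sum.inl v => (v, false)
        | Sum.inr v => (v, true)
      left_inv := by rintro ⟨v, _ | _⟩ <;> rfl
      right_inv := by rintro (v | v) <;> rfl }
  src_arc := by
    rintro ⟨a, i⟩
    refine Fin.cases rfl (fun j => rfl) i
  tgt_arc := by
    rintro ⟨a, i⟩
    refine Fin.cases rfl (fun j => ?_) i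
    obtain rfl : j = (0 : Fin 1) := Subsingleton.elim (α := Fin 1) _ _
    have hn : (cylinder W).next ⟨a, (1 : Fin 2)⟩ = ⟨a, (0 : Fin 2)⟩ :=
      congrArg (Sigma.mk (β := fun _ : W.Arc => Fin 2) a) (by decide : (1 : Fin 2) + 1 = 0)
    have ht : (cylinder W).link.tgt ⟨a, (1 : Fin 2)⟩ = (W.tgt a, true) :=
      congrArg (fun t => ((cylinder W).edge t, !(cylinder W).sgn t)) hn
    exact (congrArg (fun v : W.Vert × Bool => match v with
        | (v, false) => (Sum.inl v : W.Vert ⊕ W.Vert)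
        | (v, true) => Sum.inr v) ht).symm
  fiber s := match s with
    | ⟨a, ⟨0, _⟩⟩ => LinearEquiv.refl R (W.fiber a)
    | ⟨a, ⟨_ + 1, _⟩⟩ => LinearEquiv.refl R (W.fiber a)
  transport := by
    rintro x y h ⟨a, i⟩
    revert h
    refine Fin.cases (fun h => ?_) (fun j h => ?_) i
    · exact congrArg (fun z => W.transport.symm z a) (funext fun b => by
        let z : Fin 2 → W.fiber b := fun j => x ⟨b, j⟩
        exact (h ⟨b, (0 : Fin 2)⟩).trans (congrArg z (by decide : (0 : Fin 2) = 1 - 1)))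
    · exact congrArg (fun z => W.transport z a) (funext fun b => h ⟨b, (1 : Fin 2)⟩)

theorem isFoamWithBoundary_cylinder (W : OneFoam R) :
    (cylinder W).IsFoamWithBoundary (W.reverse.sum W) :=
  ⟨Empty, inferInstance, fun i => i.elim, fun i => i.elim, _,
    ⟨(linkCylinder W).trans ((FlatGraph.Iso.sumSigmaEmpty _ _).symm.trans
      (FlatGraph.Iso.subdivideZero _))⟩⟩

end PolygonComplex

namespace Cobordant

variable {R : Type u} [Ring R]

theorem of_iso {U W : OneFoam R} (e : FlatGraph.Iso U.toFlatGraph W.toFlatGraph) :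
    Cobordant U W :=
  ⟨_, (PolygonComplex.isFoamWithBoundary_cylinder U).congr
    (FlatGraph.Iso.sumCongr (FlatGraph.Iso.refl _) e.symm)⟩

theorem sum {U U' W W' : OneFoam R} (h : Cobordant U U') (h' : Cobordant W W') :
    Cobordant (U.sum W) (U'.sum W') := by
  obtain ⟨F, hF⟩ := h
  obtain ⟨F', hF'⟩ := h'
  exact ⟨_, (hF.sum hF').congr ((FlatGraph.Iso.sumCongr (FlatGraph.Iso.reverseSum _ _)
    (FlatGraph.Iso.refl _)).trans (FlatGraph.Iso.sumSumSumComm _ _ _ _))⟩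

theorem empty_sum_reverse (U : OneFoam R) : Cobordant OneFoam.empty (U.reverse.sum U) := by
  refine ⟨_, (PolygonComplex.isFoamWithBoundary_cylinder U).congr ?_⟩
  refine (FlatGraph.Iso.sumCongr (?_ : FlatGraph.Iso _ FlatGraph.empty)
    (FlatGraph.Iso.refl _)).trans (FlatGraph.Iso.emptySum _)
  exact FlatGraph.Iso.refl FlatGraph.empty

end Cobordant

/-! ### The cobordism group -/

/-- The set of cobordism classes of closed `R`-decorated 1-foams: the quotient by the equivalence
relation generated by `Cobordant`. (Gluing 2-foams along a common boundary shows that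
`Cobordant` is itself an equivalence relation; the quotient does not presuppose it.) -/
def Cob1 (R : Type u) [Ring R] : Type (u + 1) := Quot (Cobordant (R := R))

namespace Cob1

variable {R : Type u} [Ring R]

/-- The cobordism class of a foam. -/
def mk (U : OneFoam R) : Cob1 R := Quot.mk _ U

theorem sound {U W : OneFoam R} (h : Cobordant U W) : mk U = mk W := Quot.sound h

theorem ind {p : Cob1 R → Prop} (h : ∀ U, p (mk U)) (x : Cob1 R) : p x := Quot.ind h x

/-- Addition is disjoint union. -/
instance : Add (Cob1 R) :=
  ⟨Quot.map₂ OneFoam.sum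
    (fun U _ _ h => Cobordant.sum (Cobordant.of_iso (FlatGraph.Iso.refl U.toFlatGraph)) h)
    (fun _ _ W h => Cobordant.sum h (Cobordant.of_iso (FlatGraph.Iso.refl W.toFlatGraph)))⟩

/-- Zero is the class of the empty foam. -/
instance : Zero (Cob1 R) := ⟨mk OneFoam.empty⟩

theorem mk_sum (U W : OneFoam R) : mk (U.sum W) = mk U + mk W := rfl

theorem mk_empty : mk (OneFoam.empty : OneFoam R) = 0 := rfl

theorem add_assoc' (x y z : Cob1 R) : x + y + z = x + (y + z) := by
  induction x using ind with | _ U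
  induction y using ind with | _ V
  induction z using ind with | _ W
  exact sound (Cobordant.of_iso (FlatGraph.Iso.sumAssoc _ _ _))

theorem add_comm' (x y : Cob1 R) : x + y = y + x := by
  induction x using ind with | _ U
  induction y using ind with | _ V
  exact sound (Cobordant.of_iso (FlatGraph.Iso.sumComm _ _))

theorem zero_add' (x : Cob1 R) : 0 + x = x := by
  induction x using ind with | _ U
  exact sound (Cobordant.of_iso (FlatGraph.Iso.emptySum _))

theorem reverse_add (U : OneFoam R) : mk U.reverse + mk U = 0 :=
  (sound (Cobordant.empty_sum_reverse U)).symm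

/-- Negation is orientation reversal. -/
instance : Neg (Cob1 R) :=
  ⟨Quot.lift (fun U => mk U.reverse) fun U W h => by
    have h' : mk U = mk W := sound h
    calc mk U.reverse = 0 + mk U.reverse := (zero_add' _).symm
      _ = mk W.reverse + mk W + mk U.reverse := by rw [reverse_add]
      _ = mk W.reverse + (mk U.reverse + mk U) := by
        rw [add_assoc', h', add_comm' (mk W)]
      _ = mk W.reverse := by rw [reverse_add, add_comm', zero_add']⟩

theorem mk_reverse (U : OneFoam R) : mk U.reverse = -mk U := rfl

/-- The group of cobordism classes: addition is disjoint union, zero is the class of the empty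
foam, and negation is orientation reversal. -/
instance : AddCommGroup (Cob1 R) where
  add_assoc := add_assoc'
  zero_add := zero_add'
  add_zero x := (add_comm' x 0).trans (zero_add' x)
  add_comm := add_comm'
  neg_add_cancel := ind reverse_add
  nsmul := nsmulRec
  zsmul := zsmulRec

end Cob1

end RFoam
end

noncomputable section

namespace RFoam

/-! ### Calculus of automorphism classes in `K₁(R) / τ(K₀(R))` -/

section KTheoryModTau

variable {R : Type u} [Ring R]

/-! The map `γ` sends a foam to the class of its `transport`, the automorphism of the sum of all
fibers. Modulo the image of `τ`, every permutation of equal summands has class zero, and so does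
every automorphism exchanging two complementary summands by mutually inverse isomorphisms. The first
fact makes the class independent of the strong cut (`cls_subdivide`): extra points only insert
rotations.

Invariance under cobordism has a short reason. For a 2-foam cut into polygons, the transport of the
union of all vertex links is a rotation of the corners of each polygon followed by the gluing of
sides (`cls_link`). The gluing exchanges positive and negative sides, so both factors die. Links of
interior points also have class zero; for the tetrahedron this holds because its transport, once
every fiber is decomposed into three modules, merely permutes the summands. Hence the class of the
boundary is zero.

The inverse `δ` sends `[(P, α)]` to the circle with monodromy `α`. Its relations come from foams
without vertices, described by a `Matching`: a pair of pants gives multiplicativity, a single seam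
gives direct sums, and a seam whose two thin sides form one facet kills the transposition. A general
exact sequence splits, leaving a shear, which is stably a commutator. On circles `γ ∘ δ` is the
identity, so only the surjectivity of `δ` remains.

For surjectivity, record at each vertex the isomorphism classes of incoming and outgoing fibers, and
let the `defect` be the formal sum of the differences. If it vanishes, merging and splitting
vertices can be joined in pairs by seams, and punctured disks make the foam cobordant to circles
(`mk_mem_of_defect_eq_zero`). In general the defect is a combination of associators, the boundaries
expressing associativity of direct sums (`defect_mem_associators`). This is proved by extending the
monoid of isomorphism classes by the universal cocycle and summing the section of this extension
over all edges, once grouped by targets and once by sources. Each associator is the defect of a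
tetrahedron, which bounds a foam vertex, so the defect can be removed without changing the cobordism
class. -/

theorem K1.cls_mul (P : FGProj R) (α β : P ≃ₗ[R] P) :
    K1.cls P (α * β) = K1.cls P α + K1.cls P β := by
  have h := (QuotientAddGroup.eq_zero_iff (N := AddSubgroup.closure {x | K1.IsRelation R x}) _).2
    (AddSubgroup.subset_closure (K1.IsRelation.mul P α β))
  rw [QuotientAddGroup.mk_sub, QuotientAddGroup.mk_add, sub_eq_zero] at h
  exact h

theorem K1.cls_exact {P₁ P₂ P₃ : FGProj R} (i : P₁ →ₗ[R] P₂) (p : P₂ →ₗ[R] P₃)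
    (α₁ : P₁ ≃ₗ[R] P₁) (α₂ : P₂ ≃ₗ[R] P₂) (α₃ : P₃ ≃ₗ[R] P₃)
    (hi : Function.Injective i) (hip : Function.Exact i p) (hp : Function.Surjective p)
    (h₁ : ∀ x, i (α₁ x) = α₂ (i x)) (h₂ : ∀ x, p (α₂ x) = α₃ (p x)) :
    K1.cls P₂ α₂ = K1.cls P₁ α₁ + K1.cls P₃ α₃ := by
  have h := (QuotientAddGroup.eq_zero_iff (N := AddSubgroup.closure {x | K1.IsRelation R x}) _).2
    (AddSubgroup.subset_closure (K1.IsRelation.exact P₁ P₂ P₃ i p α₁ α₂ α₃ hi hip hp h₁ h₂))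
  rw [QuotientAddGroup.mk_sub, QuotientAddGroup.mk_add, sub_eq_zero] at h
  exact h

instance {ι : Type} [Finite ι] (M : ι → Type u) [∀ i, AddCommGroup (M i)] [∀ i, Module R (M i)]
    [∀ i, Module.Projective R (M i)] : Module.Projective R (∀ i, M i) := by
  classical
  have := Fintype.ofFinite ι
  exact Module.Projective.of_equiv (DFinsupp.linearEquivFunOnFintype (R := R) (M := M))

/-- The class of `(P, α)` in `K₁(R) / τ(K₀(R))`. -/
def kap {M : Type u} [AddCommGroup M] [Module R M] [Module.Finite R M] [Module.Projective R M]
    (α : M ≃ₗ[R] M) : K1 R ⧸ (tau R).range :=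
  QuotientAddGroup.mk (K1.cls ⟨M⟩ α)

section

variable {M N L : Type u} [AddCommGroup M] [Module R M] [Module.Finite R M] [Module.Projective R M]
  [AddCommGroup N] [Module R N] [Module.Finite R N] [Module.Projective R N]
  [AddCommGroup L] [Module R L] [Module.Finite R L] [Module.Projective R L]

theorem kap_mul (α β : M ≃ₗ[R] M) : kap (α * β) = kap α + kap β := by
  rw [kap, K1.cls_mul, QuotientAddGroup.mk_add]; rfl

theorem kap_trans (α β : M ≃ₗ[R] M) : kap (α.trans β) = kap α + kap β := by
  rw [add_comm, ← kap_mul]; rfl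

theorem kap_one : kap (1 : M ≃ₗ[R] M) = 0 := by
  have h := kap_mul (R := R) (M := M) 1 1
  rwa [mul_one, left_eq_add] at h

theorem kap_eq_zero_of_forall {α : M ≃ₗ[R] M} (h : ∀ x, α x = x) : kap α = 0 := by
  obtain rfl : α = 1 := LinearEquiv.ext h
  exact kap_one

theorem kap_symm (α : M ≃ₗ[R] M) : kap α.symm = - kap α := by
  rw [eq_neg_iff_add_eq_zero, ← kap_trans]
  exact kap_eq_zero_of_forall fun x => by simp

theorem kap_exact (i : L →ₗ[R] M) (p : M →ₗ[R] N)
    (α₁ : L ≃ₗ[R] L) (α₂ : M ≃ₗ[R] M) (α₃ : N ≃ₗ[R] N)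
    (hi : Function.Injective i) (hip : Function.Exact i p) (hp : Function.Surjective p)
    (h₁ : ∀ x, i (α₁ x) = α₂ (i x)) (h₂ : ∀ x, p (α₂ x) = α₃ (p x)) :
    kap α₂ = kap α₁ + kap α₃ := by
  rw [kap, K1.cls_exact (P₁ := ⟨L⟩) (P₂ := ⟨M⟩) (P₃ := ⟨N⟩) i p α₁ α₂ α₃ hi hip hp h₁ h₂,
    QuotientAddGroup.mk_add]; rfl

/-- A conjugating isomorphism is a short exact sequence whose first term is zero. -/
theorem kap_conj {α : M ≃ₗ[R] M} {β : N ≃ₗ[R] N} (e : M ≃ₗ[R] N)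
    (h : ∀ x, e (α x) = β (e x)) : kap α = kap β := by
  have h1 := kap_exact (L := PUnit.{u + 1}) (0 : PUnit.{u + 1} →ₗ[R] M) e.toLinearMap
    1 α β (fun _ _ _ => rfl) (by
      intro x
      constructor
      · intro hx
        exact ⟨PUnit.unit, ((LinearEquiv.map_eq_zero_iff e).1 hx).symm⟩
      · rintro ⟨_, rfl⟩
        simp) e.surjective (fun _ => by simp) h
  rw [h1, kap_one, zero_add]

theorem kap_prodCongr (α : M ≃ₗ[R] M) (β : N ≃ₗ[R] N) :
    kap (α.prodCongr β) = kap α + kap β :=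
  kap_exact (LinearMap.inl R M N) (LinearMap.snd R M N) α (α.prodCongr β) β
    LinearMap.inl_injective Function.Exact.inl_snd LinearMap.snd_surjective
    (fun _ => Prod.ext rfl (β.map_zero).symm) (fun _ => rfl)

/-- This is the vanishing for which one divides by the image of `τ`; those for permutations and
exchanges follow from it. -/
theorem kap_prodComm : kap (LinearEquiv.prodComm R M M) = 0 :=
  (QuotientAddGroup.eq_zero_iff _).2 ⟨K0.cls ⟨M⟩, tau_cls R ⟨M⟩⟩

/-- Permutations are products of swaps. A swap of `x` and `y` fixes the functions vanishing at both
points, and on the quotient `M × M` by these it is the transposition. -/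
theorem kap_eq_zero_of_perm {ι : Type} [Finite ι] (π : Equiv.Perm ι) :
    kap (LinearEquiv.funCongrLeft R M π) = 0 := by
  classical
  induction π using Equiv.Perm.swap_induction_on with
  | one => exact kap_eq_zero_of_forall fun _ => rfl
  | swap_mul f x y hxy ih =>
    have h : LinearEquiv.funCongrLeft R M (Equiv.swap x y * f) =
      (LinearEquiv.funCongrLeft R M (Equiv.swap x y)).trans (LinearEquiv.funCongrLeft R M f) := rfl
    rw [h, kap_trans, ih, add_zero]
    let i : ({k : ι // k ≠ x ∧ k ≠ y} → M) →ₗ[R] (ι → M) :=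
      { toFun := fun z k => if h : k ≠ x ∧ k ≠ y then z ⟨k, h⟩ else 0
        map_add' := fun z w => by
          funext k
          by_cases h : k ≠ x ∧ k ≠ y <;> simp [h]
        map_smul' := fun c z => by
          funext k
          by_cases h : k ≠ x ∧ k ≠ y <;> simp [h] }
    have hi : ∀ z k (h : k ≠ x ∧ k ≠ y), i z k = z ⟨k, h⟩ := fun z k h => dif_pos h
    have hx : ∀ z, i z x = 0 := fun z => dif_neg (by simp)
    have hy : ∀ z, i z y = 0 := fun z => dif_neg (by simp)
    let p : (ι → M) →ₗ[R] M × M := (LinearMap.proj x).prod (LinearMap.proj y)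
    rw [kap_exact i p 1
      (LinearEquiv.funCongrLeft R M (Equiv.swap x y)) (LinearEquiv.prodComm R M M)
      ?_ ?_ ?_ ?_ ?_, kap_one, kap_prodComm, add_zero]
    · intro z w h
      funext ⟨k, hk⟩
      rw [← hi z k hk, ← hi w k hk, h]
    · intro z
      constructor
      · intro hz
        have h1 : z x = 0 := congrArg Prod.fst hz
        have h2 : z y = 0 := congrArg Prod.snd hz
        refine ⟨fun k => z k.1, funext fun k => ?_⟩
        by_cases hkx : k = x
        · rw [hkx, hx, h1]
        by_cases hky : k = y
        · rw [hky, hy, h2]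
        exact hi _ k ⟨hkx, hky⟩
      · rintro ⟨w, rfl⟩
        exact Prod.ext (hx w) (hy w)
    · rintro ⟨a, b⟩
      refine ⟨fun k => if k = x then a else b, Prod.ext ?_ ?_⟩
      · exact if_pos rfl
      · exact if_neg hxy.symm
    · intro z
      funext k
      change i z k = i z (Equiv.swap x y k)
      by_cases hkx : k = x
      · rw [hkx, Equiv.swap_apply_left, hx, hy]
      by_cases hky : k = y
      · rw [hky, Equiv.swap_apply_right, hx, hy]
      rw [Equiv.swap_apply_of_ne_of_ne hkx hky]
    · intro z
      refine Prod.ext ?_ ?_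
      · exact congrArg z (Equiv.swap_apply_left x y)
      · exact congrArg z (Equiv.swap_apply_right x y)

end

/-- Identifying `N` with `M` along `f` turns `α` into the transposition of `M × M`. -/
theorem kap_eq_zero_of_exchange {L M N : Type u} [AddCommGroup L] [Module R L]
    [Module.Finite R L] [Module.Projective R L] [AddCommGroup M] [Module R M] [Module.Finite R M]
    [Module.Projective R M] [AddCommGroup N] [Module R N] {α : L ≃ₗ[R] L} (e : L ≃ₗ[R] M × N)
    (f : M ≃ₗ[R] N) (h : ∀ x, e (α x) = (f.symm (e x).2, f (e x).1)) : kap α = 0 := by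
  rw [← kap_prodComm (R := R) (M := M)]
  refine kap_conj (e.trans ((LinearEquiv.refl R M).prodCongr f.symm)) fun x => ?_
  refine Prod.ext ?_ ?_
  · change (e (α x)).1 = f.symm (e x).2
    rw [h]
  · change f.symm (e (α x)).2 = (e x).1
    rw [h, f.symm_apply_apply]

/-- An automorphism of a sum indexed by `S = ι ⊔ κ` that is block triangular. -/
theorem kap_pi_split {S ι κ : Type} [Finite S] [Finite ι] [Finite κ] (e : ι ⊕ κ ≃ S)
    (P : S → FGProj R) (α : (∀ s, P s) ≃ₗ[R] (∀ s, P s))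
    (β : (∀ i, P (e (Sum.inl i))) ≃ₗ[R] (∀ i, P (e (Sum.inl i))))
    (γ : (∀ k, P (e (Sum.inr k))) ≃ₗ[R] (∀ k, P (e (Sum.inr k))))
    (h₁ : ∀ x : ∀ s, P s, (∀ k, x (e (Sum.inr k)) = 0) →
      ∀ i, α x (e (Sum.inl i)) = β (fun i => x (e (Sum.inl i))) i)
    (h₂ : ∀ (x : ∀ s, P s) k, α x (e (Sum.inr k)) = γ (fun k => x (e (Sum.inr k))) k) :
    kap α = kap β + kap γ := by
  let E : (∀ s, P s) ≃ₗ[R] (∀ i, P (e (Sum.inl i))) × (∀ k, P (e (Sum.inr k))) :=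
    (LinearEquiv.piCongrLeft R (fun s => (P s).carrier) e).symm.trans
      (LinearEquiv.sumPiEquivProdPi R ι κ _)
  have hE : ∀ x, E x = (fun i => x (e (Sum.inl i)), fun k => x (e (Sum.inr k))) := fun x => rfl
  -- The `ι`-summand is the invariant submodule and the `κ`-summand the quotient: by `h₂` the
  -- `κ`-part of the image depends only on the `κ`-part.
  refine kap_exact (E.symm.toLinearMap ∘ₗ LinearMap.inl R _ _)
    (LinearMap.snd R _ _ ∘ₗ E.toLinearMap) β α γ
    (E.symm.injective.comp LinearMap.inl_injective) ?_
    (fun z => ⟨E.symm (0, z), congrArg Prod.snd (E.apply_symm_apply (0, z))⟩) ?_ ?_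
  · intro x
    constructor
    · intro hx
      exact ⟨(E x).1, E.symm_apply_eq.2 (Prod.ext rfl (Eq.symm hx))⟩
    · rintro ⟨y, rfl⟩
      exact congrArg Prod.snd (E.apply_symm_apply (y, 0))
  · intro y
    refine E.symm_apply_eq.2 ?_
    have h0 := E.apply_symm_apply (y, 0)
    rw [hE] at h0
    have h3 := congrArg Prod.fst h0
    have h4 := congrArg Prod.snd h0
    rw [hE]
    refine Prod.ext (funext fun i => ?_) (funext fun k => ?_)
    · refine Eq.symm ((h₁ _ (fun k => congrFun h4 k) i).trans ?_)
      exact congrArg (fun z => β z i) h3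
    · refine Eq.symm ((h₂ _ k).trans ?_)
      exact (congrArg (fun z => γ z k) h4).trans (congrFun γ.map_zero k)
  · intro x
    exact funext fun k => h₂ x k

theorem kap_piCongrRight {ι : Type} [Finite ι] (P : ι → FGProj R) (α : ∀ i, P i ≃ₗ[R] P i)
    (h : ∀ i, kap (α i) = 0) : kap (LinearEquiv.piCongrRight α) = 0 := by
  suffices H : ∀ (ι : Type) (_ : Finite ι) (P : ι → FGProj R) (α : ∀ i, P i ≃ₗ[R] P i),
      (∀ i, kap (α i) = 0) → kap (LinearEquiv.piCongrRight α) = 0 from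
    H ι inferInstance P α h
  intro ι hι
  refine Finite.induction_empty_option (P := fun ι => ∀ (_ : Finite ι) (P : ι → FGProj R)
    (α : ∀ i, P i ≃ₗ[R] P i), (∀ i, kap (α i) = 0) →
      kap (LinearEquiv.piCongrRight α) = 0) ?_ ?_ ?_ ι hι
  · intro ι κ e ih _ P α h
    have := Finite.of_equiv _ e.symm
    rw [← ih this (fun i => P (e i)) (fun i => α (e i)) fun i => h (e i)]
    exact kap_conj (LinearEquiv.piCongrLeft R (fun s => (P s).carrier) e).symm fun x => rfl
  · intro _ P α _
    exact kap_eq_zero_of_forall fun x => funext fun i => i.elim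
  · intro ι _ ih _ P α h
    let e : ι ⊕ Unit ≃ Option ι := (Equiv.optionEquivSumPUnit ι).symm
    rw [kap_pi_split e P _ (LinearEquiv.piCongrRight fun i => α (e (Sum.inl i)))
      (LinearEquiv.piCongrRight fun i => α (e (Sum.inr i))) (fun _ _ _ => rfl) fun _ _ => rfl,
      ih inferInstance _ _ fun i => h _, zero_add, ← h none]
    exact kap_conj (LinearEquiv.piUnique R fun k : Unit => (P (e (Sum.inr k))).carrier) fun _ => rfl

end KTheoryModTau

/-! ### The class of a flat graph: subdivision, circle and theta links -/

namespace FlatGraph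

variable {R : Type u} [Ring R]

/-- The class in `K₁(R) / τ(K₀(R))` of the automorphism `transport` of the sum of all fibers. -/
def cls (G : FlatGraph R) : K1 R ⧸ (tau R).range := kap G.transport

theorem cls_congr {G G' : FlatGraph R} (e : Iso G G') : G.cls = G'.cls := by
  let E : (∀ a, G.fiber a) ≃ₗ[R] (∀ a, G'.fiber a) :=
    (LinearEquiv.piCongrRight e.fiber).trans
      (LinearEquiv.piCongrLeft R (fun a => (G'.fiber a).carrier) e.arc)
  have hE : ∀ y a, E.symm y a = (e.fiber a).symm (y (e.arc a)) := fun _ _ => rfl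
  refine (kap_conj E.symm fun y => funext fun a => ?_).symm
  rw [hE, LinearEquiv.symm_apply_eq]
  exact e.transport (E.symm y) y (fun a => by rw [hE, LinearEquiv.apply_symm_apply]) a

theorem cls_reverse (G : FlatGraph R) : G.reverse.cls = - G.cls := kap_symm _

theorem cls_sum (G G' : FlatGraph R) : (G.sum G').cls = G.cls + G'.cls :=
  kap_pi_split (Equiv.refl (G.Arc ⊕ G'.Arc)) (G.sum G').fiber (G.sum G').transport
    G.transport G'.transport (fun _ _ _ => rfl) fun _ _ => rfl

theorem cls_sigma_eq_zero {ι : Type} [Finite ι] (M : ι → FlatGraph R) (h : ∀ i, (M i).cls = 0) :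
    (sigma M).cls = 0 := by
  rw [← kap_piCongrRight (fun i => FGProj.pi (M i).fiber) (fun i => (M i).transport) h]
  exact kap_conj (LinearEquiv.piCurry R fun i a => ((M i).fiber a).carrier) fun _ => rfl

/-- Cyclic shifts of the summands in each of finitely many sums of equal modules. -/
def rotate {ι : Type} (n : ι → ℕ) (P : ι → FGProj R) :
    (∀ s : Σ i, Fin (n i + 1), P s.1) ≃ₗ[R] (∀ s : Σ i, Fin (n i + 1), P s.1) :=
  ((LinearEquiv.piCurry R fun i (_ : Fin (n i + 1)) => (P i).carrier).trans
    (LinearEquiv.piCongrRight fun i =>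
      LinearEquiv.funCongrLeft R (P i) (Equiv.subRight (1 : Fin (n i + 1))))).trans
    (LinearEquiv.piCurry R fun i (_ : Fin (n i + 1)) => (P i).carrier).symm

theorem kap_rotate {ι : Type} [Finite ι] (n : ι → ℕ) (P : ι → FGProj R) :
    kap (rotate n P) = 0 := by
  rw [← kap_piCongrRight (fun i => FGProj.pi fun _ : Fin (n i + 1) => P i)
    (fun i => LinearEquiv.funCongrLeft R (P i) (Equiv.subRight (1 : Fin (n i + 1))))
    fun i => kap_eq_zero_of_perm _]
  exact kap_conj (LinearEquiv.piCurry R fun i (_ : Fin (n i + 1)) => (P i).carrier) fun _ => rfl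

/-- Undoing the rotation of the points on each edge leaves the original transport on the first
points and the identity on all others, and rotations have class zero. -/
theorem cls_subdivide (G : FlatGraph R) (r : G.Arc → ℕ) : (G.subdivide r).cls = G.cls := by
  let e : G.Arc ⊕ (Σ a, Fin (r a)) ≃ Σ a, Fin (r a + 1) :=
    { toFun := Sum.elim (fun a => ⟨a, 0⟩) (fun s => ⟨s.1, s.2.succ⟩)
      invFun := fun s => Fin.cases (motive := fun _ => G.Arc ⊕ (Σ a, Fin (r a))) (Sum.inl s.1)
        (fun j => Sum.inr ⟨s.1, j⟩) s.2
      left_inv := by rintro (a | ⟨a, j⟩) <;> rfl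
      right_inv := by
        rintro ⟨a, i⟩
        refine Fin.cases rfl (fun j => rfl) i }
  -- The inverse rotation reads the next point of the edge, cyclically: after the last point comes
  -- the first.
  have h0 : ∀ (x : ∀ s : Σ a, Fin (r a + 1), G.fiber s.1) a,
      (rotate r G.fiber).symm x ⟨a, Fin.last (r a)⟩ = x ⟨a, 0⟩ := fun x a => by
    let y : Fin (r a + 1) → G.fiber a := fun j => x ⟨a, j⟩
    exact congrArg y (Fin.last_add_one (r a))
  have h1 : ∀ (x : ∀ s : Σ a, Fin (r a + 1), G.fiber s.1) a (j : Fin (r a)),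
      (rotate r G.fiber).symm x ⟨a, j.castSucc⟩ = x ⟨a, j.succ⟩ := fun x a j => by
    let y : Fin (r a + 1) → G.fiber a := fun j => x ⟨a, j⟩
    exact congrArg y (Fin.coeSucc_eq_succ)
  let T : (∀ s : Σ a, Fin (r a + 1), G.fiber s.1) ≃ₗ[R] (∀ s : Σ a, Fin (r a + 1), G.fiber s.1) :=
    (G.subdivide r).transport
  let D := (rotate r G.fiber).symm.trans T
  have hD : kap D = G.cls := by
    refine (kap_pi_split e (G.subdivide r).fiber D G.transport 1 (fun x _ a => ?_)
      fun x k => ?_).trans ?_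
    · exact congrArg (fun z => G.transport z a) (funext fun b => h0 x b)
    · exact h1 x k.1 k.2
    · rw [kap_one, add_zero]; rfl
  have h := kap_trans (rotate r G.fiber).symm T
  rw [kap_symm, kap_rotate, neg_zero, zero_add] at h
  exact h.symm.trans hD

variable {M : FlatGraph R}

theorem cls_eq_zero_of_isCircleLink (h : M.IsCircleLink) : M.cls = 0 := by
  obtain ⟨a, v, ha, -, h⟩ := h
  refine kap_eq_zero_of_forall fun x => ?_
  obtain ⟨y, hy, hya⟩ := h (x a)
  obtain rfl : y = x := funext fun b => by
    obtain rfl := ha b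
    exact hya
  exact hy

theorem transport_eq_single [DecidableEq M.Arc] {b c : M.Arc}
    (h : ∀ a, M.tgt a = M.src b → a = c) (x : ∀ a, M.fiber a) :
    M.transport x b = M.transport (Pi.single c (x c)) b :=
  M.transport_local _ _ _ fun a ha => by
    obtain rfl := h a ha
    rw [Pi.single_eq_same]

theorem transport_eq_single_add_single [DecidableEq M.Arc] {b c d : M.Arc} (hcd : c ≠ d)
    (h : ∀ a, M.tgt a = M.src b → a = c ∨ a = d) (x : ∀ a, M.fiber a) :
    M.transport x b =
      M.transport (Pi.single c (x c)) b + M.transport (Pi.single d (x d)) b := by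
  rw [← Pi.add_apply, ← map_add]
  refine M.transport_local _ _ _ fun a ha => ?_
  rcases h a ha with rfl | rfl
  · rw [Pi.add_apply, Pi.single_eq_same, Pi.single_eq_of_ne hcd, add_zero]
  · rw [Pi.add_apply, Pi.single_eq_same, Pi.single_eq_of_ne hcd.symm, zero_add]

/-- The matrix coefficient of `transport` from the arc `c` to the arc `b`. -/
def coeff (M : FlatGraph R) [DecidableEq M.Arc] (b c : M.Arc) : M.fiber c →ₗ[R] M.fiber b :=
  LinearMap.proj b ∘ₗ M.transport.toLinearMap ∘ₗ LinearMap.single R (fun a => (M.fiber a).carrier) c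

/-- Parallel sections make merging the inverse of splitting, so transport exchanges the thick fiber
with the sum of the thin ones. -/
theorem cls_eq_zero_of_isThetaLink (h : M.IsThetaLink) : M.cls = 0 := by
  classical
  obtain ⟨a₁, a₂, a₁₂, v, w, hnd, hall, hvw, -, s₁, t₁, s₂, t₂, s₁₂, t₁₂, hpar⟩ := h
  simp only [List.nodup_cons, List.mem_cons, List.not_mem_nil, or_false, not_or] at hnd hall
  obtain ⟨⟨h1, h2⟩, h3, -⟩ := hnd
  have hT1 : ∀ x, M.transport x a₁ = M.coeff a₁ a₁₂ (x a₁₂) := fun x =>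
    transport_eq_single (fun a ha => by
      rcases hall a with rfl | rfl | rfl
      · exact absurd (t₁.symm.trans (ha.trans s₁)) hvw
      · exact absurd (t₂.symm.trans (ha.trans s₁)) hvw
      · rfl) x
  have hT2 : ∀ x, M.transport x a₂ = M.coeff a₂ a₁₂ (x a₁₂) := fun x =>
    transport_eq_single (fun a ha => by
      rcases hall a with rfl | rfl | rfl
      · exact absurd (t₁.symm.trans (ha.trans s₂)) hvw
      · exact absurd (t₂.symm.trans (ha.trans s₂)) hvw
      · rfl) x
  have hT12 : ∀ x, M.transport x a₁₂ = M.coeff a₁₂ a₁ (x a₁) + M.coeff a₁₂ a₂ (x a₂) := fun x =>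
    transport_eq_single_add_single h1 (fun a ha => by
      rcases hall a with rfl | rfl | rfl
      · exact Or.inl rfl
      · exact Or.inr rfl
      · exact absurd (s₁₂.symm.trans (ha.symm.trans t₁₂)) hvw) x
  have hm : ∀ ξ, M.coeff a₁₂ a₁ (M.coeff a₁ a₁₂ ξ) + M.coeff a₁₂ a₂ (M.coeff a₂ a₁₂ ξ) = ξ := by
    intro ξ
    obtain ⟨x, hx, rfl⟩ := hpar ξ
    rw [← hT1, ← hT2, hx, ← hT12, hx]
  let s : M.fiber a₁₂ →ₗ[R] M.fiber a₁ × M.fiber a₂ := (M.coeff a₁ a₁₂).prod (M.coeff a₂ a₁₂)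
  -- Transport is onto the sum of all fibers, and its thin coordinates depend only on the thick one.
  have hs : Function.Surjective s := by
    rintro ⟨y, z⟩
    obtain ⟨x, hx⟩ := M.transport.surjective (Pi.single a₁ y + Pi.single a₂ z)
    refine ⟨x a₁₂, Prod.ext ?_ ?_⟩
    · change M.coeff a₁ a₁₂ (x a₁₂) = y
      rw [← hT1, hx, Pi.add_apply, Pi.single_eq_same, Pi.single_eq_of_ne h1, add_zero]
    · change M.coeff a₂ a₁₂ (x a₁₂) = z
      rw [← hT2, hx, Pi.add_apply, Pi.single_eq_same, Pi.single_eq_of_ne (Ne.symm h1), zero_add]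
  have hinj : Function.Injective s := by
    intro ξ η h
    rw [← hm ξ, ← hm η]
    have h4 : M.coeff a₁ a₁₂ ξ = M.coeff a₁ a₁₂ η := congrArg Prod.fst h
    have h5 : M.coeff a₂ a₁₂ ξ = M.coeff a₂ a₁₂ η := congrArg Prod.snd h
    rw [h4, h5]
  let S := LinearEquiv.ofBijective s ⟨hinj, hs⟩
  let E : (∀ a, M.fiber a) →ₗ[R] M.fiber a₁₂ × (M.fiber a₁ × M.fiber a₂) :=
    (LinearMap.proj a₁₂).prod ((LinearMap.proj a₁).prod (LinearMap.proj a₂))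
  have hE : Function.Bijective E := by
    constructor
    · refine (injective_iff_map_eq_zero E).2 fun x hx => funext fun a => ?_
      rcases hall a with rfl | rfl | rfl
      · exact congrArg (fun z => z.2.1) hx
      · exact congrArg (fun z => z.2.2) hx
      · exact congrArg Prod.fst hx
    · rintro ⟨z, y₁, y₂⟩
      refine ⟨Function.update (Function.update (Pi.single a₁₂ z) a₁ y₁) a₂ y₂, ?_⟩
      simp [E, h1, Ne.symm h2, Ne.symm h3]
  refine kap_eq_zero_of_exchange (LinearEquiv.ofBijective E hE) S fun x => ?_
  change (M.transport x a₁₂, (M.transport x a₁, M.transport x a₂)) =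
    (S.symm (x a₁, x a₂), (M.coeff a₁ a₁₂ (x a₁₂), M.coeff a₂ a₁₂ (x a₁₂)))
  rw [hT1, hT2]
  refine Prod.ext ?_ rfl
  refine (S.symm_apply_eq.2 ?_).symm
  obtain ⟨ξ, hξ⟩ := hs (x a₁, x a₂)
  have h4 : M.coeff a₁ a₁₂ ξ = x a₁ := congrArg Prod.fst hξ
  have h5 : M.coeff a₂ a₁₂ ξ = x a₂ := congrArg Prod.snd hξ
  change (x a₁, x a₂) = s (M.transport x a₁₂)
  rw [hT12, ← h4, ← h5, hm]
  rfl

end FlatGraph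

/-! ### The link of a foam vertex -/

section Tetrahedron

variable {R : Type u} [Ring R] {Q₁ Q₂ Q₃ Q₁₂ Q₂₃ Q₁₂₃ : FGProj R}

/-- The monodromy around a tetrahedron permutes the summands, once all fibers are decomposed
into three modules. -/
theorem kap_eq_zero_of_tetrahedron
    (p₁ : Q₁₂ →ₗ[R] Q₁) (p₂ : Q₁₂ →ₗ[R] Q₂) (q₁₂ : Q₁₂₃ →ₗ[R] Q₁₂) (q₃ : Q₁₂₃ →ₗ[R] Q₃)
    (m₂ : Q₂ →ₗ[R] Q₂₃) (m₃ : Q₃ →ₗ[R] Q₂₃) (n₁ : Q₁ →ₗ[R] Q₁₂₃) (n₂₃ : Q₂₃ →ₗ[R] Q₁₂₃)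
    (T : (Q₁ × Q₂ × Q₃ × Q₁₂ × Q₂₃ × Q₁₂₃) ≃ₗ[R] (Q₁ × Q₂ × Q₃ × Q₁₂ × Q₂₃ × Q₁₂₃))
    (hT : ∀ x₁ x₂ x₃ x₁₂ x₂₃ x₁₂₃, T (x₁, x₂, x₃, x₁₂, x₂₃, x₁₂₃) =
      (p₁ x₁₂, p₂ x₁₂, q₃ x₁₂₃, q₁₂ x₁₂₃, m₂ x₂ + m₃ x₃, n₁ x₁ + n₂₃ x₂₃))
    (hpar : ∀ ξ, n₁ (p₁ (q₁₂ ξ)) + n₂₃ (m₂ (p₂ (q₁₂ ξ)) + m₃ (q₃ ξ)) = ξ) : kap T = 0 := by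
  -- Bijectivity of the individual splittings and merges is not assumed; it is read off from `T` on
  -- vectors supported at one vertex.
  have hp : ∀ u v, ∃ z, p₁ z = u ∧ p₂ z = v := fun u v => by
    obtain ⟨⟨x₁, x₂, x₃, x₁₂, x₂₃, x₁₂₃⟩, h⟩ := T.surjective (u, v, 0, 0, 0, 0)
    simp only [hT, Prod.mk.injEq] at h
    exact ⟨x₁₂, h.1, h.2.1⟩
  have hq : ∀ z w, ∃ y, q₁₂ y = z ∧ q₃ y = w := fun z w => by
    obtain ⟨⟨x₁, x₂, x₃, x₁₂, x₂₃, x₁₂₃⟩, h⟩ := T.surjective (0, 0, w, z, 0, 0)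
    simp only [hT, Prod.mk.injEq] at h
    exact ⟨x₁₂₃, h.2.2.2.1, h.2.2.1⟩
  have hm : ∀ y, ∃ v w, m₂ v + m₃ w = y := fun y => by
    obtain ⟨⟨x₁, x₂, x₃, x₁₂, x₂₃, x₁₂₃⟩, h⟩ := T.surjective (0, 0, 0, 0, y, 0)
    simp only [hT, Prod.mk.injEq] at h
    exact ⟨x₂, x₃, h.2.2.2.2.1⟩
  have hs : ∀ u v w, ∃ y, p₁ (q₁₂ y) = u ∧ p₂ (q₁₂ y) = v ∧ q₃ y = w := fun u v w => by
    obtain ⟨z, h1, h2⟩ := hp u v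
    obtain ⟨y, rfl, h4⟩ := hq z w
    exact ⟨y, h1, h2, h4⟩
  -- By `hpar`, merging is a left inverse of the full splitting of `Q₁₂₃`; as that splitting is
  -- onto, it is a right inverse too.
  have key : ∀ u v w, p₁ (q₁₂ (n₁ u + n₂₃ (m₂ v + m₃ w))) = u ∧
      p₂ (q₁₂ (n₁ u + n₂₃ (m₂ v + m₃ w))) = v ∧ q₃ (n₁ u + n₂₃ (m₂ v + m₃ w)) = w := by
    intro u v w
    obtain ⟨y, rfl, rfl, rfl⟩ := hs u v w
    rw [hpar]
    exact ⟨rfl, rfl, rfl⟩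
  have k1 : ∀ u, p₁ (q₁₂ (n₁ u)) = u ∧ p₂ (q₁₂ (n₁ u)) = 0 ∧ q₃ (n₁ u) = 0 := fun u => by
    simpa using key u 0 0
  have k2 : ∀ v w, p₁ (q₁₂ (n₂₃ (m₂ v + m₃ w))) = 0 ∧ p₂ (q₁₂ (n₂₃ (m₂ v + m₃ w))) = v ∧
      q₃ (n₂₃ (m₂ v + m₃ w)) = w := fun v w => by
    simpa only [map_zero, zero_add] using key 0 v w
  have k3 : ∀ y, p₁ (q₁₂ (n₂₃ y)) = 0 := fun y => by
    obtain ⟨v, w, rfl⟩ := hm y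
    exact (k2 v w).1
  have sinj : ∀ y, p₁ (q₁₂ y) = 0 → p₂ (q₁₂ y) = 0 → q₃ y = 0 → y = 0 := fun y h1 h2 h3 => by
    rw [← hpar y, h1, h2, h3]
    simp
  -- `Q₁` occurs in the three fibers `Q₁, Q₁₂, Q₁₂₃`, `Q₂` in four and `Q₃` in three. The
  -- occurrences are listed so that `T` replaces each entry by the next one, cyclically. The
  -- components of `Q₂₃` are read after inclusion into `Q₁₂₃`.
  let E₁ : (Q₁ × Q₂ × Q₃ × Q₁₂ × Q₂₃ × Q₁₂₃) →ₗ[R] (Fin 3 → Q₁) :=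
    { toFun := fun x => ![x.1, p₁ x.2.2.2.1, p₁ (q₁₂ x.2.2.2.2.2)]
      map_add' := fun x y => by simp
      map_smul' := fun c x => by simp }
  let E₂ : (Q₁ × Q₂ × Q₃ × Q₁₂ × Q₂₃ × Q₁₂₃) →ₗ[R] (Fin 4 → Q₂) :=
    { toFun := fun x => ![x.2.1, p₂ x.2.2.2.1, p₂ (q₁₂ x.2.2.2.2.2), p₂ (q₁₂ (n₂₃ x.2.2.2.2.1))]
      map_add' := fun x y => by simp
      map_smul' := fun c x => by simp }
  let E₃ : (Q₁ × Q₂ × Q₃ × Q₁₂ × Q₂₃ × Q₁₂₃) →ₗ[R] (Fin 3 → Q₃) :=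
    { toFun := fun x => ![x.2.2.1, q₃ x.2.2.2.2.2, q₃ (n₂₃ x.2.2.2.2.1)]
      map_add' := fun x y => by simp
      map_smul' := fun c x => by simp }
  let E := E₁.prod (E₂.prod E₃)
  have hE : Function.Bijective E := by
    constructor
    · refine (injective_iff_map_eq_zero E).2 ?_
      rintro ⟨x₁, x₂, x₃, x₁₂, x₂₃, x₁₂₃⟩ hx
      have h1 : ![x₁, p₁ x₁₂, p₁ (q₁₂ x₁₂₃)] = 0 := congrArg Prod.fst hx
      have h2 : ![x₂, p₂ x₁₂, p₂ (q₁₂ x₁₂₃), p₂ (q₁₂ (n₂₃ x₂₃))] = 0 :=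
        congrArg (fun z => z.2.1) hx
      have h3 : ![x₃, q₃ x₁₂₃, q₃ (n₂₃ x₂₃)] = 0 := congrArg (fun z => z.2.2) hx
      have h12 : x₁₂ = 0 := by
        have h : T (0, 0, 0, x₁₂, 0, 0) = 0 := by
          rw [hT, show p₁ x₁₂ = 0 from congrFun h1 1, show p₂ x₁₂ = 0 from congrFun h2 1]
          simp
        exact congrArg (fun z => z.2.2.2.1) ((LinearEquiv.map_eq_zero_iff T).1 h)
      have h123 : x₁₂₃ = 0 := sinj _ (congrFun h1 2) (congrFun h2 2) (congrFun h3 1)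
      have h23 : x₂₃ = 0 := by
        have h0 : n₂₃ x₂₃ = 0 := sinj _ (k3 _) (congrFun h2 3) (congrFun h3 2)
        have h : T (0, 0, 0, 0, x₂₃, 0) = 0 := by
          rw [hT, h0]
          simp
        exact congrArg (fun z => z.2.2.2.2.1) ((LinearEquiv.map_eq_zero_iff T).1 h)
      rw [show x₁ = 0 from congrFun h1 0, show x₂ = 0 from congrFun h2 0,
        show x₃ = 0 from congrFun h3 0, h12, h123, h23]
      rfl
    · rintro ⟨f, g, h⟩
      obtain ⟨x₁₂, h1, h2⟩ := hp (f 1) (g 1)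
      obtain ⟨x₁₂₃, h3, h4, h5⟩ := hs (f 2) (g 2) (h 1)
      refine ⟨(f 0, g 0, h 0, x₁₂, m₂ (g 3) + m₃ (h 2), x₁₂₃), ?_⟩
      refine Prod.ext ?_ (Prod.ext ?_ ?_)
      · funext i
        fin_cases i <;> [rfl; exact h1; exact h3]
      · funext i
        fin_cases i <;> [rfl; exact h2; exact h4; exact (k2 _ _).2.1]
      · funext i
        fin_cases i <;> [rfl; exact h5; exact (k2 _ _).2.2]
  have hz := kap_prodCongr (LinearEquiv.funCongrLeft R Q₁ (Equiv.addRight (1 : Fin 3)))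
    ((LinearEquiv.funCongrLeft R Q₂ (Equiv.addRight (1 : Fin 4))).prodCongr
      (LinearEquiv.funCongrLeft R Q₃ (Equiv.addRight (1 : Fin 3))))
  rw [kap_prodCongr (LinearEquiv.funCongrLeft R Q₂ (Equiv.addRight (1 : Fin 4))),
    kap_eq_zero_of_perm, kap_eq_zero_of_perm, kap_eq_zero_of_perm, add_zero, add_zero] at hz
  rw [← hz]
  refine kap_conj (LinearEquiv.ofBijective E hE) ?_
  rintro ⟨x₁, x₂, x₃, x₁₂, x₂₃, x₁₂₃⟩
  change E (T (x₁, x₂, x₃, x₁₂, x₂₃, x₁₂₃)) = _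
  rw [hT]
  refine Prod.ext ?_ (Prod.ext ?_ ?_)
  · funext i
    fin_cases i
    · rfl
    · rfl
    · change p₁ (q₁₂ (n₁ x₁ + n₂₃ x₂₃)) = x₁
      rw [map_add, map_add, k3, add_zero, (k1 _).1]
  · funext i
    fin_cases i
    · rfl
    · rfl
    · change p₂ (q₁₂ (n₁ x₁ + n₂₃ x₂₃)) = p₂ (q₁₂ (n₂₃ x₂₃))
      rw [map_add, map_add, (k1 _).2.1, zero_add]
    · exact (k2 _ _).2.1
  · funext i
    fin_cases i
    · rfl
    · change q₃ (n₁ x₁ + n₂₃ x₂₃) = q₃ (n₂₃ x₂₃)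
      rw [map_add, (k1 _).2.2, zero_add]
    · exact (k2 _ _).2.2

end Tetrahedron

/-! ### Vanishing of the class on all vertex links -/

namespace FlatGraph

variable {R : Type u} [Ring R] {M : FlatGraph R}

/-- Listing the six edges makes transport the block matrix of `kap_eq_zero_of_tetrahedron`; locality
and the incidences leave only the coefficients appearing there. -/
theorem cls_eq_zero_of_isTetrahedronLink (h : M.IsTetrahedronLink) : M.cls = 0 := by
  classical
  obtain ⟨a₁, a₂, a₃, a₁₂, a₂₃, a₁₂₃, v₁, v₂, v₃, v₄, hnd, hall, hv, -, t₁₂₃, s₁₂, s₃, t₁₂, s₁, s₂,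
    t₂, t₃, s₂₃, t₁, t₂₃, s₁₂₃, hpar⟩ := h
  simp only [List.nodup_cons, List.mem_cons, List.not_mem_nil, or_false, not_or] at hnd hall hv
  obtain ⟨⟨h1, h2, h3, h4, h5⟩, ⟨h6, h7, h8, h9⟩, ⟨h10, h11, h12⟩, ⟨h13, h14⟩, h15, -⟩ := hnd
  obtain ⟨⟨g1, g2, g3⟩, ⟨g4, g5⟩, g6, -⟩ := hv
  have hT1 : ∀ x, M.transport x a₁ = M.coeff a₁ a₁₂ (x a₁₂) := fun x =>
    transport_eq_single (fun a ha => by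
      rcases hall a with rfl | rfl | rfl | rfl | rfl | rfl <;> simp_all) x
  have hT2 : ∀ x, M.transport x a₂ = M.coeff a₂ a₁₂ (x a₁₂) := fun x =>
    transport_eq_single (fun a ha => by
      rcases hall a with rfl | rfl | rfl | rfl | rfl | rfl <;> simp_all) x
  have hT3 : ∀ x, M.transport x a₃ = M.coeff a₃ a₁₂₃ (x a₁₂₃) := fun x =>
    transport_eq_single (fun a ha => by
      rcases hall a with rfl | rfl | rfl | rfl | rfl | rfl <;> simp_all) x
  have hT12 : ∀ x, M.transport x a₁₂ = M.coeff a₁₂ a₁₂₃ (x a₁₂₃) := fun x =>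
    transport_eq_single (fun a ha => by
      rcases hall a with rfl | rfl | rfl | rfl | rfl | rfl <;> simp_all) x
  have hT23 : ∀ x, M.transport x a₂₃ = M.coeff a₂₃ a₂ (x a₂) + M.coeff a₂₃ a₃ (x a₃) := fun x =>
    transport_eq_single_add_single h6 (fun a ha => by
      rcases hall a with rfl | rfl | rfl | rfl | rfl | rfl <;> simp_all) x
  have hT123 : ∀ x, M.transport x a₁₂₃ = M.coeff a₁₂₃ a₁ (x a₁) + M.coeff a₁₂₃ a₂₃ (x a₂₃) :=
    fun x => transport_eq_single_add_single h4 (fun a ha => by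
      rcases hall a with rfl | rfl | rfl | rfl | rfl | rfl <;> simp_all) x
  let E : (∀ a, M.fiber a) →ₗ[R] M.fiber a₁ × M.fiber a₂ × M.fiber a₃ × M.fiber a₁₂ ×
      M.fiber a₂₃ × M.fiber a₁₂₃ :=
    (LinearMap.proj a₁).prod ((LinearMap.proj a₂).prod ((LinearMap.proj a₃).prod
      ((LinearMap.proj a₁₂).prod ((LinearMap.proj a₂₃).prod (LinearMap.proj a₁₂₃)))))
  have hE : Function.Bijective E := by
    constructor
    · refine (injective_iff_map_eq_zero E).2 fun x hx => funext fun a => ?_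
      rcases hall a with rfl | rfl | rfl | rfl | rfl | rfl
      · exact congrArg Prod.fst hx
      · exact congrArg (fun z => z.2.1) hx
      · exact congrArg (fun z => z.2.2.1) hx
      · exact congrArg (fun z => z.2.2.2.1) hx
      · exact congrArg (fun z => z.2.2.2.2.1) hx
      · exact congrArg (fun z => z.2.2.2.2.2) hx
    · rintro ⟨x₁, x₂, x₃, x₁₂, x₂₃, x₁₂₃⟩
      refine ⟨Function.update (Function.update (Function.update (Function.update (Function.update
        (Pi.single a₁₂₃ x₁₂₃) a₂₃ x₂₃) a₁₂ x₁₂) a₃ x₃) a₂ x₂) a₁ x₁, ?_⟩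
      simp [E, Ne.symm h1, Ne.symm h2, Ne.symm h3, Ne.symm h4, Ne.symm h5, Ne.symm h6, Ne.symm h7, Ne.symm h8,
        Ne.symm h9, Ne.symm h10, Ne.symm h11, Ne.symm h12, Ne.symm h13, Ne.symm h14, Ne.symm h15]
  let e := LinearEquiv.ofBijective E hE
  have he : ∀ x, e x = (x a₁, x a₂, x a₃, x a₁₂, x a₂₃, x a₁₂₃) := fun _ => rfl
  rw [← kap_eq_zero_of_tetrahedron (M.coeff a₁ a₁₂) (M.coeff a₂ a₁₂) (M.coeff a₁₂ a₁₂₃)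
    (M.coeff a₃ a₁₂₃) (M.coeff a₂₃ a₂) (M.coeff a₂₃ a₃) (M.coeff a₁₂₃ a₁) (M.coeff a₁₂₃ a₂₃)
    ((e.symm.trans M.transport).trans e) ?_ ?_]
  · exact kap_conj e fun x => by simp
  · intro x₁ x₂ x₃ x₁₂ x₂₃ x₁₂₃
    have h := he (e.symm (x₁, x₂, x₃, x₁₂, x₂₃, x₁₂₃))
    rw [e.apply_symm_apply] at h
    simp only [Prod.mk.injEq] at h
    obtain ⟨k1, k2, k3, k4, k5, k6⟩ := h
    rw [LinearEquiv.trans_apply, LinearEquiv.trans_apply, he, hT1, hT2, hT3, hT12, hT23, hT123,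
      ← k1, ← k2, ← k3, ← k4, ← k5, ← k6]
  · intro ξ
    obtain ⟨x, hx, rfl⟩ := hpar ξ
    -- Each rewriting by `hx` uses that `x` is parallel, following the vector once around the
    -- tetrahedron.
    rw [← hT12, ← hT3, hx, ← hT1, ← hT2, hx, ← hT23, hx, ← hT123, hx]

theorem cls_eq_zero_of_isVertexLink (h : M.IsVertexLink) : M.cls = 0 := by
  rcases h with h | h | h
  · exact cls_eq_zero_of_isCircleLink h
  · exact cls_eq_zero_of_isThetaLink h
  · exact cls_eq_zero_of_isTetrahedronLink h

end FlatGraph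

/-! ### The links in a 2-foam have total class zero -/

namespace PolygonComplex

variable {R : Type u} [Ring R]

/-- Gluing is an involution which carries sections on positive sides to sections on negative sides
and conversely, hence an exchange. -/
theorem kap_glue (F : PolygonComplex R) : kap F.glue = 0 := by
  let E : (∀ s : F.Side, F.fiber s.1) ≃ₗ[R]
      (∀ s : {s : F.Side // F.sgn s = true}, F.fiber s.1.1) ×
        (∀ s : {s : F.Side // ¬ F.sgn s = true}, F.fiber s.1.1) :=
    { toFun := fun x => (fun s => x s.1, fun s => x s.1)
      invFun := fun y s => if h : F.sgn s = true then y.1 ⟨s, h⟩ else y.2 ⟨s, h⟩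
      map_add' := fun _ _ => rfl
      map_smul' := fun _ _ => rfl
      left_inv := fun x => by
        funext s
        by_cases h : F.sgn s = true <;> simp [h]
      right_inv := fun y => by
        refine Prod.ext (funext fun s => ?_) (funext fun s => ?_)
        · exact dif_pos s.2
        · exact dif_neg s.2 }
  have hE : ∀ x : ∀ s : F.Side, F.fiber s.1,
      E x = ((fun s : {s : F.Side // F.sgn s = true} => x s.1),
        (fun s : {s : F.Side // ¬ F.sgn s = true} => x s.1)) := fun _ => rfl
  have hp : ∀ y s (h : F.sgn s = true), E.symm y s = y.1 ⟨s, h⟩ := fun y s h => dif_pos h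
  have hn : ∀ y s (h : ¬ F.sgn s = true), E.symm y s = y.2 ⟨s, h⟩ := fun y s h => dif_neg h
  have h0 : ∀ s, F.glue 0 s = 0 := fun s => congrFun F.glue.map_zero s
  -- By locality, gluing at a positive side reads only negative sides, where the section is zero;
  -- `h2` is the mirror statement.
  have h1 : ∀ u, (E (F.glue (E.symm (u, 0)))).1 = 0 := fun u => by
    rw [hE]
    refine funext fun s => (F.glue_local _ 0 s.1 fun t _ ht => ?_).trans (h0 _)
    rw [hn _ t fun h => ht (h.trans s.2.symm)]
    rfl
  have h2 : ∀ w, (E (F.glue (E.symm (0, w)))).2 = 0 := fun w => by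
    rw [hE]
    refine funext fun s => (F.glue_local _ 0 s.1 fun t _ ht => ?_).trans (h0 _)
    have hs := s.2
    have ht' : F.sgn t = true := by
      revert ht hs
      cases F.sgn t <;> cases F.sgn s.1 <;> simp
    rw [hp _ t ht']
    rfl
  -- The positive-to-negative half of the gluing; its inverse is the other half because gluing
  -- squares to the identity.
  let f : (∀ s : {s : F.Side // F.sgn s = true}, F.fiber s.1.1) ≃ₗ[R]
        (∀ s : {s : F.Side // ¬ F.sgn s = true}, F.fiber s.1.1) :=
    { (LinearMap.snd R _ _ ∘ₗ E.toLinearMap ∘ₗ F.glue.toLinearMap ∘ₗ E.symm.toLinearMap ∘ₗ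
        LinearMap.inl R _ _) with
      invFun := fun w => (E (F.glue (E.symm (0, w)))).1
      left_inv := fun u => by
        change (E (F.glue (E.symm (0, (E (F.glue (E.symm (u, 0)))).2)))).1 = u
        have h : ((0, (E (F.glue (E.symm (u, 0)))).2) : _ × _) = E (F.glue (E.symm (u, 0))) :=
          Prod.ext (h1 u).symm rfl
        rw [h, E.symm_apply_apply, F.glue_glue, E.apply_symm_apply]
      right_inv := fun w => by
        change (E (F.glue (E.symm ((E (F.glue (E.symm (0, w)))).1, 0)))).2 = w
        have h : (((E (F.glue (E.symm (0, w)))).1, 0) : _ × _) = E (F.glue (E.symm (0, w))) :=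
          Prod.ext rfl (h2 w).symm
        rw [h, E.symm_apply_apply, F.glue_glue, E.apply_symm_apply] }
  refine kap_eq_zero_of_exchange E f fun x => ?_
  have hx : x = E.symm ((E x).1, 0) + E.symm (0, (E x).2) := by
    rw [← map_add, Prod.mk_add_mk, add_zero, zero_add, E.symm_apply_apply]
  have key : E (F.glue x) = E (F.glue (E.symm ((E x).1, 0))) + E (F.glue (E.symm (0, (E x).2))) := by
    rw [← map_add, ← map_add, ← hx]
  rw [key]
  refine Prod.ext ?_ ?_
  · rw [Prod.fst_add, h1, zero_add]
    rfl
  · rw [Prod.snd_add, h2, add_zero]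
    rfl

/-- Transport of the link is a cyclic rotation of the corners within each polygon, followed by the
gluing. -/
theorem cls_link (F : PolygonComplex R) : F.link.cls = 0 := by
  have h : kap F.shift = 0 := FlatGraph.kap_rotate F.n F.fiber
  refine (kap_trans F.shift F.glue).trans ?_
  rw [h, kap_glue, add_zero]

end PolygonComplex

/-! ### Cobordism invariance and the homomorphism `γ` -/

theorem Cobordant.cls_eq {R : Type u} [Ring R] {U W : OneFoam R} (h : Cobordant U W) :
    U.toFlatGraph.cls = W.toFlatGraph.cls := by
  obtain ⟨F, ι, _, M, hM, r, ⟨e⟩⟩ := h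
  have h := F.cls_link
  rw [FlatGraph.cls_congr e, FlatGraph.cls_subdivide, FlatGraph.cls_sum,
    FlatGraph.cls_sigma_eq_zero M fun i => FlatGraph.cls_eq_zero_of_isVertexLink (hM i), add_zero]
    at h
  have h' : U.toFlatGraph.reverse.cls + W.toFlatGraph.cls = 0 :=
    (FlatGraph.cls_sum U.toFlatGraph.reverse W.toFlatGraph).symm.trans h
  rwa [FlatGraph.cls_reverse, neg_add_eq_zero] at h'

/-- The homomorphism `γ`. -/
def gamma (R : Type u) [Ring R] : Cob1 R →+ K1 R ⧸ (tau R).range where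
  toFun := Quot.lift (fun U => U.toFlatGraph.cls) fun _ _ h => h.cls_eq
  map_zero' := kap_eq_zero_of_forall fun _ => rfl
  map_add' x y := by
    induction x using Cob1.ind with | _ U
    induction y using Cob1.ind with | _ W
    exact FlatGraph.cls_sum U.toFlatGraph W.toFlatGraph

/-- The map `f_B` is by construction the transport of a subdivision. -/
theorem gamma_mk_strongCut {R : Type u} [Ring R] (U : OneFoam R) (B : U.StrongCut) :
    gamma R (Cob1.mk U) = QuotientAddGroup.mk (K1.cls (U.cutModule B) (U.cutMap B)) :=
  (U.toFlatGraph.cls_subdivide B).symm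

/-! ### Foams without vertices built from matchings -/

/-- A pairing of the vertices of a 1-foam, by which each vertex is matched to the mirror image of
another one. The arcs ending at `v` correspond to the arcs beginning at the partner of `v`. -/
structure Matching {R : Type u} [Ring R] (W : OneFoam R) where
  partner : W.Vert → W.Vert
  pos : W.Vert → Bool
  partner_partner : ∀ v, partner (partner v) = v
  pos_partner : ∀ v, pos (partner v) = !pos v
  perm : Equiv.Perm W.Arc
  iso : ∀ a, W.fiber a ≃ₗ[R] W.fiber (perm a)
  src_perm : ∀ a, W.src (perm a) = partner (W.tgt a)
  -- Transport followed by the inverse of all `iso a` squares to the identity: the isomorphisms at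
  -- partner vertices are mutually inverse once fibers are identified.
  involutive : ∀ x y z : (∀ a, W.fiber a), (∀ a, iso a (y a) = W.transport x (perm a)) →
    (∀ a, iso a (z a) = W.transport y (perm a)) → z = x

namespace Matching

variable {R : Type u} [Ring R] {W : OneFoam R} (m : Matching W)

/-- The isomorphisms `iso a`, as an automorphism of the sum of all fibers. -/
def total : (∀ a, W.fiber a) ≃ₗ[R] (∀ a, W.fiber a) :=
  (LinearEquiv.piCongrRight m.iso).trans
    (LinearEquiv.piCongrLeft R (fun a => (W.fiber a).carrier) m.perm)

theorem total_symm_apply (x : ∀ a, W.fiber a) (a : W.Arc) :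
    m.total.symm x a = (m.iso a).symm (x (m.perm a)) := rfl

theorem total_apply (x : ∀ a, W.fiber a) (a : W.Arc) :
    m.total x (m.perm a) = m.iso a (x a) := by
  rw [← LinearEquiv.symm_apply_eq, ← total_symm_apply, LinearEquiv.symm_apply_apply]

/-- The transport across the seams. -/
def cross : (∀ a, W.fiber a) ≃ₗ[R] (∀ a, W.fiber a) := W.transport.trans m.total.symm

theorem cross_apply (x : ∀ a, W.fiber a) (a : W.Arc) :
    m.cross x a = (m.iso a).symm (W.transport x (m.perm a)) := rfl

theorem cross_cross (x : ∀ a, W.fiber a) : m.cross (m.cross x) = x :=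
  m.involutive x (m.cross x) _ (fun a => by rw [cross_apply, LinearEquiv.apply_symm_apply])
    fun a => by rw [cross_apply, LinearEquiv.apply_symm_apply]

/-- The circles formed by the fibers along the cycles of `perm`. -/
def circles : FlatGraph R where
  Arc := W.Arc
  Vert := W.Arc
  finite_arc := inferInstance
  finite_vert := inferInstance
  src := m.perm
  tgt := id
  fiber := W.fiber
  transport := m.total.symm
  transport_local x y b h := by
    rw [total_symm_apply, total_symm_apply, h _ rfl]

/-- The seam ending at a vertex. -/
def seam (v : W.Vert) : {v : W.Vert // m.pos v = true} :=
  if h : m.pos v = true then ⟨v, h⟩ else ⟨m.partner v, by simpa [m.pos_partner] using h⟩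

theorem seam_of_pos {v : W.Vert} (h : m.pos v = true) : (m.seam v : W.Vert) = v := by
  rw [seam, dif_pos h]

theorem seam_of_neg {v : W.Vert} (h : m.pos v = false) : (m.seam v : W.Vert) = m.partner v := by
  rw [seam, dif_neg (by simp [h])]

theorem seam_partner (v : W.Vert) : m.seam (m.partner v) = m.seam v := by
  apply Subtype.ext
  rcases h : m.pos v with _ | _
  · rw [m.seam_of_neg h, m.seam_of_pos (by rw [m.pos_partner, h]; rfl)]
  · rw [m.seam_of_pos h, m.seam_of_neg (by rw [m.pos_partner, h]; rfl), m.partner_partner]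

theorem seam_eq_and_pos_iff (u : {v : W.Vert // m.pos v = true}) (v : W.Vert) :
    (m.seam v = u ∧ m.pos v = true) ↔ v = u := by
  constructor
  · rintro ⟨rfl, h⟩
    exact (m.seam_of_pos h).symm
  · rintro rfl
    exact ⟨Subtype.ext (m.seam_of_pos u.2), u.2⟩

theorem seam_eq_and_neg_iff (u : {v : W.Vert // m.pos v = true}) (v : W.Vert) :
    (m.seam v = u ∧ m.pos v = false) ↔ v = m.partner u := by
  constructor
  · rintro ⟨rfl, h⟩
    rw [m.seam_of_neg h, m.partner_partner]
  · rintro rfl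
    refine ⟨?_, by rw [m.pos_partner, u.2]; rfl⟩
    rw [seam_partner]
    exact Subtype.ext (m.seam_of_pos u.2)

theorem _root_.RFoam.card_sigma_fin_three {A : Type} [Finite A] (p : (Σ _ : A, Fin 3) → Prop) :
    Nat.card {s // p s} =
      Nat.card {a // p ⟨a, 0⟩} + Nat.card {a // p ⟨a, 1⟩} + Nat.card {a // p ⟨a, 2⟩} := by
  rw [← Nat.card_sum, ← Nat.card_sum]
  exact Nat.card_congr
    { toFun := fun s => match s with
        | ⟨⟨a, 0⟩, h⟩ => Sum.inl (Sum.inl ⟨a, h⟩)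
        | ⟨⟨a, 1⟩, h⟩ => Sum.inl (Sum.inr ⟨a, h⟩)
        | ⟨⟨a, 2⟩, h⟩ => Sum.inr ⟨a, h⟩
      invFun := fun s => match s with
        | Sum.inl (Sum.inl a) => ⟨⟨a.1, 0⟩, a.2⟩
        | Sum.inl (Sum.inr a) => ⟨⟨a.1, 1⟩, a.2⟩
        | Sum.inr a => ⟨⟨a.1, 2⟩, a.2⟩
      left_inv := by
        rintro ⟨⟨a, i⟩, h⟩
        fin_cases i <;> rfl
      right_inv := by rintro ((a | a) | a) <;> rfl }

theorem card_tgt_partner (v : W.Vert) :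
    Nat.card {a // W.tgt a = m.partner v} = W.outDeg v :=
  Nat.card_congr (m.perm.subtypeEquiv fun a => by
    rw [m.src_perm]
    constructor
    · intro h
      rw [h, m.partner_partner]
    · intro h
      rw [← h, m.partner_partner])

/-- The foam whose seams join matched vertices. Each facet is a disk, bounded by arcs and seams; it
is cut by rays from its center to its boundary arcs. -/
def foam : PolygonComplex R where
  Poly := W.Arc
  Edge := {v : W.Vert // m.pos v = true} ⊕ W.Arc
  finite_poly := inferInstance
  finite_edge := inferInstance
  n _ := 2
  fiber := W.fiber
  -- Triangle `a` lies between the midpoints of the boundary arcs `a` and `perm a`. Its sides are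
  -- the seam joining the head of `a` to the tail of `perm a`, the ray at `perm a` and the ray at
  -- `a`; rays point outwards.
  edge s := ![Sum.inl (m.seam (W.tgt s.1)), Sum.inr (m.perm s.1), Sum.inr s.1] s.2
  sgn s := ![m.pos (W.tgt s.1), false, true] s.2
  valence := by
    rintro (v | c)
    · have h1 : Nat.card {a : W.Arc // (Sum.inl (m.seam (W.tgt a)) :
          {v : W.Vert // m.pos v = true} ⊕ W.Arc) = Sum.inl v ∧ m.pos (W.tgt a) = true} =
          W.inDeg v := by
        simp only [Sum.inl.injEq, seam_eq_and_pos_iff]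
        rfl
      -- The negative sides of the seam at `v` are the arcs ending at the partner, which `perm`
      -- carries to the arcs leaving `v`. So the valence of the seam is that of `v`; at a base point
      -- it is an ordinary edge inside a facet.
      have h2 : Nat.card {a : W.Arc // (Sum.inl (m.seam (W.tgt a)) :
          {v : W.Vert // m.pos v = true} ⊕ W.Arc) = Sum.inl v ∧ m.pos (W.tgt a) = false} =
          W.outDeg v := by
        simp only [Sum.inl.injEq, seam_eq_and_neg_iff]
        exact m.card_tgt_partner v
      rw [card_sigma_fin_three, card_sigma_fin_three]
      simp only [Matrix.cons_val_zero, Matrix.cons_val_one, Matrix.cons_val, h1, h2, reduceCtorEq,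
        false_and, Nat.card_of_isEmpty, add_zero]
      rcases W.valence v with ⟨h, h'⟩ | ⟨h, h'⟩ | ⟨h, h', _⟩ <;> simp [h, h']
    · rw [card_sigma_fin_three, card_sigma_fin_three]
      have h1 : Nat.card {a // m.perm a = c} = 1 := by
        rw [Nat.card_eq_one_iff_unique]
        exact ⟨⟨fun a b => Subtype.ext (m.perm.injective (a.2.trans b.2.symm))⟩,
          ⟨m.perm.symm c, m.perm.apply_symm_apply c⟩⟩
      have h2 : Nat.card {a // a = c} = 1 := by simp
      simp [h1]
  glue :=
    { toFun := fun x s => ![m.cross (fun a => x ⟨a, 0⟩) s.1, m.total.symm (fun a => x ⟨a, 2⟩) s.1,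
        m.total (fun a => x ⟨a, 1⟩) s.1] s.2
      invFun := fun x s => ![m.cross (fun a => x ⟨a, 0⟩) s.1, m.total.symm (fun a => x ⟨a, 2⟩) s.1,
        m.total (fun a => x ⟨a, 1⟩) s.1] s.2
      map_add' := fun x y => by
        funext ⟨a, i⟩
        fin_cases i
        · exact congrFun (m.cross.map_add (fun a => x ⟨a, 0⟩) fun a => y ⟨a, 0⟩) a
        · exact congrFun (m.total.symm.map_add (fun a => x ⟨a, 2⟩) fun a => y ⟨a, 2⟩) a
        · exact congrFun (m.total.map_add (fun a => x ⟨a, 1⟩) fun a => y ⟨a, 1⟩) a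
      map_smul' := fun c x => by
        funext ⟨a, i⟩
        fin_cases i
        · exact congrFun (m.cross.map_smul c fun a => x ⟨a, 0⟩) a
        · exact congrFun (m.total.symm.map_smul c fun a => x ⟨a, 2⟩) a
        · exact congrFun (m.total.map_smul c fun a => x ⟨a, 1⟩) a
      left_inv := fun x => by
        funext ⟨a, i⟩
        fin_cases i
        · exact congrFun (m.cross_cross fun a => x ⟨a, 0⟩) a
        · exact congrFun (m.total.symm_apply_apply fun a => x ⟨a, 1⟩) a
        · exact congrFun (m.total.apply_symm_apply fun a => x ⟨a, 2⟩) a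
      right_inv := fun x => by
        funext ⟨a, i⟩
        fin_cases i
        · exact congrFun (m.cross_cross fun a => x ⟨a, 0⟩) a
        · exact congrFun (m.total.symm_apply_apply fun a => x ⟨a, 1⟩) a
        · exact congrFun (m.total.apply_symm_apply fun a => x ⟨a, 2⟩) a }
  glue_glue x := by
    funext ⟨a, i⟩
    fin_cases i
    · exact congrFun (m.cross_cross fun a => x ⟨a, 0⟩) a
    · exact congrFun (m.total.symm_apply_apply fun a => x ⟨a, 1⟩) a
    · exact congrFun (m.total.apply_symm_apply fun a => x ⟨a, 2⟩) a
  glue_local := by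
    rintro x y ⟨a, i⟩ h
    fin_cases i
    · refine congrArg (m.iso a).symm (W.transport_local _ _ _ fun b hb => h ⟨b, 0⟩ ?_ ?_)
      all_goals replace hb : W.tgt b = W.src (m.perm a) := hb
      · change (Sum.inl (m.seam (W.tgt b)) : _ ⊕ W.Arc) = Sum.inl (m.seam (W.tgt a))
        rw [hb, m.src_perm, m.seam_partner]
      · change m.pos (W.tgt b) ≠ m.pos (W.tgt a)
        rw [hb, m.src_perm, m.pos_partner]
        cases m.pos (W.tgt a) <;> simp
    · exact congrArg (m.iso a).symm (h ⟨m.perm a, 2⟩ rfl Bool.false_ne_true.symm)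
    · obtain ⟨b, rfl⟩ := m.perm.surjective a
      change m.total (fun a => x ⟨a, 1⟩) (m.perm b) = m.total (fun a => y ⟨a, 1⟩) (m.perm b)
      rw [total_apply, total_apply]
      exact congrArg (m.iso b) (h ⟨b, 1⟩ rfl Bool.false_ne_true)

/-- The vertex at one end of a seam. -/
def seamEnd (v : {v : W.Vert // m.pos v = true}) (b : Bool) : W.Vert :=
  if b = true then m.partner v else v

theorem seamEnd_seam (v : W.Vert) : m.seamEnd (m.seam v) (m.pos v) = m.partner v := by
  rcases h : m.pos v with _ | _
  · exact m.seam_of_neg h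
  · exact congrArg m.partner (m.seam_of_pos h)

theorem seamEnd_seam_not (v : W.Vert) : m.seamEnd (m.seam v) (!m.pos v) = v := by
  rcases h : m.pos v with _ | _
  · exact (congrArg m.partner (m.seam_of_neg h)).trans (m.partner_partner v)
  · exact m.seam_of_pos h

/-- Ends of seams are the vertices of `W`. The outer end of a ray is the midpoint of an arc, and the
inner end a vertex on the circle around a center. -/
def linkFoamVert : ({v : W.Vert // m.pos v = true} ⊕ W.Arc) × Bool ≃
    (W.Vert ⊕ (Σ _ : W.Arc, Fin 1)) ⊕ W.Arc where
  toFun k := match k with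
    | (Sum.inl v, b) => Sum.inl (Sum.inl (m.seamEnd v b))
    | (Sum.inr a, true) => Sum.inl (Sum.inr ⟨a, 0⟩)
    | (Sum.inr a, false) => Sum.inr a
  invFun k := match k with
    | Sum.inl (Sum.inl v) => (Sum.inl (m.seam v), !m.pos v)
    | Sum.inl (Sum.inr a) => (Sum.inr a.1, true)
    | Sum.inr a => (Sum.inr a, false)
  left_inv := by
    rintro ⟨v | a, b⟩
    · refine Prod.ext (congrArg Sum.inl ?_) ?_
      · cases b
        · exact Subtype.ext (m.seam_of_pos v.2)
        · exact (m.seam_partner v).trans (Subtype.ext (m.seam_of_pos v.2))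
      · cases b
        · exact congrArg not v.2
        · exact congrArg not ((m.pos_partner v).trans (congrArg not v.2))
    · cases b <;> rfl
  right_inv := by
    rintro ((v | ⟨a, i⟩) | a)
    · exact congrArg (fun z => Sum.inl (Sum.inl z)) (m.seamEnd_seam_not v)
    · obtain rfl : i = 0 := Subsingleton.elim _ _
      rfl
    · rfl

/-- Corner `0` of triangle `a` cuts out the first half of `perm a`, corner `2` the second half of
`a`; the corners `1` surround the centers of the facets. -/
def linkFoam : FlatGraph.Iso m.foam.link ((W.subdivide fun _ => 1).sum m.circles) where
  arc :=
    { toFun := fun s => (![Sum.inl ⟨m.perm s.1, (0 : Fin 2)⟩, Sum.inr s.1,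
        Sum.inl ⟨s.1, (1 : Fin 2)⟩] : Fin 3 → (Σ _ : W.Arc, Fin 2) ⊕ W.Arc) s.2
      invFun := fun s => match s with
        | Sum.inl ⟨a, i⟩ =>
          (![⟨m.perm.symm a, (0 : Fin 3)⟩, ⟨a, (2 : Fin 3)⟩] : Fin 2 → Σ _ : W.Arc, Fin 3) i
        | Sum.inr a => ⟨a, (1 : Fin 3)⟩
      left_inv := by
        rintro ⟨a, i⟩
        fin_cases i
        · exact congrArg (fun b => (⟨b, 0⟩ : Σ _ : W.Arc, Fin 3)) (m.perm.symm_apply_apply a)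
        · rfl
        · rfl
      right_inv := by
        rintro (⟨a, i⟩ | a)
        · fin_cases i
          · exact congrArg (fun b => Sum.inl (⟨b, 0⟩ : Σ _ : W.Arc, Fin 2))
              (m.perm.apply_symm_apply a)
          · rfl
        · rfl }
  vert := m.linkFoamVert
  src_arc := by
    rintro ⟨a, (i : Fin 3)⟩
    fin_cases i
    · refine congrArg (fun z => Sum.inl (Sum.inl z)) ?_
      exact (m.src_perm a).trans (m.seamEnd_seam _).symm
    · rfl
    · rfl
  tgt_arc := by
    rintro ⟨a, (i : Fin 3)⟩
    fin_cases i
    · rfl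
    · rfl
    · refine (congrArg Sum.inl (FlatGraph.subdivide_tgt_last _ _ a)).trans ?_
      have hn : m.foam.next ⟨a, (2 : Fin 3)⟩ = ⟨a, (0 : Fin 3)⟩ :=
        congrArg (Sigma.mk (β := fun _ : W.Arc => Fin 3) a) (by decide : (2 : Fin 3) + 1 = 0)
      have ht : m.foam.link.tgt ⟨a, (2 : Fin 3)⟩ =
          (Sum.inl (m.seam (W.tgt a)), !m.pos (W.tgt a)) :=
        congrArg (fun t => (m.foam.edge t, !m.foam.sgn t)) hn
      exact (congrArg (fun z => Sum.inl (Sum.inl z)) (m.seamEnd_seam_not _).symm).trans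
        (congrArg m.linkFoamVert ht).symm
  fiber s := match s with
    | ⟨a, ⟨0, _⟩⟩ => m.iso a
    | ⟨a, ⟨1, _⟩⟩ => LinearEquiv.refl R (W.fiber a)
    | ⟨a, ⟨2, _⟩⟩ => LinearEquiv.refl R (W.fiber a)
  transport := by
    rintro x y h ⟨a, (i : Fin 3)⟩
    have h0 : ∀ a, y (Sum.inl ⟨m.perm a, (0 : Fin 2)⟩) = m.iso a (x ⟨a, (0 : Fin 3)⟩) :=
      fun a => h ⟨a, (0 : Fin 3)⟩
    have h1 : ∀ a, y (Sum.inr a) = x ⟨a, (1 : Fin 3)⟩ := fun a => h ⟨a, (1 : Fin 3)⟩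
    have h2 : ∀ a, y (Sum.inl ⟨a, (1 : Fin 2)⟩) = x ⟨a, (2 : Fin 3)⟩ := fun a => h ⟨a, (2 : Fin 3)⟩
    fin_cases i
    · refine Eq.symm (((m.iso a).apply_symm_apply _).trans ?_)
      exact congrArg (fun z => W.transport z (m.perm a)) (funext fun b => (h2 b).symm)
    · let z : Fin 3 → W.fiber (m.perm a) := fun j => x ⟨m.perm a, j⟩
      exact congrArg (m.iso a).symm ((h1 (m.perm a)).trans
        (congrArg z (by decide : (1 : Fin 3) = 2 - 1)))
    · obtain ⟨b, rfl⟩ := m.perm.surjective a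
      let z : Fin 3 → W.fiber b := fun j => x ⟨b, j⟩
      exact ((h0 b).trans (congrArg (fun j => m.iso b (z j)) (by decide : (0 : Fin 3) = 1 - 1))).trans
        (m.total_apply (fun b => x ⟨b, ((1 - 1 : Fin 3) : Fin 3)⟩) b).symm

/-- Removing the centers of the facets leaves a foam without vertices whose boundary is `W ⊔ X`. -/
theorem mk_add_mk_eq_zero {X : OneFoam R} (r : X.Arc → ℕ)
    (e : FlatGraph.Iso m.circles (X.subdivide r)) : Cob1.mk W + Cob1.mk X = 0 := by
  have h : Cobordant W.reverse X := by
    refine ⟨m.foam, Empty, inferInstance, fun i => i.elim, fun i => i.elim, _, ⟨m.linkFoam.trans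
      ((FlatGraph.Iso.sumCongr (FlatGraph.Iso.refl _) e).trans
        ((FlatGraph.Iso.subdivideSum _ _ _ r).trans
          (FlatGraph.Iso.subdivideCongr (FlatGraph.Iso.sumSigmaEmpty _ _) _).symm))⟩⟩
  rw [← Cob1.sound h, Cob1.mk_reverse, add_neg_cancel]

end Matching

/-! ### Circles and theta graphs -/

namespace OneFoam

variable {R : Type u} [Ring R]

/-- Circles without vertices, with given monodromies. -/
def circles {ι : Type} [Finite ι] (P : ι → FGProj R) (α : ∀ i, P i ≃ₗ[R] P i) : OneFoam R where
  Arc := ι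
  Vert := ι
  finite_arc := inferInstance
  finite_vert := inferInstance
  src := id
  tgt := id
  fiber := P
  transport := LinearEquiv.piCongrRight α
  transport_local _ _ b h := congrArg (α b) (h b rfl)
  valence v := Or.inr (Or.inr ⟨by simp [FlatGraph.inDeg], by simp [FlatGraph.outDeg], v, rfl, rfl⟩)

/-- The theta graph with thin fibers `P` and `Q` and thick fiber `P ⊕ Q`. -/
def theta (P Q : FGProj R) : OneFoam R where
  Arc := Option Bool
  Vert := Bool
  finite_arc := inferInstance
  finite_vert := inferInstance
  -- The thick arc is `none`; it splits at the vertex `true`, and the thin arcs merge at `false`.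
  src a := a.isSome
  tgt a := !a.isSome
  fiber a := match a with
    | none => P.prod Q
    | some false => P
    | some true => Q
  transport :=
    { toFun := fun x a => match a with
        | none => (x (some false), x (some true))
        | some false => (x none).1
        | some true => (x none).2
      invFun := fun x a => match a with
        | none => (x (some false), x (some true))
        | some false => (x none).1
        | some true => (x none).2
      map_add' := fun x y => by
        funext a
        rcases a with _ | _ | _ <;> rfl
      map_smul' := fun c x => by
        funext a
        rcases a with _ | _ | _ <;> rfl
      left_inv := fun x => by
        funext a
        rcases a with _ | _ | _ <;> rfl
      right_inv := fun x => by
        funext a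
        rcases a with _ | _ | _ <;> rfl }
  transport_local _ _ b h := by
    rcases b with _ | _ | _
    · exact Prod.ext (h (some false) rfl) (h (some true) rfl)
    · exact congrArg Prod.fst (h none rfl)
    · exact congrArg Prod.snd (h none rfl)
  valence v := by
    have h1 : Nat.card {a : Option Bool // (!a.isSome) = false} = 2 := by
      rw [Nat.card_eq_fintype_card]; rfl
    have h2 : Nat.card {a : Option Bool // (!a.isSome) = true} = 1 := by
      rw [Nat.card_eq_fintype_card]; rfl
    have h3 : Nat.card {a : Option Bool // a.isSome = false} = 1 := by
      rw [Nat.card_eq_fintype_card]; rfl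
    have h4 : Nat.card {a : Option Bool // a.isSome = true} = 2 := by
      rw [Nat.card_eq_fintype_card]; rfl
    cases v
    · exact Or.inl ⟨h1, h3⟩
    · exact Or.inr (Or.inl ⟨h2, h4⟩)

end OneFoam

/-! ### Circles satisfy the relations of `K₁(R) / τ(K₀(R))` -/

section Circle

variable {R : Type u} [Ring R]

/-- The circle with monodromy `α`. -/
def circleFoam {M : Type u} [AddCommGroup M] [Module R M] [Module.Finite R M]
    [Module.Projective R M] (α : M ≃ₗ[R] M) : OneFoam R :=
  OneFoam.circles (fun _ : Unit => (⟨M⟩ : FGProj R)) fun _ => α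

/-- The cobordism class of the circle with monodromy `α`. -/
def circ {M : Type u} [AddCommGroup M] [Module R M] [Module.Finite R M]
    [Module.Projective R M] (α : M ≃ₗ[R] M) : Cob1 R := Cob1.mk (circleFoam α)

variable {M N : Type u} [AddCommGroup M] [Module R M] [Module.Finite R M] [Module.Projective R M]
  [AddCommGroup N] [Module R N] [Module.Finite R N] [Module.Projective R N]

theorem gamma_circ (α : M ≃ₗ[R] M) : gamma R (circ α) = kap α :=
  kap_conj (LinearEquiv.funUnique Unit R M) fun _ => rfl

theorem circ_conj {α : M ≃ₗ[R] M} {β : N ≃ₗ[R] N} (e : M ≃ₗ[R] N)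
    (h : ∀ x, e (α x) = β (e x)) : circ α = circ β :=
  Cob1.sound (Cobordant.of_iso
    { arc := Equiv.refl Unit
      vert := Equiv.refl Unit
      src_arc := fun _ => rfl
      tgt_arc := fun _ => rfl
      fiber := fun _ => e
      transport := fun x _ hx a => (congrArg β (hx a)).trans (h (x a)).symm })

theorem circ_symm (α : M ≃ₗ[R] M) : circ α.symm = - circ α := by
  rw [circ, circ, ← Cob1.mk_reverse]
  exact Cob1.sound (Cobordant.of_iso (FlatGraph.Iso.refl (circleFoam α).reverse.toFlatGraph))

/-- Two circles with the same fiber, joined along a seamless annulus. -/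
def matchingCircles (α β : M ≃ₗ[R] M) : Matching ((circleFoam α).sum (circleFoam β)) where
  partner := Sum.swap
  pos := Sum.isLeft
  partner_partner := Sum.swap_swap
  pos_partner := by rintro (_ | _) <;> rfl
  perm := Equiv.sumComm Unit Unit
  iso a := match a with
    | Sum.inl _ => LinearEquiv.refl R M
    -- With the identity on the first arc, involutivity forces `α * β` on the second.
    | Sum.inr _ => α * β
  src_perm := by rintro (_ | _) <;> rfl
  involutive x y z hy hz := by
    have hyl : y (Sum.inl ()) = β (x (Sum.inr ())) := hy (Sum.inl ())
    have hyr : α (β (y (Sum.inr ()))) = α (x (Sum.inl ())) := hy (Sum.inr ())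
    have hzl : z (Sum.inl ()) = β (y (Sum.inr ())) := hz (Sum.inl ())
    have hzr : α (β (z (Sum.inr ()))) = α (y (Sum.inl ())) := hz (Sum.inr ())
    funext a
    rcases a with ⟨⟩ | ⟨⟩
    · exact hzl.trans (α.injective hyr)
    · rw [hyl] at hzr
      exact β.injective (α.injective hzr)

def matchingCirclesIso (α β : M ≃ₗ[R] M) : FlatGraph.Iso (matchingCircles α β).circles
    ((circleFoam (α * β).symm).subdivide fun _ => 1) where
  arc :=
    { toFun := fun s => match s with
        | Sum.inl _ => ⟨(), (1 : Fin 2)⟩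
        | Sum.inr _ => ⟨(), (0 : Fin 2)⟩
      invFun := fun s => (![Sum.inr (), Sum.inl ()] : Fin 2 → Unit ⊕ Unit) s.2
      left_inv := by rintro (_ | _) <;> rfl
      right_inv := by
        rintro ⟨_, (i : Fin 2)⟩
        fin_cases i <;> rfl }
  vert :=
    { toFun := fun s => match s with
        | Sum.inl _ => Sum.inl ()
        | Sum.inr _ => Sum.inr ⟨(), (0 : Fin 1)⟩
      invFun := fun s => match s with
        | Sum.inl _ => Sum.inl ()
        | Sum.inr _ => Sum.inr ()
      left_inv := by rintro (_ | _) <;> rfl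
      right_inv := by
        rintro (_ | ⟨_, (i : Fin 1)⟩)
        · rfl
        · obtain rfl : i = 0 := Subsingleton.elim _ _
          rfl }
  src_arc := by rintro (_ | _) <;> rfl
  tgt_arc := by
    rintro (_ | _)
    · exact FlatGraph.subdivide_tgt_last (circleFoam (α * β).symm).toFlatGraph (fun _ => 1) ()
    · exact FlatGraph.subdivide_tgt_castSucc (circleFoam (α * β).symm).toFlatGraph (fun _ => 1) () 0
  fiber s := match s with
    | Sum.inl _ => LinearEquiv.refl R M
    | Sum.inr _ => LinearEquiv.refl R M
  transport x y h a := by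
    rcases a with ⟨⟩ | ⟨⟩
    · exact h (Sum.inr ())
    · exact congrArg (α * β).symm (h (Sum.inl ()))

/-- The punctured annulus is a pair of pants with these three boundary circles. -/
theorem circ_add_add_symm (α β : M ≃ₗ[R] M) : circ α + circ β + circ (α * β).symm = 0 :=
  (matchingCircles α β).mk_add_mk_eq_zero _ (matchingCirclesIso α β)

theorem circ_mul (α β : M ≃ₗ[R] M) : circ (α * β) = circ α + circ β := by
  have h := circ_add_add_symm α β
  rw [circ_symm, ← sub_eq_add_neg, sub_eq_zero] at h
  exact h.symm

theorem circ_one : circ (1 : M ≃ₗ[R] M) = 0 := by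
  have h := circ_mul (R := R) (M := M) 1 1
  rwa [mul_one, left_eq_add] at h

theorem circ_eq_zero_of_forall {α : M ≃ₗ[R] M} (h : ∀ x, α x = x) : circ α = 0 := by
  obtain rfl : α = 1 := LinearEquiv.ext h
  exact circ_one

/-- The theta graph bounds a foam with one seam. -/
def matchingTheta (P Q : FGProj R) (α : P ≃ₗ[R] P) (β : Q ≃ₗ[R] Q) :
    Matching (OneFoam.theta P Q) where
  partner := not
  pos := not
  partner_partner := Bool.not_not
  pos_partner _ := rfl
  -- Each facet meets the boundary in a single arc, so there are three disks; puncturing them leaves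
  -- circles whose monodromies are compatible at the seam.
  perm := 1
  iso a := match a with
    | none => α.symm.prodCongr β.symm
    | some false => α
    | some true => β
  src_perm := by rintro (_ | _ | _) <;> rfl
  involutive x y z hy hz := by
    have hy0 := hy none
    have hy1 : α (y (some false)) = (x none).1 := hy (some false)
    have hy2 : β (y (some true)) = (x none).2 := hy (some true)
    have hz0 := hz none
    have hz1 : α (z (some false)) = (y none).1 := hz (some false)
    have hz2 : β (z (some true)) = (y none).2 := hz (some true)
    have hy3 : (y none).1 = α (x (some false)) := α.symm_apply_eq.1 (congrArg Prod.fst hy0)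
    have hy4 : (y none).2 = β (x (some true)) := β.symm_apply_eq.1 (congrArg Prod.snd hy0)
    have hz3 : (z none).1 = α (y (some false)) := α.symm_apply_eq.1 (congrArg Prod.fst hz0)
    have hz4 : (z none).2 = β (y (some true)) := β.symm_apply_eq.1 (congrArg Prod.snd hz0)
    funext a
    rcases a with _ | _ | _
    · exact Prod.ext (hz3.trans hy1) (hz4.trans hy2)
    · exact α.injective (hz1.trans hy3)
    · exact β.injective (hz2.trans hy4)

def matchingThetaIso (P Q : FGProj R) (α : P ≃ₗ[R] P) (β : Q ≃ₗ[R] Q) :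
    FlatGraph.Iso (matchingTheta P Q α β).circles
      (((circleFoam α.symm).sum (circleFoam β.symm)).sum
        (circleFoam (α.prodCongr β))).toFlatGraph where
  arc := (Equiv.optionEquivSumPUnit Bool).trans
    (Equiv.sumCongr Equiv.boolEquivPUnitSumPUnit (Equiv.refl Unit))
  vert := (Equiv.optionEquivSumPUnit Bool).trans
    (Equiv.sumCongr Equiv.boolEquivPUnitSumPUnit (Equiv.refl Unit))
  src_arc := by rintro (_ | _ | _) <;> rfl
  tgt_arc := by rintro (_ | _ | _) <;> rfl
  fiber s := match s with
    | none => LinearEquiv.refl R (P × Q)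
    | some false => LinearEquiv.refl R P
    | some true => LinearEquiv.refl R Q
  transport x y h a := by
    rcases a with _ | _ | _
    · exact congrArg (α.prodCongr β) (h none)
    · exact congrArg α.symm (h (some false))
    · exact congrArg β.symm (h (some true))

theorem mk_theta_add (P Q : FGProj R) (α : P ≃ₗ[R] P) (β : Q ≃ₗ[R] Q) :
    Cob1.mk (OneFoam.theta P Q) + (circ α.symm + circ β.symm + circ (α.prodCongr β)) = 0 :=
  (matchingTheta P Q α β).mk_add_mk_eq_zero _
    ((matchingThetaIso P Q α β).trans (FlatGraph.Iso.subdivideZero _))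

/-- With trivial monodromies all three inner circles bound. -/
theorem mk_theta (P Q : FGProj R) : Cob1.mk (OneFoam.theta P Q) = 0 := by
  have h := mk_theta_add P Q 1 1
  rw [circ_symm, circ_symm, circ_one, circ_one, neg_zero, add_zero, zero_add,
    circ_eq_zero_of_forall (fun _ => rfl), add_zero] at h
  exact h

theorem circ_prodCongr (α : M ≃ₗ[R] M) (β : N ≃ₗ[R] N) :
    circ (α.prodCongr β) = circ α + circ β := by
  have h := mk_theta_add ⟨M⟩ ⟨N⟩ α β
  rw [mk_theta, zero_add, circ_symm, circ_symm, ← neg_add, neg_add_eq_zero] at h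
  exact h.symm

/-- The theta graph with equal thin fibers bounds a foam whose thin facet is a Möbius-type double
cover of the thick one. -/
def matchingThetaSwap (P : FGProj R) : Matching (OneFoam.theta P P) where
  partner := not
  pos := not
  partner_partner := Bool.not_not
  pos_partner _ := rfl
  -- Exchanging the thin arcs joins both thin sides of the seam into one facet; the thick facet then
  -- has the transposition as monodromy.
  perm := Equiv.optionCongr Equiv.boolNot
  iso a := match a with
    | none => LinearEquiv.prodComm R P P
    | some false => LinearEquiv.refl R P
    | some true => LinearEquiv.refl R P
  src_perm := by rintro (_ | _ | _) <;> rfl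
  involutive x y z hy hz := by
    have hy0 : (y none).2 = x (some false) := congrArg Prod.fst (hy none)
    have hy3 : (y none).1 = x (some true) := congrArg Prod.snd (hy none)
    have hy1 : y (some false) = (x none).2 := hy (some false)
    have hy2 : y (some true) = (x none).1 := hy (some true)
    have hz0 : (z none).2 = y (some false) := congrArg Prod.fst (hz none)
    have hz3 : (z none).1 = y (some true) := congrArg Prod.snd (hz none)
    have hz1 : z (some false) = (y none).2 := hz (some false)
    have hz2 : z (some true) = (y none).1 := hz (some true)
    funext a
    rcases a with _ | _ | _
    · exact Prod.ext (hz3.trans hy2) (hz0.trans hy1)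
    · exact hz1.trans hy0
    · exact hz2.trans hy3

def matchingThetaSwapIso (P : FGProj R) :
    FlatGraph.Iso (matchingThetaSwap P).circles
      (((circleFoam (LinearEquiv.prodComm R P P)).sum
        (circleFoam (LinearEquiv.refl R P))).subdivide (Sum.elim (fun _ => 0) fun _ => 1)) where
  arc :=
    { toFun := fun s => match s with
        | none => ⟨Sum.inl (), (0 : Fin 1)⟩
        | some false => ⟨Sum.inr (), (1 : Fin 2)⟩
        | some true => ⟨Sum.inr (), (0 : Fin 2)⟩
      invFun := fun s => match s with
        | ⟨Sum.inl _, _⟩ => none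
        | ⟨Sum.inr _, i⟩ => (![some true, some false] : Fin 2 → Option Bool) i
      left_inv := by rintro (_ | _ | _) <;> rfl
      right_inv := by
        rintro ⟨_ | _, i⟩
        · obtain rfl : i = (0 : Fin 1) := Subsingleton.elim (α := Fin 1) _ _
          rfl
        · revert i
          exact fun (i : Fin 2) => by fin_cases i <;> rfl }
  vert :=
    { toFun := fun s => match s with
        | none => Sum.inl (Sum.inl ())
        | some false => Sum.inl (Sum.inr ())
        | some true => Sum.inr ⟨Sum.inr (), (0 : Fin 1)⟩
      invFun := fun s => match s with
        | Sum.inl (Sum.inl _) => none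
        | Sum.inl (Sum.inr _) => some false
        | Sum.inr _ => some true
      left_inv := by rintro (_ | _ | _) <;> rfl
      right_inv := by
        rintro ((_ | _) | ⟨_ | _, i⟩)
        · rfl
        · rfl
        · exact (i : Fin 0).elim0
        · obtain rfl : i = (0 : Fin 1) := Subsingleton.elim (α := Fin 1) _ _
          rfl }
  src_arc := by rintro (_ | _ | _) <;> rfl
  tgt_arc := by
    rintro (_ | _ | _)
    · exact FlatGraph.subdivide_tgt_last _ _ _
    · exact FlatGraph.subdivide_tgt_last _ _ _
    · exact FlatGraph.subdivide_tgt_castSucc ((circleFoam (LinearEquiv.prodComm R P P)).sum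
        (circleFoam (LinearEquiv.refl R P))).toFlatGraph (Sum.elim (fun _ => 0) fun _ => 1)
        (Sum.inr ()) (0 : Fin 1)
  fiber s := match s with
    | none => LinearEquiv.refl R (P × P)
    | some false => LinearEquiv.refl R P
    | some true => LinearEquiv.refl R P
  transport x y h a := by
    rcases a with _ | _ | _
    · exact congrArg (LinearEquiv.prodComm R P P) (h none)
    · exact h (some true)
    · exact h (some false)

/-- The thick facet contributes the transposition, the single thin facet a circle with trivial
monodromy, and the theta graph itself bounds. This makes `δ` well defined modulo `τ`. -/
theorem circ_prodComm : circ (LinearEquiv.prodComm R M M) = 0 := by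
  have h := (matchingThetaSwap (⟨M⟩ : FGProj R)).mk_add_mk_eq_zero _
    (matchingThetaSwapIso (⟨M⟩ : FGProj R))
  rw [mk_theta, zero_add, Cob1.mk_sum] at h
  have h1 : circ (LinearEquiv.refl R M) = 0 := circ_one
  change circ (LinearEquiv.prodComm R M M) + circ (LinearEquiv.refl R M) = 0 at h
  rwa [h1, add_zero] at h

/-- The elementary automorphism `(x, y) ↦ (x + u y, y)`. -/
def shear (u : N →ₗ[R] M) : (M × N) ≃ₗ[R] (M × N) where
  toFun z := (z.1 + u z.2, z.2)
  invFun z := (z.1 - u z.2, z.2)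
  map_add' z w := by
    refine Prod.ext ?_ rfl
    simp only [Prod.fst_add, Prod.snd_add, map_add]
    abel
  map_smul' c z := by
    refine Prod.ext ?_ rfl
    simp
  left_inv z := by simp
  right_inv z := by simp

/-- After stabilization, an elementary automorphism is a commutator. -/
theorem circ_shear (u : N →ₗ[R] M) : circ (shear u) = 0 := by
  -- `A` adds `u` of the new copy of `N` to `M`, and `B` adds the old copy of `N` to the new one;
  -- their commutator adds `u` of the old copy to `M`.
  let A : ((M × N) × N) ≃ₗ[R] ((M × N) × N) := shear (LinearMap.inl R M N ∘ₗ u)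
  let s := LinearEquiv.prodComm R (M × N) N
  let B : ((M × N) × N) ≃ₗ[R] ((M × N) × N) := (s.trans (shear (LinearMap.snd R M N))).trans s.symm
  have h : A * B * A.symm * B.symm = (shear u).prodCongr (1 : N ≃ₗ[R] N) := by
    refine LinearEquiv.ext ?_
    rintro ⟨⟨x, y⟩, z⟩
    simp only [LinearEquiv.mul_apply]
    simp [A, B, s, shear]
    abel
  have h2 := congrArg circ h
  rw [circ_mul, circ_mul, circ_mul, circ_symm, circ_symm, circ_prodCongr, circ_one, add_zero] at h2
  rw [← h2]
  abel

/-- A splitting of `p` makes `α₂` block triangular with diagonal `α₁, α₃`, that is, the diagonal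
automorphism composed with a shear, and shears bound. -/
theorem circ_exact {L : Type u} [AddCommGroup L] [Module R L] [Module.Finite R L]
    [Module.Projective R L] (i : L →ₗ[R] M) (p : M →ₗ[R] N)
    (α₁ : L ≃ₗ[R] L) (α₂ : M ≃ₗ[R] M) (α₃ : N ≃ₗ[R] N)
    (hi : Function.Injective i) (hip : Function.Exact i p) (hp : Function.Surjective p)
    (h₁ : ∀ x, i (α₁ x) = α₂ (i x)) (h₂ : ∀ x, p (α₂ x) = α₃ (p x)) :
    circ α₂ = circ α₁ + circ α₃ := by
  obtain ⟨s, hs⟩ := Module.projective_lifting_property p LinearMap.id hp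
  have hs' : ∀ z, p (s z) = z := fun z => LinearMap.congr_fun hs z
  have hpi : ∀ x, p (i x) = 0 := fun x => (hip (i x)).2 ⟨x, rfl⟩
  let e₀ : (L × N) →ₗ[R] M := i.coprod s
  have he₀ : Function.Bijective e₀ := by
    constructor
    · refine (injective_iff_map_eq_zero e₀).2 ?_
      rintro ⟨x, z⟩ h
      have h0 : i x + s z = 0 := h
      have hz : z = 0 := by
        have := congrArg p h0
        rwa [map_add, hpi, hs', zero_add, map_zero] at this
      rw [hz, map_zero, add_zero] at h0
      rw [hz, (injective_iff_map_eq_zero i).1 hi x h0]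
      rfl
    · intro y
      obtain ⟨x, hx⟩ := (hip (y - s (p y))).1 (by rw [map_sub, hs', sub_self])
      exact ⟨(x, p y), by simp [e₀, hx]⟩
  let e := LinearEquiv.ofBijective e₀ he₀
  have he : ∀ x z, e (x, z) = i x + s z := fun _ _ => rfl
  have hpe : ∀ y, (e.symm y).2 = p y := fun y => by
    obtain ⟨⟨x, z⟩, rfl⟩ := e.surjective y
    rw [e.symm_apply_apply, he, map_add, hpi, hs', zero_add]
  -- The off-diagonal block of `α₂`; since the shear is applied before the diagonal part, it has to
  -- be `α₁⁻¹ u`.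
  let u : N →ₗ[R] L := LinearMap.fst R L N ∘ₗ e.symm.toLinearMap ∘ₗ α₂.toLinearMap ∘ₗ s
  rw [← circ_prodCongr, ← add_zero (circ (α₁.prodCongr α₃)),
    ← circ_shear (α₁.symm.toLinearMap ∘ₗ u), ← circ_mul]
  refine circ_conj e.symm fun y => ?_
  obtain ⟨⟨x, z⟩, rfl⟩ := e.surjective y
  rw [e.symm_apply_apply, e.symm_apply_eq, he, map_add, ← h₁]
  change _ = e (α₁ (x + α₁.symm (u z)), α₃ z)
  rw [map_add, LinearEquiv.apply_symm_apply, he, map_add, add_assoc]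
  congr 1
  rw [← he, ← e.symm_apply_eq]
  exact Prod.ext rfl ((hpe _).trans ((h₂ _).trans (congrArg α₃ (hs' z))))

end Circle

/-! ### The homomorphism `δ`, a right inverse of `γ` -/

/-- The homomorphism `K₁(R) → Cob₁(R)` sending `[(P, α)]` to the circle with monodromy `α`. -/
def deltaK1 (R : Type u) [Ring R] : K1 R →+ Cob1 R :=
  QuotientAddGroup.lift (AddSubgroup.closure {x | K1.IsRelation R x})
    (FreeAbelianGroup.lift fun g : K1.Gen R => circ g.aut) (by
      rw [AddSubgroup.closure_le]
      intro x hx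
      rcases hx with ⟨P, α, β⟩ | ⟨P₁, P₂, P₃, i, p, α₁, α₂, α₃, hi, hip, hp, h₁, h₂⟩
      · simp [circ_mul α β]
      · simp [circ_exact i p α₁ α₂ α₃ hi hip hp h₁ h₂])

theorem deltaK1_cls {R : Type u} [Ring R] (P : FGProj R) (α : P ≃ₗ[R] P) :
    deltaK1 R (K1.cls P α) = circ α :=
  FreeAbelianGroup.lift_apply_of _ _

/-- The homomorphism `δ`, inverse to `γ`. -/
def delta (R : Type u) [Ring R] : K1 R ⧸ (tau R).range →+ Cob1 R :=
  QuotientAddGroup.lift (tau R).range (deltaK1 R) (by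
    have h : (deltaK1 R).comp (tau R) = 0 := by
      refine QuotientAddGroup.addMonoidHom_ext _ (FreeAbelianGroup.lift_ext _ _ fun P => ?_)
      exact (congrArg (deltaK1 R) (tau_cls R P)).trans ((deltaK1_cls _ _).trans circ_prodComm)
    rintro _ ⟨x, rfl⟩
    exact DFunLike.congr_fun h x)

theorem delta_kap {R : Type u} [Ring R] {M : Type u} [AddCommGroup M] [Module R M]
    [Module.Finite R M] [Module.Projective R M] (α : M ≃ₗ[R] M) : delta R (kap α) = circ α :=
  deltaK1_cls ⟨M⟩ α

theorem gamma_delta {R : Type u} [Ring R] (x : K1 R ⧸ (tau R).range) :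
    gamma R (delta R x) = x := by
  have h : (gamma R).comp (delta R) = AddMonoidHom.id _ := by
    refine QuotientAddGroup.addMonoidHom_ext _ (QuotientAddGroup.addMonoidHom_ext _
      (FreeAbelianGroup.lift_ext _ _ fun g => ?_))
    exact (congrArg (gamma R) (delta_kap g.aut)).trans (gamma_circ _)
  exact DFunLike.congr_fun h x

/-! ### Cycle decomposition of a permutation -/

section Cycles

variable {A : Type}

/-- The sequence `x, π x, π (π x), …`. -/
def chain (π : A → A) (x : A) : ℕ → A
  | 0 => x
  | k + 1 => π (chain π x k)

/-- Unlike iteration, `chain` unfolds by definition with the last step outermost, as the dependent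
type of `walk` requires. -/
theorem chain_eq_iterate (π : A → A) (x : A) (k : ℕ) : chain π x k = π^[k] x := by
  induction k with
  | zero => rfl
  | succ k ih => rw [Function.iterate_succ_apply', ← ih, chain]

theorem exists_cycles [Finite A] (π : Equiv.Perm A) :
    ∃ (ι : Type) (_ : Finite ι) (n : ι → ℕ) (x : ι → A),
      Function.Bijective (fun s : Σ o, Fin (n o + 1) => chain π (x s.1) s.2) ∧
      ∀ o, chain π (x o) (n o + 1) = x o := by
  let S := Equiv.Perm.SameCycle.setoid π
  have hper : ∀ x, 0 < Function.minimalPeriod π x := fun x =>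
    Function.minimalPeriod_pos_of_mem_periodicPts
      (Function.mk_mem_periodicPts (orderOf_pos π) (by
        change π^[orderOf π] x = x
        rw [← Equiv.Perm.coe_pow, pow_orderOf_eq_one, Equiv.Perm.one_apply]))
  have hsub : ∀ x, Function.minimalPeriod π x - 1 + 1 = Function.minimalPeriod π x := fun x =>
    Nat.sub_add_cancel (hper x)
  have hsame : ∀ x k, S.r (chain π x k) x := fun x k => by
    rw [chain_eq_iterate, ← Equiv.Perm.coe_pow]
    exact Equiv.Perm.SameCycle.symm ⟨k, by rw [zpow_natCast]⟩
  -- One index per cycle, with a chosen base point; `n` is the length of the cycle minus one, the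
  -- number of points subdividing a circle into that many arcs.
  refine ⟨Quotient S, inferInstance, fun o => Function.minimalPeriod π o.out - 1, Quotient.out,
    ⟨?_, ?_⟩, fun o => ?_⟩
  · rintro ⟨o, i⟩ ⟨o', j⟩ h
    have ho : o = o' := by
      rw [← Quotient.out_eq o, ← Quotient.out_eq o']
      refine Quotient.sound (S.trans (S.symm (hsame o.out i)) ?_)
      have h' : chain π o.out i = chain π o'.out j := h
      rw [h']
      exact hsame o'.out j
    subst ho
    congr 1
    have h' : chain π o.out i = chain π o.out j := h
    rw [chain_eq_iterate, chain_eq_iterate] at h'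
    refine Fin.ext (Function.iterate_injOn_Iio_minimalPeriod (f := π) (x := o.out) ?_ ?_ h')
    · exact i.2.trans_eq (hsub _)
    · exact j.2.trans_eq (hsub _)
  · intro a
    have h : S.r (Quotient.mk S a).out a := Quotient.exact (Quotient.out_eq _)
    obtain ⟨k, hk⟩ := Equiv.Perm.SameCycle.exists_nat_pow_eq h
    refine ⟨⟨Quotient.mk S a, ⟨k % Function.minimalPeriod π (Quotient.mk S a).out,
      (Nat.mod_lt _ (hper _)).trans_eq (hsub _).symm⟩⟩, ?_⟩
    change chain π _ (k % _) = a
    rw [chain_eq_iterate, Function.iterate_mod_minimalPeriod_eq, ← Equiv.Perm.coe_pow, hk]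
  · rw [hsub, chain_eq_iterate, Function.iterate_minimalPeriod]

end Cycles

/-! ### Circles and matched foams lie in the image of `δ` -/

namespace OneFoam

variable {R : Type u} [Ring R]

theorem mk_circles_mem {ι : Type} [Finite ι] (P : ι → FGProj R) (α : ∀ i, P i ≃ₗ[R] P i) :
    Cob1.mk (circles P α) ∈ (delta R).range := by
  suffices H : ∀ (ι : Type) (_ : Finite ι) (P : ι → FGProj R) (α : ∀ i, P i ≃ₗ[R] P i),
      Cob1.mk (circles P α) ∈ (delta R).range from H ι inferInstance P α
  intro ι hι
  refine Finite.induction_empty_option (P := fun ι => ∀ (_ : Finite ι) (P : ι → FGProj R)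
    (α : ∀ i, P i ≃ₗ[R] P i), Cob1.mk (circles P α) ∈ (delta R).range) ?_ ?_ ?_ ι hι
  · intro ι κ e ih _ P α
    have := Finite.of_equiv _ e.symm
    have h : Cob1.mk (circles (fun i => P (e i)) fun i => α (e i)) = Cob1.mk (circles P α) :=
      Cob1.sound (Cobordant.of_iso
        { arc := e
          vert := e
          src_arc := fun _ => rfl
          tgt_arc := fun _ => rfl
          fiber := fun i => LinearEquiv.refl R (P (e i))
          transport := fun x y hx i => congrArg (α (e i)) (hx i) })
    rw [← h]
    exact ih this _ _
  · intro _ P α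
    have h : Cob1.mk (circles P α) = Cob1.mk empty :=
      Cob1.sound (Cobordant.of_iso
        { arc := Equiv.equivOfIsEmpty PEmpty Empty
          vert := Equiv.equivOfIsEmpty PEmpty Empty
          src_arc := fun a => a.elim
          tgt_arc := fun a => a.elim
          fiber := fun a => a.elim
          transport := fun x y hx a => a.elim })
    rw [h, Cob1.mk_empty]
    exact zero_mem _
  · intro ι _ ih _ P α
    have h : Cob1.mk (circles P α) =
        Cob1.mk ((circles (fun i => P (some i)) fun i => α (some i)).sum
          (circleFoam (α none))) :=
      Cob1.sound (Cobordant.of_iso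
        { arc := Equiv.optionEquivSumPUnit ι
          vert := Equiv.optionEquivSumPUnit ι
          src_arc := by rintro (_ | a) <;> rfl
          tgt_arc := by rintro (_ | a) <;> rfl
          fiber := fun s => match s with
            | none => LinearEquiv.refl R (P none)
            | some i => LinearEquiv.refl R (P (some i))
          transport := by
            rintro x y hx (_ | i)
            · exact congrArg (α none) (hx none)
            · exact congrArg (α (some i)) (hx (some i)) })
    rw [h, Cob1.mk_sum]
    exact add_mem (ih _ _ _) ⟨kap (α none), delta_kap (α none)⟩

end OneFoam

namespace Matching

variable {R : Type u} [Ring R] {W : OneFoam R} (m : Matching W)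

theorem cast_fiber_apply (z : ∀ a, W.fiber a) {a b : W.Arc} (h : a = b) :
    LinearEquiv.cast (R := R) (M := fun a => W.fiber a) h (z a) = z b := by
  subst h
  rfl

/-- One step along a cycle. -/
def step (a : W.Arc) : W.fiber a ≃ₗ[R] W.fiber (m.perm.symm a) :=
  (LinearEquiv.cast (R := R) (M := fun a => W.fiber a) (m.perm.apply_symm_apply a).symm).trans
    (m.iso (m.perm.symm a)).symm

theorem total_symm_apply_perm_symm (x : ∀ a, W.fiber a) (a : W.Arc) :
    m.total.symm x (m.perm.symm a) = m.step a (x a) := by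
  rw [total_symm_apply, step, LinearEquiv.trans_apply, cast_fiber_apply x]

/-- Several steps along a cycle. -/
def walk (a : W.Arc) : ∀ k, W.fiber a ≃ₗ[R] W.fiber (chain m.perm.symm a k)
  | 0 => LinearEquiv.refl R (W.fiber a)
  | k + 1 => (walk a k).trans (m.step (chain m.perm.symm a k))

theorem total_symm_apply_chain (y : ∀ a, W.fiber a) (a : W.Arc) (k : ℕ) {ξ : W.fiber a}
    (h : y (chain m.perm.symm a k) = m.walk a k ξ) :
    m.total.symm y (chain m.perm.symm a (k + 1)) = m.walk a (k + 1) ξ :=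
  (m.total_symm_apply_perm_symm y _).trans (congrArg (m.step _) h)

/-- The monodromy along a cycle. -/
def monodromy {a : W.Arc} {k : ℕ} (h : chain m.perm.symm a k = a) : W.fiber a ≃ₗ[R] W.fiber a :=
  (m.walk a k).trans (LinearEquiv.cast (R := R) (M := fun a => W.fiber a) h)

section

variable {ι : Type} [Finite ι] {n : ι → ℕ} {x : ι → W.Arc}
  (hx : ∀ o, chain m.perm.symm (x o) (n o + 1) = x o)

/-- The circles along the cycles of `perm`, before subdivision. -/
def cycleFoam : OneFoam R := OneFoam.circles (fun o => W.fiber (x o)) fun o => m.monodromy (hx o)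

/-- The original vertex of a circle corresponds to the last arc because in `Matching.circles` every
arc ends at the vertex named after it. -/
def cycleVert (n : ι → ℕ) : ι ⊕ (Σ o, Fin (n o)) ≃ Σ o, Fin (n o + 1) where
  toFun := Sum.elim (fun o => ⟨o, Fin.last (n o)⟩) fun s => ⟨s.1, s.2.castSucc⟩
  invFun s := Fin.lastCases (motive := fun _ => ι ⊕ (Σ o, Fin (n o))) (Sum.inl s.1)
    (fun j => Sum.inr ⟨s.1, j⟩) s.2
  left_inv := by rintro (o | ⟨o, j⟩) <;> simp
  right_inv := by
    rintro ⟨o, i⟩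
    refine Fin.lastCases ?_ (fun j => ?_) i <;> simp

/-- The circles of a matching are subdivisions of its cycles. -/
def circlesIso
    (hb : Function.Bijective (fun s : Σ o, Fin (n o + 1) => chain m.perm.symm (x s.1) s.2)) :
    FlatGraph.Iso ((m.cycleFoam hx).subdivide n) m.circles where
  arc := Equiv.ofBijective _ hb
  vert := (cycleVert n).trans (Equiv.ofBijective _ hb)
  src_arc := by
    rintro ⟨o, i⟩
    refine Fin.cases ?_ (fun j => ?_) i
    · change m.perm (x o) = chain m.perm.symm (x o) (n o)
      rw [← Equiv.eq_symm_apply]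
      exact (hx o).symm
    · exact m.perm.apply_symm_apply _
  tgt_arc := by
    rintro ⟨o, i⟩
    refine Fin.lastCases ?_ (fun j => ?_) i
    · exact (congrArg ((cycleVert n).trans (Equiv.ofBijective _ hb))
        (FlatGraph.subdivide_tgt_last (m.cycleFoam hx).toFlatGraph n o)).symm
    · exact (congrArg ((cycleVert n).trans (Equiv.ofBijective _ hb))
        (FlatGraph.subdivide_tgt_castSucc (m.cycleFoam hx).toFlatGraph n o j)).symm
  fiber s := m.walk (x s.1) s.2
  transport := by
    rintro z y h ⟨o, i⟩
    refine Fin.cases ?_ (fun j => ?_) i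
    · have h1 := m.total_symm_apply_chain y (x o) (n o) (h ⟨o, Fin.last (n o)⟩)
      have h2 := cast_fiber_apply (m.total.symm y) (hx o)
      rw [h1] at h2
      exact h2.symm
    · exact m.total_symm_apply_chain y (x o) j (h ⟨o, j.castSucc⟩)

end

/-- The matched foam is minus the union of its inner circles, which are a subdivision of finitely
many circles without vertices. -/
theorem mk_mem (m : Matching W) : Cob1.mk W ∈ (delta R).range := by
  -- The inner circles run against `perm`: the arc `a` is followed by `perm.symm a`.
  obtain ⟨ι, _, n, x, hb, hx⟩ := exists_cycles m.perm.symm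
  rw [eq_neg_of_add_eq_zero_left (m.mk_add_mk_eq_zero (X := m.cycleFoam hx) n (m.circlesIso hx hb).symm)]
  exact neg_mem (OneFoam.mk_circles_mem _ _)

end Matching

/-! ### Multisets of labels -/

section Labels

variable {A B V W γ δ : Type*}

/-- The multiset of values of a function on a finite type. -/
def labels [Finite A] (c : A → γ) : Multiset γ :=
  letI := Fintype.ofFinite A
  Finset.univ.val.map c

theorem labels_eq [Fintype A] (c : A → γ) : labels c = Finset.univ.val.map c := by
  rw [labels, Subsingleton.elim (Fintype.ofFinite A)]

theorem card_labels [Finite A] (c : A → γ) : (labels c).card = Nat.card A := by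
  have := Fintype.ofFinite A
  rw [labels_eq, Multiset.card_map, Nat.card_eq_fintype_card]
  rfl

theorem labels_equiv [Finite A] [Finite B] (e : A ≃ B) {c : A → γ} {d : B → γ}
    (h : ∀ a, d (e a) = c a) : labels c = labels d := by
  have := Fintype.ofFinite A
  have := Fintype.ofFinite B
  rw [labels_eq, labels_eq, ← Finset.univ_map_equiv_to_embedding e, Finset.map_val,
    Multiset.map_map]
  exact Multiset.map_congr rfl fun a _ => (h a).symm

theorem labels_eq_of_isEmpty [Finite A] [IsEmpty A] (c : A → γ) : labels c = 0 :=
  Multiset.card_eq_zero.1 (by rw [card_labels, Nat.card_of_isEmpty])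

theorem labels_unique [Unique A] (c : A → γ) : labels c = {c default} := by
  rw [labels_eq]
  rfl

theorem count_labels [Finite A] [DecidableEq γ] (c : A → γ) (y : γ) :
    (labels c).count y = Nat.card {a // c a = y} := by
  have := Fintype.ofFinite A
  rw [labels_eq, Multiset.count_map, Nat.card_eq_fintype_card, Fintype.card_subtype]
  congr 1
  exact Multiset.filter_congr fun a _ => eq_comm

/-- Each label occurs equally often, so the fibers over it are in bijection; these bijections are
assembled. -/
theorem exists_equiv_of_labels_eq [Finite A] [Finite B] {c : A → γ} {d : B → γ}
    (h : labels c = labels d) : ∃ e : A ≃ B, ∀ a, d (e a) = c a := by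
  classical
  have hc : ∀ y, Nonempty ({a // c a = y} ≃ {b // d b = y}) := fun y => by
    rw [← Finite.card_eq, ← count_labels, ← count_labels, h]
  let f := fun y => (hc y).some
  refine ⟨(Equiv.sigmaFiberEquiv c).symm.trans ((Equiv.sigmaCongrRight f).trans
    (Equiv.sigmaFiberEquiv d)), fun a => ?_⟩
  exact (f (c a) ⟨a, rfl⟩).2

theorem sum_map_labels [Fintype A] [AddCommMonoid δ] (c : A → γ) (g : γ → δ) :
    ((labels c).map g).sum = ∑ a, g (c a) := by
  rw [labels_eq, Multiset.map_map]
  rfl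

/-- The labels of the elements of the fiber of `f` over `v`. -/
def star [Finite A] (f : A → V) (c : A → γ) (v : V) : Multiset γ :=
  labels fun a : {a // f a = v} => c a

theorem card_star [Finite A] (f : A → V) (c : A → γ) (v : V) :
    (star f c v).card = Nat.card {a // f a = v} := card_labels _

theorem star_inl [Finite A] [Finite B] (f : A → V) (g : B → W) (c : A ⊕ B → γ) (v : V) :
    star (Sum.map f g) c (Sum.inl v) = star f (c ∘ Sum.inl) v :=
  (labels_equiv (A := {a // f a = v}) (B := {s // Sum.map f g s = Sum.inl v})
    { toFun := fun a => ⟨Sum.inl a.1, congrArg Sum.inl a.2⟩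
      invFun := fun s => match s with
        | ⟨Sum.inl a, h⟩ => ⟨a, Sum.inl_injective h⟩
        | ⟨Sum.inr _, h⟩ => absurd h (by simp)
      left_inv := fun _ => rfl
      right_inv := by rintro ⟨a | b, h⟩ <;> [rfl; exact absurd h (by simp)] } fun _ => rfl).symm

theorem star_inr [Finite A] [Finite B] (f : A → V) (g : B → W) (c : A ⊕ B → γ) (w : W) :
    star (Sum.map f g) c (Sum.inr w) = star g (c ∘ Sum.inr) w :=
  (labels_equiv (A := {b // g b = w}) (B := {s // Sum.map f g s = Sum.inr w})
    { toFun := fun a => ⟨Sum.inr a.1, congrArg Sum.inr a.2⟩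
      invFun := fun s => match s with
        | ⟨Sum.inr a, h⟩ => ⟨a, Sum.inr_injective h⟩
        | ⟨Sum.inl _, h⟩ => absurd h (by simp)
      left_inv := fun _ => rfl
      right_inv := by rintro ⟨a | b, h⟩ <;> [exact absurd h (by simp); rfl] } fun _ => rfl).symm

theorem sum_sum_star [Fintype A] [Fintype V] [AddCommMonoid δ] (f : A → V) (c : A → γ)
    (g : γ → δ) : ∑ v, ((star f c v).map g).sum = ∑ a, g (c a) := by
  classical
  simp only [star, sum_map_labels]
  rw [← Fintype.sum_sigma']
  exact Fintype.sum_equiv (Equiv.sigmaFiberEquiv f) _ _ fun _ => rfl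

theorem star_eq_singleton [Finite A] {f : A → V} (c : A → γ) {v : V}
    (h : Nat.card {a // f a = v} = 1) : ∃ a, (∀ x, f x = v ↔ x = a) ∧ star f c v = {c a} := by
  obtain ⟨_, ⟨a⟩⟩ := Nat.card_eq_one_iff_unique.1 h
  have : Unique {a // f a = v} := ⟨⟨a⟩, fun b => Subsingleton.elim _ _⟩
  refine ⟨(default : {a // f a = v}), fun x => ⟨fun h => ?_, ?_⟩, labels_unique _⟩
  · exact congrArg Subtype.val (Subsingleton.elim ⟨x, h⟩ (default : {a // f a = v}))
  · rintro rfl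
    exact (default : {a // f a = v}).2

end Labels

/-! ### The monoid of isomorphism classes -/

section IsoClass

/-- Isomorphism of finitely generated projective modules. -/
def isoSetoid (R : Type u) [Ring R] : Setoid (FGProj R) where
  r P Q := Nonempty (P ≃ₗ[R] Q)
  iseqv := ⟨fun P => ⟨LinearEquiv.refl R P⟩, fun ⟨e⟩ => ⟨e.symm⟩, fun ⟨e⟩ ⟨f⟩ => ⟨e.trans f⟩⟩

/-- The isomorphism classes of finitely generated projective modules. -/
def IsoClass (R : Type u) [Ring R] : Type (u + 1) := Quotient (isoSetoid R)

variable {R : Type u} [Ring R]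

/-- The isomorphism class of `P`. -/
def isoClass (P : FGProj R) : IsoClass R := Quotient.mk (isoSetoid R) P

theorem isoClass_eq_iff {P Q : FGProj R} : isoClass P = isoClass Q ↔ Nonempty (P ≃ₗ[R] Q) :=
  Quotient.eq (r := isoSetoid R)

theorem isoClass_eq {P Q : FGProj R} (e : P ≃ₗ[R] Q) : isoClass P = isoClass Q :=
  isoClass_eq_iff.2 ⟨e⟩

theorem exists_isoClass (x : IsoClass R) : ∃ P, isoClass P = x := Quotient.exists_rep x

instance : Add (IsoClass R) :=
  ⟨Quotient.map₂ FGProj.prod fun _ _ ⟨e⟩ _ _ ⟨f⟩ => ⟨LinearEquiv.prodCongr e f⟩⟩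

instance : Zero (IsoClass R) := ⟨isoClass ⟨PUnit⟩⟩

theorem isoClass_prod (P Q : FGProj R) : isoClass (P.prod Q) = isoClass P + isoClass Q := rfl

theorem isoClass_of_subsingleton (P : FGProj R) [Subsingleton P] : isoClass P = 0 :=
  isoClass_eq (0 : P ≃ₗ[R] PUnit.{u + 1})

/-- Addition is the direct sum. -/
instance : AddCommMonoid (IsoClass R) where
  add_assoc x y z := by
    obtain ⟨P, rfl⟩ := exists_isoClass x
    obtain ⟨Q, rfl⟩ := exists_isoClass y
    obtain ⟨S, rfl⟩ := exists_isoClass z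
    exact isoClass_eq (P := (P.prod Q).prod S) (Q := P.prod (Q.prod S))
      (LinearEquiv.prodAssoc R P Q S)
  zero_add x := by
    obtain ⟨P, rfl⟩ := exists_isoClass x
    exact isoClass_eq (P := FGProj.prod ⟨PUnit⟩ P) (LinearEquiv.uniqueProd : (PUnit.{u + 1} × P) ≃ₗ[R] P)
  add_zero x := by
    obtain ⟨P, rfl⟩ := exists_isoClass x
    exact isoClass_eq (P := FGProj.prod P ⟨PUnit⟩) (LinearEquiv.prodUnique : (P × PUnit.{u + 1}) ≃ₗ[R] P)
  add_comm x y := by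
    obtain ⟨P, rfl⟩ := exists_isoClass x
    obtain ⟨Q, rfl⟩ := exists_isoClass y
    exact isoClass_eq (P := P.prod Q) (Q := Q.prod P) (LinearEquiv.prodComm R P Q)
  nsmul := nsmulRec

theorem isoClass_pi {ι : Type} [Finite ι] (P : ι → FGProj R) :
    isoClass (FGProj.pi P) = (labels fun i => isoClass (P i)).sum := by
  suffices H : ∀ (ι : Type) (_ : Finite ι) (P : ι → FGProj R),
      isoClass (FGProj.pi P) = (labels fun i => isoClass (P i)).sum from H ι inferInstance P
  intro ι hι
  refine Finite.induction_empty_option (P := fun ι => ∀ (_ : Finite ι) (P : ι → FGProj R),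
    isoClass (FGProj.pi P) = (labels fun i => isoClass (P i)).sum) ?_ ?_ ?_ ι hι
  · intro ι κ e ih _ P
    have := Finite.of_equiv _ e.symm
    rw [← labels_equiv e fun _ => rfl, ← ih this fun i => P (e i)]
    exact isoClass_eq (LinearEquiv.piCongrLeft R (fun k => (P k).carrier) e).symm
  · intro _ P
    rw [labels_eq_of_isEmpty]
    have : Subsingleton (FGProj.pi P) := inferInstanceAs (Subsingleton (∀ i : PEmpty, P i))
    exact isoClass_of_subsingleton _
  · intro ι _ ih _ P
    have h : isoClass (FGProj.pi P) =
        isoClass ((P none).prod (FGProj.pi fun i => P (some i))) :=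
      isoClass_eq (LinearEquiv.piOptionEquivProd R (M := fun k => (P k).carrier))
    rw [h, isoClass_prod, ih inferInstance]
    simp only [labels_eq]
    exact (Fintype.sum_option fun i => isoClass (P i)).symm

end IsoClass

/-! ### Vertex isomorphisms and the defect -/

namespace FlatGraph

variable {R : Type u} [Ring R] (G : FlatGraph R)

/-- The extension by zero of a section over the arcs ending at `v`. -/
def extend (f : G.Arc → G.Vert) (v : G.Vert) :
    (∀ a : {a // f a = v}, G.fiber a) →ₗ[R] ∀ a, G.fiber a :=
  letI := Classical.decEq G.Vert
  { toFun := fun x a => if h : f a = v then x ⟨a, h⟩ else 0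
    map_add' := fun x y => by
      funext a
      by_cases h : f a = v <;> simp [h]
    map_smul' := fun c x => by
      funext a
      by_cases h : f a = v <;> simp [h] }

theorem extend_apply (f : G.Arc → G.Vert) (v : G.Vert) (x : ∀ a : {a // f a = v}, G.fiber a)
    {a : G.Arc} (h : f a = v) : G.extend f v x a = x ⟨a, h⟩ := dif_pos h

/-- The isomorphism at a vertex. -/
def vertexIso (v : G.Vert) :
    (∀ a : {a // G.tgt a = v}, G.fiber a) ≃ₗ[R] ∀ b : {b // G.src b = v}, G.fiber b where
  toFun x b := G.transport (G.extend G.tgt v x) b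
  invFun y a := G.transport.symm (G.extend G.src v y) a
  map_add' x y := by
    funext b
    rw [map_add, map_add]
    rfl
  map_smul' c x := by
    funext b
    rw [map_smul, map_smul]
    rfl
  left_inv x := by
    funext ⟨a, ha⟩
    beta_reduce
    rw [G.transport_symm_local _ (G.transport (G.extend G.tgt v x)) a fun b hb => by
      rw [extend_apply _ _ _ _ (hb.trans ha)], LinearEquiv.symm_apply_apply,
      extend_apply _ _ _ _ ha]
  right_inv y := by
    funext ⟨b, hb⟩
    beta_reduce
    rw [G.transport_local _ (G.transport.symm (G.extend G.src v y)) b fun a ha => by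
      rw [extend_apply _ _ _ _ (ha.trans hb)], LinearEquiv.apply_symm_apply,
      extend_apply _ _ _ _ hb]

theorem vertexIso_apply (v : G.Vert) (x : ∀ a, G.fiber a) (b : {b // G.src b = v}) :
    G.vertexIso v (fun a => x a) b = G.transport x b :=
  G.transport_local _ _ _ fun _ ha => extend_apply _ _ _ _ (ha.trans b.2)

/-- The isomorphism classes of the fibers over the arcs ending at a vertex. -/
def inClasses (v : G.Vert) : Multiset (IsoClass R) := star G.tgt (fun a => isoClass (G.fiber a)) v

/-- The isomorphism classes of the fibers over the arcs beginning at a vertex. -/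
def outClasses (v : G.Vert) : Multiset (IsoClass R) :=
  star G.src (fun a => isoClass (G.fiber a)) v

theorem card_inClasses (v : G.Vert) : (G.inClasses v).card = G.inDeg v := card_star _ _ _

theorem card_outClasses (v : G.Vert) : (G.outClasses v).card = G.outDeg v := card_star _ _ _

theorem sum_inClasses (v : G.Vert) : (G.inClasses v).sum = (G.outClasses v).sum :=
  (isoClass_pi _).symm.trans ((isoClass_eq (P := FGProj.pi fun a : {a // G.tgt a = v} => G.fiber a)
    (Q := FGProj.pi fun b : {b // G.src b = v} => G.fiber b) (G.vertexIso v)).trans (isoClass_pi _))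

theorem sum_outClasses_eq_sum_inClasses [Fintype G.Arc] [Fintype G.Vert] {M : Type*}
    [AddCommMonoid M] (g : IsoClass R → M) :
    ∑ v, ((G.outClasses v).map g).sum = ∑ v, ((G.inClasses v).map g).sum :=
  (sum_sum_star _ _ _).trans (sum_sum_star _ _ _).symm

/-- The formal difference between the classes at the two sides of a vertex. -/
def vertexDefect (v : G.Vert) : FreeAbelianGroup (Multiset (IsoClass R)) :=
  FreeAbelianGroup.of (G.inClasses v) - FreeAbelianGroup.of (G.outClasses v)

/-- The formal sum, over all vertices, of the differences between the classes at the two sides of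
the vertex. -/
def defect : FreeAbelianGroup (Multiset (IsoClass R)) :=
  letI := Fintype.ofFinite G.Vert
  ∑ v, G.vertexDefect v

theorem defect_eq [Fintype G.Vert] : G.defect = ∑ v, G.vertexDefect v := by
  rw [defect, Subsingleton.elim (Fintype.ofFinite G.Vert)]

theorem defect_reverse : G.reverse.defect = - G.defect := by
  have := Fintype.ofFinite G.Vert
  let : Fintype G.reverse.Vert := this
  rw [defect_eq, defect_eq, ← Finset.sum_neg_distrib]
  exact Fintype.sum_equiv (Equiv.refl G.Vert) G.reverse.vertexDefect (fun v => - G.vertexDefect v)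
    fun v => (neg_sub _ _).symm

theorem defect_sum (G' : FlatGraph R) : (G.sum G').defect = G.defect + G'.defect := by
  have h1 := Fintype.ofFinite G.Vert
  have h2 := Fintype.ofFinite G'.Vert
  let : Fintype (G.sum G').Vert := inferInstanceAs (Fintype (G.Vert ⊕ G'.Vert))
  rw [defect_eq, defect_eq, defect_eq]
  refine (Fintype.sum_sum_type (G.sum G').vertexDefect).trans (congrArg₂ (· + ·)
    (Fintype.sum_congr _ G.vertexDefect fun v => ?_)
    (Fintype.sum_congr _ G'.vertexDefect fun v => ?_))
  · exact congrArg₂ (fun s t => FreeAbelianGroup.of s - FreeAbelianGroup.of t)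
      (star_inl _ _ _ _) (star_inl _ _ _ _)
  · exact congrArg₂ (fun s t => FreeAbelianGroup.of s - FreeAbelianGroup.of t)
      (star_inr _ _ _ _) (star_inr _ _ _ _)

theorem defect_empty : (FlatGraph.empty : FlatGraph R).defect = 0 := by
  have : Fintype (FlatGraph.empty : FlatGraph R).Vert := inferInstanceAs (Fintype Empty)
  have : IsEmpty (FlatGraph.empty : FlatGraph R).Vert := inferInstanceAs (IsEmpty Empty)
  rw [defect_eq, Fintype.sum_empty]

/-- In a free abelian group the vanishing means that each multiset occurs equally often as the
incoming and as the outgoing classes of a vertex. -/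
theorem exists_perm_of_defect_eq_zero (h : G.defect = 0) :
    ∃ e : Equiv.Perm G.Vert, ∀ v, G.outClasses (e v) = G.inClasses v := by
  classical
  have := Fintype.ofFinite G.Vert
  refine exists_equiv_of_labels_eq (Multiset.ext.2 fun s => ?_)
  -- The homomorphism reading off the coefficient of `s`.
  have hs := congrArg (FreeAbelianGroup.lift fun t => if t = s then (1 : ℤ) else 0) h
  rw [defect_eq, map_sum, map_zero] at hs
  simp only [vertexDefect, map_sub, FreeAbelianGroup.lift_apply_of, Finset.sum_sub_distrib, sub_eq_zero,
    Finset.sum_boole] at hs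
  rw [count_labels, count_labels, Nat.card_eq_fintype_card, Nat.card_eq_fintype_card,
    Fintype.card_subtype, Fintype.card_subtype]
  exact_mod_cast hs

end FlatGraph

/-- A permutation with prescribed restrictions to fibers. -/
theorem exists_perm_of_fiberwise {A V : Type*} {f g : A → V} {p : V → V}
    (hp : ∀ v, p (p v) = v) (E : ∀ v, {a // f a = v} ≃ {a // g a = p v}) :
    ∃ e : Equiv.Perm A, ∀ a, e a = E (f a) ⟨a, rfl⟩ :=
  ⟨(Equiv.sigmaFiberEquiv f).symm.trans ((Equiv.sigmaCongrRight E).trans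
    ((Equiv.sigmaCongrLeft (β := fun v => {a // g a = v}) (⟨p, p, hp, hp⟩ : V ≃ V)).trans
      (Equiv.sigmaFiberEquiv g))), fun _ => rfl⟩

/-! ### Defect zero implies cobordant to circles -/

namespace OneFoam

variable {R : Type u} [Ring R] (W : OneFoam R)

/-- The isomorphism along the thick facet at a seam. -/
theorem exists_thick_iso {v w : W.Vert} (hv : W.outDeg v = 1) (hw : W.inDeg w = 1)
    (e : Equiv.Perm W.Arc) (he : ∀ a, W.tgt a = v ↔ W.src (e a) = w)
    (φ : ∀ a, W.tgt a = v → (W.fiber a ≃ₗ[R] W.fiber (e a)))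
    {d : W.Arc} (hd : W.tgt d = w) (hed : W.src (e d) = v) :
    ∃ i : W.fiber d ≃ₗ[R] W.fiber (e d), ∀ x y : (∀ a, W.fiber a),
      (∀ a h, φ a h (y a) = W.transport x (e a)) → i (x d) = W.transport y (e d) := by
  obtain ⟨h1, -⟩ := Nat.card_eq_one_iff_unique.1 hv
  obtain ⟨h2, -⟩ := Nat.card_eq_one_iff_unique.1 hw
  let : Unique {a // W.tgt a = w} := ⟨⟨⟨d, hd⟩⟩, fun _ => Subsingleton.elim _ _⟩
  let : Unique {a // W.src a = v} := ⟨⟨⟨e d, hed⟩⟩, fun _ => Subsingleton.elim _ _⟩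
  let ε : {a // W.tgt a = v} ≃ {a // W.src a = w} := e.subtypeEquiv he
  let Φ : (∀ a : {a // W.tgt a = v}, W.fiber a) ≃ₗ[R] ∀ b : {b // W.src b = w}, W.fiber b :=
    (LinearEquiv.piCongrRight fun a : {a // W.tgt a = v} => φ a a.2).trans
      (LinearEquiv.piCongrLeft R (fun b : {b // W.src b = w} => (W.fiber b).carrier) ε)
  have hΦ : ∀ (y : ∀ a : {a // W.tgt a = v}, W.fiber a) (a : {a // W.tgt a = v}),
      Φ y (ε a) = φ a a.2 (y a) := fun y a =>
    Equiv.piCongrLeft_apply_apply (fun b : {b // W.src b = w} => (W.fiber b).carrier) ε _ a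
  let L : (∀ a : {a // W.tgt a = w}, W.fiber a) ≃ₗ[R] W.fiber d :=
    { toFun := fun x => x ⟨d, hd⟩
      invFun := fun ξ a => LinearEquiv.cast (R := R) (M := fun a => W.fiber a)
        (congrArg Subtype.val (Subsingleton.elim ⟨d, hd⟩ a)) ξ
      map_add' := fun _ _ => rfl
      map_smul' := fun _ _ => rfl
      left_inv := fun x => by
        funext a
        obtain rfl : ⟨d, hd⟩ = a := Subsingleton.elim _ _
        rfl
      right_inv := fun _ => rfl }
  let L' : (∀ a : {a // W.src a = v}, W.fiber a) ≃ₗ[R] W.fiber (e d) :=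
    { toFun := fun x => x ⟨e d, hed⟩
      invFun := fun ξ a => LinearEquiv.cast (R := R) (M := fun a => W.fiber a)
        (congrArg Subtype.val (Subsingleton.elim ⟨e d, hed⟩ a)) ξ
      map_add' := fun _ _ => rfl
      map_smul' := fun _ _ => rfl
      left_inv := fun x => by
        funext a
        obtain rfl : ⟨e d, hed⟩ = a := Subsingleton.elim _ _
        rfl
      right_inv := fun _ => rfl }
  -- Cross the vertex `w`, return through `φ` to the arcs ending at `v`, and cross `v`.
  refine ⟨L.symm.trans ((W.vertexIso w).trans (Φ.symm.trans ((W.vertexIso v).trans L'))),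
    fun x y h => ?_⟩
  have hx : L.symm (x d) = fun a : {a // W.tgt a = w} => x a :=
    L.symm_apply_eq.2 rfl
  have hy : Φ (fun a => y a) = W.vertexIso w (fun a : {a // W.tgt a = w} => x a) := by
    funext b
    obtain ⟨a, rfl⟩ := ε.surjective b
    rw [hΦ, h, FlatGraph.vertexIso_apply]
    rfl
  simp only [LinearEquiv.trans_apply]
  rw [hx, ← hy, LinearEquiv.symm_apply_apply]
  exact W.vertexIso_apply v y ⟨e d, hed⟩

/-- At a positive vertex the fibers are identified by arbitrary isomorphisms. The isomorphism along
the single arc ending at its partner is then determined by the two vertex isomorphisms, and this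
choice is what makes the crossing an involution. -/
theorem exists_matching (partner : W.Vert → W.Vert) (pos : W.Vert → Bool)
    (hp : ∀ v, partner (partner v) = v) (hpos : ∀ v, pos (partner v) = !pos v)
    (hout : ∀ v, pos v = true → W.outDeg v = 1)
    (hin : ∀ v, pos v = true → W.inDeg (partner v) = 1)
    (hcls : ∀ v, pos v = true → W.outClasses (partner v) = W.inClasses v) :
    Nonempty (Matching W) := by
  have hE : ∀ v, ∃ E : {a // W.tgt a = v} ≃ {a // W.src a = partner v}, pos v = true →
      ∀ a : {a // W.tgt a = v}, Nonempty (W.fiber a ≃ₗ[R] W.fiber (E a)) := by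
    intro v
    rcases h : pos v with _ | _
    · have h' : pos (partner v) = true := by rw [hpos, h]; rfl
      have h1 := hin _ h'
      rw [hp] at h1
      have h2 := hout _ h'
      have : Nonempty ({a // W.tgt a = v} ≃ {a // W.src a = partner v}) :=
        Finite.card_eq.1 (h1.trans h2.symm)
      exact ⟨this.some, fun h => absurd h Bool.false_ne_true⟩
    · obtain ⟨E, hE⟩ := exists_equiv_of_labels_eq (hcls v h).symm
      exact ⟨E, fun _ a => isoClass_eq_iff.1 (hE a).symm⟩
  choose E hE using hE
  obtain ⟨e, he⟩ := exists_perm_of_fiberwise hp E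
  have hsrc : ∀ a, W.src (e a) = partner (W.tgt a) := fun a => by
    rw [he]
    exact (E (W.tgt a) ⟨a, rfl⟩).2
  have hiff : ∀ v a, W.tgt a = v ↔ W.src (e a) = partner v := fun v a => by
    rw [hsrc]
    exact ⟨congrArg _, fun h => by rw [← hp (W.tgt a), h, hp]⟩
  have hφ : ∀ a, pos (W.tgt a) = true → Nonempty (W.fiber a ≃ₗ[R] W.fiber (e a)) := fun a h => by
    rw [he]
    exact hE _ h ⟨a, rfl⟩
  let φ : ∀ a, pos (W.tgt a) = true → (W.fiber a ≃ₗ[R] W.fiber (e a)) := fun a h => (hφ a h).some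
  have hi : ∀ a, ∃ i : W.fiber a ≃ₗ[R] W.fiber (e a), (∀ h, i = φ a h) ∧
      (pos (W.tgt a) = false → ∀ x y : (∀ a, W.fiber a),
        (∀ b, W.tgt b = partner (W.tgt a) → ∀ h, φ b h (y b) = W.transport x (e b)) →
        i (x a) = W.transport y (e a)) := by
    intro a
    by_cases h : pos (W.tgt a) = true
    · exact ⟨φ a h, fun _ => rfl, fun h' => absurd (h.symm.trans h') Bool.false_ne_true.symm⟩
    · have h' : pos (partner (W.tgt a)) = true := by simpa [hpos] using h
      obtain ⟨i, hi⟩ := W.exists_thick_iso (w := W.tgt a) (hout _ h')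
        (by rw [← hp (W.tgt a)]; exact hin _ h') e
        (fun b => (hiff _ b).trans (by rw [hp])) (fun b hb => φ b (by rw [hb, h'])) rfl (hsrc a)
      exact ⟨i, fun h' => absurd h' h,
        fun _ x y hxy => hi x y fun b hb => hxy b hb (by rw [hb, h'])⟩
  choose i hi hi' using hi
  refine ⟨⟨partner, pos, hp, hpos, e, i, hsrc, fun x y z hy hz => funext fun a => ?_⟩⟩
  rcases h : pos (W.tgt a) with _ | _
  · exact (i a).injective ((hz a).trans (hi' a h x y fun b _ hb => by rw [← hi b hb, hy]).symm)
  · have h' : pos (partner (W.tgt a)) = false := by rw [hpos, h]; rfl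
    -- `x'` is a section whose crossing is `x`. It agrees with `y` on the arcs ending at the partner
    -- vertex, which is all that transport sees.
    obtain ⟨x', hx'⟩ : ∃ x' : (∀ a, W.fiber a), ∀ b, W.transport x' (e b) = i b (x b) := by
      refine ⟨W.transport.symm (((LinearEquiv.piCongrRight i).trans
        (LinearEquiv.piCongrLeft R (fun a => (W.fiber a).carrier) e)) x), fun b => ?_⟩
      rw [LinearEquiv.apply_symm_apply]
      exact Equiv.piCongrLeft_apply_apply (fun b => (W.fiber b).carrier) e _ b
    refine (i a).injective ?_
    rw [hz, ← hx']
    refine W.transport_local _ _ _ fun d hd => ?_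
    rw [hsrc] at hd
    refine (i d).injective ?_
    rw [hy, hi' d (by rw [hd, h']) x' x fun b _ hb => by rw [← hi b hb, hx']]

theorem inClasses_of_loop {v : W.Vert} (h : W.inDeg v = 1) {a : W.Arc} (ha : W.tgt a = v) :
    W.inClasses v = {isoClass (W.fiber a)} := by
  obtain ⟨b, hb, h'⟩ := star_eq_singleton (fun a => isoClass (W.fiber a)) h
  rw [(hb a).1 ha]
  exact h'

/-- The vertices which are base points of circles. -/
def BasePoint : Type := {v : W.Vert // W.inDeg v = 1 ∧ W.outDeg v = 1}

instance : Finite W.BasePoint := inferInstanceAs (Finite {v : W.Vert // W.inDeg v = 1 ∧ W.outDeg v = 1})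

theorem exists_loop (l : W.BasePoint) : ∃ a, W.src a = l.1 ∧ W.tgt a = l.1 := by
  obtain ⟨v, h, h'⟩ := l
  rcases W.valence v with ⟨h1, -⟩ | ⟨-, h1⟩ | ⟨-, -, h1⟩
  · omega
  · omega
  · exact h1

/-- Trivial circles, one for each circle of the foam. -/
def trivialCircles : OneFoam R :=
  circles (fun l => W.fiber (W.exists_loop l).choose) fun _ => LinearEquiv.refl R _

theorem trivialCircles_inDeg (l : W.BasePoint) : W.trivialCircles.inDeg l = 1 :=
  Nat.card_eq_one_iff_unique.2
    ⟨⟨fun a b => Subtype.ext (a.2.trans b.2.symm)⟩, ⟨⟨l, rfl⟩⟩⟩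

theorem outClasses_trivialCircles (l : W.BasePoint) :
    W.trivialCircles.outClasses l = W.inClasses l.1 := by
  rw [W.inClasses_of_loop l.2.1 (W.exists_loop l).choose_spec.2]
  exact W.trivialCircles.inClasses_of_loop (W.trivialCircles_inDeg l) rfl

variable {W}

section

variable (e : Equiv.Perm W.Vert)

open Classical in
/-- The pairing of vertices induced by a permutation. -/
def pairing : W.Vert ⊕ W.BasePoint → W.Vert ⊕ W.BasePoint
  | Sum.inl v => if h : W.inDeg v = 1 ∧ W.outDeg v = 1 then Sum.inr ⟨v, h⟩ else
      if W.inDeg v = 2 then Sum.inl (e v) else Sum.inl (e.symm v)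
  | Sum.inr l => Sum.inl l.1

theorem pairing_base {v : W.Vert} (h : W.inDeg v = 1 ∧ W.outDeg v = 1) :
    pairing e (Sum.inl v) = Sum.inr ⟨v, h⟩ := dif_pos h

theorem pairing_in {v : W.Vert} (h : W.inDeg v = 2) : pairing e (Sum.inl v) = Sum.inl (e v) := by
  rw [pairing, dif_neg (by omega), if_pos h]

theorem pairing_out {v : W.Vert} (h : W.outDeg v = 2) (h' : W.inDeg v = 1) :
    pairing e (Sum.inl v) = Sum.inl (e.symm v) := by
  rw [pairing, dif_neg (by omega), if_neg (by omega)]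

end

/-- The permutation pairs each merging vertex with a splitting vertex having the same classes. A
base point of a circle has no such opposite, so it is paired with an added trivial circle with the
same fiber; the added circles are in the image and can be cancelled. -/
theorem mk_mem_of_defect_eq_zero (h : W.defect = 0) : Cob1.mk W ∈ (delta R).range := by
  obtain ⟨e, he⟩ := W.exists_perm_of_defect_eq_zero h
  have hdeg : ∀ v, W.outDeg (e v) = W.inDeg v := fun v => by
    rw [← FlatGraph.card_inClasses, ← FlatGraph.card_outClasses, he]
  have hval : ∀ v, (W.inDeg v = 2 ∧ W.outDeg v = 1) ∨ (W.inDeg v = 1 ∧ W.outDeg v = 2) ∨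
      (W.inDeg v = 1 ∧ W.outDeg v = 1) := fun v => by
    rcases W.valence v with h | h | h <;> tauto
  have hin : ∀ v, W.inDeg v = 2 → W.outDeg (e v) = 2 ∧ W.inDeg (e v) = 1 := fun v hv => by
    have := hdeg v
    have := hval (e v)
    omega
  have hout : ∀ v, W.outDeg v = 2 →
      W.inDeg (e.symm v) = 2 ∧ W.outDeg (e.symm v) = 1 := fun v hv => by
    have h1 := hdeg (e.symm v)
    have := hval (e.symm v)
    rw [e.apply_symm_apply] at h1
    omega
  let W' := W.sum W.trivialCircles
  have hdi : ∀ v, W'.inDeg (Sum.inl v) = W.inDeg v := fun v => card_fiber_inl _ _ _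
  have hdo : ∀ v, W'.outDeg (Sum.inl v) = W.outDeg v := fun v => card_fiber_inl _ _ _
  have hci : ∀ v, W'.inClasses (Sum.inl v) = W.inClasses v := fun v => star_inl _ _ _ _
  have hco : ∀ v, W'.outClasses (Sum.inl v) = W.outClasses v := fun v => star_inl _ _ _ _
  have hXi : ∀ l, W'.inDeg (Sum.inr l) = 1 := fun l =>
    (card_fiber_inr _ _ _).trans (W.trivialCircles_inDeg l)
  have hXo : ∀ l, W'.outClasses (Sum.inr l) = W.inClasses l.1 := fun l =>
    (star_inr _ _ _ _).trans (W.outClasses_trivialCircles l)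
  -- Positive are the merging vertices and base points of `W`, negative the splitting vertices and
  -- the added circles.
  let pos : W.Vert ⊕ W.BasePoint → Bool :=
    Sum.elim (fun v => decide (W.outDeg v = 1)) fun _ => false
  have hpp : ∀ s, pairing e (pairing e s) = s := by
    rintro (v | l)
    · rcases hval v with ⟨h1, h2⟩ | ⟨h1, h2⟩ | h1
      · rw [pairing_in e h1, pairing_out e (hin v h1).1 (hin v h1).2, e.symm_apply_apply]
      · rw [pairing_out e h2 h1, pairing_in e (hout v h2).1, e.apply_symm_apply]
      · rw [pairing_base e h1]
        rfl
    · exact pairing_base e l.2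
  have hpos : ∀ s, pos (pairing e s) = !pos s := by
    rintro (v | l)
    · rcases hval v with ⟨h1, h2⟩ | ⟨h1, h2⟩ | h1
      · rw [pairing_in e h1]
        simp [pos, h2, (hin v h1).1]
      · rw [pairing_out e h2 h1]
        simp [pos, h2, (hout v h2).2]
      · rw [pairing_base e h1]
        simp only [pos, Sum.elim_inl, h1.2, decide_true]
        rfl
    · change decide (W.outDeg l.1 = 1) = true
      simp [l.2.2]
  have hm : Nonempty (Matching W') := by
    refine W'.exists_matching (pairing e) pos hpp hpos ?_ ?_ ?_
    · rintro (v | l) hv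
      · exact (hdo v).trans (of_decide_eq_true hv)
      · exact absurd hv Bool.false_ne_true
    · rintro (v | l) hv
      · have hv' : W.outDeg v = 1 := of_decide_eq_true hv
        rcases hval v with ⟨h1, h2⟩ | ⟨h1, h2⟩ | h1
        · exact (congrArg W'.inDeg (pairing_in e h1)).trans ((hdi _).trans (hin v h1).2)
        · omega
        · exact (congrArg W'.inDeg (pairing_base e h1)).trans (hXi _)
      · exact absurd hv Bool.false_ne_true
    · rintro (v | l) hv
      · have hv' : W.outDeg v = 1 := of_decide_eq_true hv
        rcases hval v with ⟨h1, h2⟩ | ⟨h1, h2⟩ | h1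
        · exact (congrArg W'.outClasses (pairing_in e h1)).trans
            ((hco _).trans ((he v).trans (hci v).symm))
        · omega
        · exact (congrArg W'.outClasses (pairing_base e h1)).trans ((hXo _).trans (hci v).symm)
      · exact absurd hv Bool.false_ne_true
  have h1 := hm.some.mk_mem
  rw [Cob1.mk_sum] at h1
  exact (AddSubgroup.add_mem_cancel_right _ (mk_circles_mem _ _)).1 h1

end OneFoam

/-! ### The universal merging cocycle and its extension -/

section Cocycle

open FreeAbelianGroup

variable {M : Type*} [AddCommMonoid M]

/-- The formal difference between a pair and its sum. -/
def merge (a b : M) : FreeAbelianGroup (Multiset M) := of {a, b} - of {a + b}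

/-- The failure of the cocycle condition for `merge`. -/
def associator (a b c : M) : FreeAbelianGroup (Multiset M) :=
  merge b c + merge a (b + c) - merge a b - merge (a + b) c

variable (M) in
/-- The subgroup generated by the associators. -/
def associators : AddSubgroup (FreeAbelianGroup (Multiset M)) :=
  AddSubgroup.closure {x | ∃ a b c, x = associator a b c}

/-- `merge`, with values modulo the associators. -/
def mergeClass (a b : M) : FreeAbelianGroup (Multiset M) ⧸ associators M :=
  QuotientAddGroup.mk (merge a b)

theorem mergeClass_comm (a b : M) : mergeClass a b = mergeClass b a := by
  rw [mergeClass, mergeClass, merge, merge, Multiset.pair_comm, add_comm a b]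

theorem mergeClass_assoc (a b c : M) :
    mergeClass b c + mergeClass a (b + c) = mergeClass a b + mergeClass (a + b) c := by
  have h : (QuotientAddGroup.mk (associator a b c) : FreeAbelianGroup (Multiset M) ⧸ associators M) = 0 :=
    (QuotientAddGroup.eq_zero_iff _).2 (AddSubgroup.subset_closure ⟨a, b, c, rfl⟩)
  rw [associator, QuotientAddGroup.mk_sub, QuotientAddGroup.mk_sub, sub_sub, sub_eq_zero] at h
  exact h

/-- This is the associator of `a, 0, 0`. The cocycle is not normalized, whence the corrections by
`mergeClass 0 0` in the zero of `MergeExt` and in `incl`. -/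
theorem mergeClass_zero (a : M) : mergeClass a 0 = mergeClass 0 (0 : M) := by
  have h := mergeClass_assoc a 0 0
  rw [add_zero, add_zero] at h
  exact (add_right_cancel h).symm

variable (M) in
/-- The extension of `M` defined by the cocycle `mergeClass`. -/
@[ext]
structure MergeExt where
  fst : M
  snd : FreeAbelianGroup (Multiset M) ⧸ associators M

namespace MergeExt

instance : Add (MergeExt M) := ⟨fun x y => ⟨x.1 + y.1, x.2 + y.2 + mergeClass x.1 y.1⟩⟩

instance : Zero (MergeExt M) := ⟨⟨0, - mergeClass 0 0⟩⟩

instance : AddCommMonoid (MergeExt M) where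
  add_assoc x y z := by
    refine MergeExt.ext (add_assoc _ _ _) ?_
    change x.2 + y.2 + mergeClass x.1 y.1 + z.2 + mergeClass (x.1 + y.1) z.1 =
      x.2 + (y.2 + z.2 + mergeClass y.1 z.1) + mergeClass x.1 (y.1 + z.1)
    have h := mergeClass_assoc x.1 y.1 z.1
    calc _ = x.2 + y.2 + z.2 + (mergeClass x.1 y.1 + mergeClass (x.1 + y.1) z.1) := by abel
      _ = _ := by
        rw [← h]
        abel
  add_comm x y := by
    refine MergeExt.ext (add_comm _ _) ?_
    change x.2 + y.2 + mergeClass x.1 y.1 = y.2 + x.2 + mergeClass y.1 x.1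
    rw [add_comm x.2, mergeClass_comm]
  zero_add x := by
    refine MergeExt.ext (zero_add _) ?_
    change - mergeClass 0 0 + x.2 + mergeClass 0 x.1 = x.2
    rw [mergeClass_comm 0 x.1, mergeClass_zero x.1]
    abel
  add_zero x := by
    refine MergeExt.ext (add_zero _) ?_
    change x.2 + - mergeClass 0 0 + mergeClass x.1 0 = x.2
    rw [mergeClass_zero x.1]
    abel
  nsmul := nsmulRec

/-- The inclusion of the kernel. -/
def incl : (FreeAbelianGroup (Multiset M) ⧸ associators M) →+ MergeExt M where
  toFun g := ⟨0, g - mergeClass 0 0⟩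
  map_zero' := MergeExt.ext rfl (zero_sub _)
  map_add' g h := by
    refine MergeExt.ext (add_zero _).symm ?_
    change g + h - _ = (g - _) + (h - _) + _
    abel

theorem add_incl (x : MergeExt M) (g : FreeAbelianGroup (Multiset M) ⧸ associators M) :
    x + incl g = ⟨x.1, x.2 + g⟩ := by
  refine MergeExt.ext (add_zero _) ?_
  change x.2 + (g - _) + mergeClass x.1 0 = x.2 + g
  rw [mergeClass_zero x.1]
  abel

/-- The kernel translates the second component, which lies in a group. Hence it acts freely although
`M` need not be cancellative. -/
theorem eq_zero_of_add_incl {x : MergeExt M} {g : FreeAbelianGroup (Multiset M) ⧸ associators M}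
    (h : x + incl g = x) : g = 0 := by
  rw [add_incl] at h
  exact add_eq_left.1 (congrArg MergeExt.snd h)

/-- The section of the extension. -/
def lift (a : M) : MergeExt M := ⟨a, 0⟩

theorem lift_add_lift (a b : M) : lift a + lift b = lift (a + b) + incl (mergeClass a b) := by
  rw [add_incl]
  refine MergeExt.ext rfl ?_
  change 0 + 0 + mergeClass a b = 0 + mergeClass a b
  abel

end MergeExt

end Cocycle

/-! ### Removing the defect by tetrahedra -/

namespace OneFoam

variable {R : Type u} [Ring R] (W : OneFoam R)

/-- At a merging vertex this is the cocycle formula `lift_add_lift`, at a splitting vertex the same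
formula reversed; at a base point the two sides have the same class. -/
theorem sum_lift_inClasses (v : W.Vert) :
    ((W.inClasses v).map MergeExt.lift).sum =
      ((W.outClasses v).map MergeExt.lift).sum +
        MergeExt.incl (QuotientAddGroup.mk (W.vertexDefect v)) := by
  have hs := W.sum_inClasses v
  rw [FlatGraph.vertexDefect]
  rcases W.valence v with ⟨h1, h2⟩ | ⟨h1, h2⟩ | ⟨h1, h2, -⟩
  · obtain ⟨x, y, hi⟩ := Multiset.card_eq_two.1 ((W.card_inClasses v).trans h1)
    obtain ⟨z, ho⟩ := Multiset.card_eq_one.1 ((W.card_outClasses v).trans h2)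
    rw [hi, ho] at hs ⊢
    simp only [Multiset.sum_pair, Multiset.sum_singleton] at hs
    subst hs
    simp only [Multiset.insert_eq_cons, Multiset.map_cons, Multiset.map_singleton,
      Multiset.sum_cons, Multiset.sum_singleton]
    exact MergeExt.lift_add_lift x y
  · obtain ⟨z, hi⟩ := Multiset.card_eq_one.1 ((W.card_inClasses v).trans h1)
    obtain ⟨x, y, ho⟩ := Multiset.card_eq_two.1 ((W.card_outClasses v).trans h2)
    rw [hi, ho] at hs ⊢
    simp only [Multiset.sum_pair, Multiset.sum_singleton] at hs
    subst hs
    rw [← neg_sub, QuotientAddGroup.mk_neg]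
    simp only [Multiset.insert_eq_cons, Multiset.map_cons, Multiset.map_singleton,
      Multiset.sum_cons, Multiset.sum_singleton]
    rw [MergeExt.lift_add_lift, add_assoc, ← map_add]
    rw [show mergeClass x y + - (QuotientAddGroup.mk (FreeAbelianGroup.of (x ::ₘ {y}) -
      FreeAbelianGroup.of {x + y})) = 0 from add_neg_cancel _, map_zero, add_zero]
  · obtain ⟨x, hi⟩ := Multiset.card_eq_one.1 ((W.card_inClasses v).trans h1)
    obtain ⟨y, ho⟩ := Multiset.card_eq_one.1 ((W.card_outClasses v).trans h2)
    rw [hi, ho] at hs ⊢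
    simp only [Multiset.sum_singleton] at hs
    rw [hs, sub_self, QuotientAddGroup.mk_zero, map_zero, add_zero]

/-- The sum of `lift` over all arcs is the same whether grouped by targets or by sources. The two
groupings differ by the defect, viewed in the kernel of the extension, which acts freely. -/
theorem defect_mem_associators : W.defect ∈ associators (IsoClass R) := by
  have := Fintype.ofFinite W.Vert
  have := Fintype.ofFinite W.Arc
  have h := W.sum_outClasses_eq_sum_inClasses MergeExt.lift
  simp only [sum_lift_inClasses, Finset.sum_add_distrib] at h
  rw [← map_sum] at h
  have h' := MergeExt.eq_zero_of_add_incl h.symm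
  rw [← QuotientAddGroup.eq_zero_iff, FlatGraph.defect_eq, ← h']
  exact map_sum (QuotientAddGroup.mk' (associators (IsoClass R))) _ _

/-- One end of the cylinder over `W` is left collapsed to a point, which is then an interior point
of a foam with link `W`. -/
theorem mk_eq_zero_of_isVertexLink (h : W.IsVertexLink) : Cob1.mk W = 0 := by
  let f : FlatGraph.Iso W.toFlatGraph (FlatGraph.sigma fun _ : Unit => W.toFlatGraph) :=
    { arc := (Equiv.uniqueSigma fun _ : Unit => W.Arc).symm
      vert := (Equiv.uniqueSigma fun _ : Unit => W.Vert).symm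
      src_arc := fun _ => rfl
      tgt_arc := fun _ => rfl
      fiber := fun a => LinearEquiv.refl R (W.fiber a)
      transport := fun x y h a => congrArg (fun z => W.transport z a) (funext h) }
  have hc : Cobordant W OneFoam.empty :=
    ⟨PolygonComplex.cylinder W, Unit, inferInstance, fun _ => W.toFlatGraph, fun _ => h,
      fun _ => 0, ⟨(PolygonComplex.linkCylinder W).trans ((FlatGraph.Iso.sumCongr
        ((FlatGraph.Iso.emptySum _).symm.trans (FlatGraph.Iso.sumComm _ _)) f).trans
          (FlatGraph.Iso.subdivideZero _))⟩⟩
  exact Cob1.sound hc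

/-- The closed foam around a vertex of a 2-foam. -/
def tetrahedron (P Q S : FGProj R) : OneFoam R where
  Arc := Fin 6
  Vert := Fin 4
  finite_arc := inferInstance
  finite_vert := inferInstance
  -- Arcs `0, …, 5` are `a₁, a₂, a₃, a₁₂, a₂₃, a₁₂₃` and vertices `0, …, 3` are `v₁, …, v₄` of
  -- `IsTetrahedronLink`.
  src := ![1, 1, 0, 0, 2, 3]
  tgt := ![3, 2, 2, 1, 3, 0]
  fiber := ![P, Q, S, P.prod Q, Q.prod S, (P.prod Q).prod S]
  transport :=
    { toFun := fun x a => match a with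
        | 0 => (x 3 : P × Q).1
        | 1 => (x 3 : P × Q).2
        | 2 => (x 5 : (P × Q) × S).2
        | 3 => (x 5 : (P × Q) × S).1
        | 4 => ((x 1 : Q), (x 2 : S))
        | 5 => (((x 0 : P), (x 4 : Q × S).1), (x 4 : Q × S).2)
      invFun := fun x a => match a with
        | 0 => (x 5 : (P × Q) × S).1.1
        | 1 => (x 4 : Q × S).1
        | 2 => (x 4 : Q × S).2
        | 3 => ((x 0 : P), (x 1 : Q))
        | 4 => ((x 5 : (P × Q) × S).1.2, (x 5 : (P × Q) × S).2)
        | 5 => ((x 3 : P × Q), (x 2 : S))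
      map_add' := fun x y => by
        funext a
        fin_cases a <;> rfl
      map_smul' := fun c x => by
        funext a
        fin_cases a <;> rfl
      left_inv := fun x => by
        funext a
        fin_cases a <;> rfl
      right_inv := fun x => by
        funext a
        fin_cases a <;> rfl }
  transport_local x y b h := by
    fin_cases b
    · exact congrArg (fun z : P × Q => z.1) (h 3 rfl)
    · exact congrArg (fun z : P × Q => z.2) (h 3 rfl)
    · exact congrArg (fun z : (P × Q) × S => z.2) (h 5 rfl)
    · exact congrArg (fun z : (P × Q) × S => z.1) (h 5 rfl)
    · exact Prod.ext (h 1 rfl) (h 2 rfl)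
    · exact Prod.ext (Prod.ext (h 0 rfl) (congrArg (fun z : Q × S => z.1) (h 4 rfl)))
        (congrArg (fun z : Q × S => z.2) (h 4 rfl))
  valence v := by
    have h : ∀ (f : Fin 6 → Fin 4), Nat.card {a // f a = v} =
        (Finset.univ.filter fun a => f a = v).card :=
      fun f => by rw [Nat.card_eq_fintype_card, Fintype.card_subtype]
    have hi := h ![3, 2, 2, 1, 3, 0]
    have ho := h ![1, 1, 0, 0, 2, 3]
    fin_cases v
    · exact Or.inr (Or.inl ⟨hi, ho⟩)
    · exact Or.inr (Or.inl ⟨hi, ho⟩)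
    · exact Or.inl ⟨hi, ho⟩
    · exact Or.inl ⟨hi, ho⟩

theorem mk_tetrahedron (P Q S : FGProj R) : Cob1.mk (tetrahedron P Q S) = 0 := by
  refine mk_eq_zero_of_isVertexLink _ (Or.inr (Or.inr ⟨(0 : Fin 6), (1 : Fin 6), (2 : Fin 6),
    (3 : Fin 6), (4 : Fin 6), (5 : Fin 6), (0 : Fin 4), (1 : Fin 4), (2 : Fin 4), (3 : Fin 4),
    (by decide : ([0, 1, 2, 3, 4, 5] : List (Fin 6)).Nodup),
    (by decide : ∀ b : Fin 6, b ∈ [0, 1, 2, 3, 4, 5]),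
    (by decide : ([0, 1, 2, 3] : List (Fin 4)).Nodup),
    (by decide : ∀ z : Fin 4, z ∈ [0, 1, 2, 3]), rfl, rfl, rfl, rfl, rfl, rfl, rfl, rfl, rfl, rfl,
    rfl, rfl, fun (ξ : (P × Q) × S) => ⟨fun (a : Fin 6) => match a with
        | 0 => ξ.1.1
        | 1 => ξ.1.2
        | 2 => ξ.2
        | 3 => ξ.1
        | 4 => (ξ.1.2, ξ.2)
        | 5 => ξ, funext fun (a : Fin 6) => ?_, rfl⟩⟩))
  fin_cases a <;> rfl

theorem defect_tetrahedron (P Q S : FGProj R) :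
    (tetrahedron P Q S).defect = associator (isoClass P) (isoClass Q) (isoClass S) := by
  let : Fintype (tetrahedron P Q S).Vert := inferInstanceAs (Fintype (Fin 4))
  have h : ∀ (f : Fin 6 → Fin 4) (c : Fin 6 → IsoClass R) (v : Fin 4),
      star f c v = (Finset.univ.filter fun a => f a = v).val.map c := fun f c v => by
    rw [star, labels_eq, ← Finset.subtype_univ, ← Finset.subtype_map, Finset.map_val,
      Multiset.map_map]
    rfl
  have hi : ∀ v : Fin 4, (tetrahedron P Q S).inClasses v = _ := fun v => h _ _ v
  have ho : ∀ v : Fin 4, (tetrahedron P Q S).outClasses v = _ := fun v => h _ _ v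
  have hd : ∀ v : Fin 4, (tetrahedron P Q S).vertexDefect v = _ := fun v =>
    congrArg₂ (fun s t => FreeAbelianGroup.of s - FreeAbelianGroup.of t) (hi v) (ho v)
  have h0 : (tetrahedron P Q S).vertexDefect (0 : Fin 4) =
      - merge (isoClass P + isoClass Q) (isoClass S) := by
    rw [merge, neg_sub, Multiset.pair_comm]
    exact hd 0
  have h1 : (tetrahedron P Q S).vertexDefect (1 : Fin 4) = - merge (isoClass P) (isoClass Q) := by
    rw [merge, neg_sub]
    exact hd 1
  have h2 : (tetrahedron P Q S).vertexDefect (2 : Fin 4) = merge (isoClass Q) (isoClass S) :=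
    hd 2
  have h3 : (tetrahedron P Q S).vertexDefect (3 : Fin 4) =
      merge (isoClass P) (isoClass Q + isoClass S) := by
    -- The thick fiber is bracketed as `(P × Q) × S`.
    rw [merge, ← add_assoc]
    exact hd 3
  rw [FlatGraph.defect_eq]
  refine (Fin.sum_univ_four (tetrahedron P Q S).vertexDefect).trans ?_
  rw [associator, h0, h1, h2, h3]
  abel

/-- Tetrahedra realize the generators, disjoint unions the sums and reversals the negatives. -/
theorem exists_mk_eq_zero_of_mem_associators {n : FreeAbelianGroup (Multiset (IsoClass R))}
    (hn : n ∈ associators (IsoClass R)) : ∃ W : OneFoam R, Cob1.mk W = 0 ∧ W.defect = n := by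
  induction hn using AddSubgroup.closure_induction with
  | mem x hx =>
    obtain ⟨a, b, c, rfl⟩ := hx
    obtain ⟨P, rfl⟩ := exists_isoClass a
    obtain ⟨Q, rfl⟩ := exists_isoClass b
    obtain ⟨S, rfl⟩ := exists_isoClass c
    exact ⟨_, mk_tetrahedron P Q S, defect_tetrahedron P Q S⟩
  | zero => exact ⟨empty, rfl, FlatGraph.defect_empty⟩
  | add x y _ _ hx hy =>
    obtain ⟨W, h, rfl⟩ := hx
    obtain ⟨X, h', rfl⟩ := hy
    exact ⟨W.sum X, by rw [Cob1.mk_sum, h, h', add_zero], FlatGraph.defect_sum _ _⟩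
  | neg x _ hx =>
    obtain ⟨W, h, rfl⟩ := hx
    exact ⟨W.reverse, by rw [Cob1.mk_reverse, h, neg_zero], FlatGraph.defect_reverse _⟩

/-- Subtracting a null-cobordant foam of the same defect reduces to defect zero. -/
theorem mk_mem_range_delta : Cob1.mk W ∈ (delta R).range := by
  obtain ⟨X, hX, h⟩ := exists_mk_eq_zero_of_mem_associators W.defect_mem_associators
  have h' : (W.sum X.reverse).defect = 0 := by
    have := (FlatGraph.defect_sum W.toFlatGraph X.reverse.toFlatGraph).trans
      (congrArg (W.defect + ·) (FlatGraph.defect_reverse _))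
    rw [h, add_neg_cancel] at this
    exact this
  have hm := mk_mem_of_defect_eq_zero h'
  rwa [Cob1.mk_sum, Cob1.mk_reverse, hX, neg_zero, add_zero] at hm

end OneFoam

/-! ### Conclusion: `γ` and `δ` are mutually inverse -/

theorem delta_surjective (R : Type u) [Ring R] : Function.Surjective (delta R) :=
  Cob1.ind OneFoam.mk_mem_range_delta

theorem gamma_bijective (R : Type u) [Ring R] : Function.Bijective (gamma R) :=
  ⟨((delta_surjective R).forall₂).2 fun x y h => by
    rw [gamma_delta, gamma_delta] at h
    rw [h], fun x => ⟨delta R x, gamma_delta x⟩⟩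

end RFoam
end

theorem theorem5p12 (R : Type u) [Ring R] :
    ∃ γ : RFoam.Cob1 R ≃+ RFoam.K1 R ⧸ (RFoam.tau R).range,
      ∀ (U : RFoam.OneFoam R) (B : U.StrongCut),
        γ (RFoam.Cob1.mk U) =
          QuotientAddGroup.mk (RFoam.K1.cls (U.cutModule B) (U.cutMap B)) :=
  ⟨AddEquiv.ofBijective (RFoam.gamma R) (RFoam.gamma_bijective R), RFoam.gamma_mk_strongCut⟩
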